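/- Let $n\ge 0$. A \emph{configuration} of $n$ arcs consists of $n$ arcs in $\mathbb{R}\times[0,1]$ joining the points $(1,0),\dots,(n,0)$ bijectively to the points $(1,1),\dots,(n,1)$, such that the projection of each arc to the $y$-coordinate is a homeomorphism onto $[0,1]$ (so each arc is the graph $x=f_i(y)$ of a continuous function on $[0,1]$) and no three arcs share a common point. Two configurations are \emph{equivalent}, i.e. represent the same \emph{twin}, if they are connected by a homotopy through configurations with the ends of the arcs fixed. A \emph{diagram} is a configuration in which every arc is the graph $x=f_i(y)$ of a $C^\infty$ function on $[0,1]$ and any two arcs cross transversally; a diagram equivalent to a configuration $p$ is called a \emph{representative} of $p$. A \emph{bigon} of a diagram is a closed disc bounded by two segments of arcs with the same two double points as ends and meeting no other arc; a diagram without bigons is \emph{bigon-free} (two-sided regions cut off by the line $y=0$ or $y=1$, which are adjacent to the exterior of the strip, are not bigons in this sense). A \emph{$(-2)$ move} removes a bigon: inside a disc that meets only two arcs, which have just the two corners of the bigon as common points there, these two arcs are replaced by two disjoint arcs, and nothing is changed elsewhere; the result is again a diagram. Theorem. Let $p$ be a configuration. Then $p$ has a representative, and from every representative $D$ of $p$ one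 obtains, by finitely many (possibly zero) successive $(-2)$ moves, a bigon-free representative $D^r$ of $p$. This bigon-free representative is unique up to diffeomorphism: if $D$ and $D'$ are representatives of $p$ and $D^r$, ${D'}^r$ are any bigon-free diagrams obtained from $D$ and $D'$, respectively, by successive $(-2)$ moves, then there is a $C^\infty$ diffeomorphism of $\mathbb{R}^2$ that fixes each of the points $(1,0),\dots,(n,0),(1,1),\dots,(n,1)$ and maps $D^r$ onto ${D'}^r$, arc by arc. -/

import Mathlib

open scoped ContDiff

/-- A configuration of `n` monotone arcs in `ℝ × [0, 1]` without triple points.  Since the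
projection of an arc to the `y`-coordinate is a homeomorphism onto `[0, 1]`, an arc is the graph
`x = arc i y` of a continuous function on `[0, 1]`.  The arc `i` is the one that starts at the
`i`-th bottom point `(i + 1, 0)` (`i = 0, …, n - 1`).  Values outside `[0, 1]` play no role. -/
structure Configuration (n : ℕ) where
  arc : Fin n → ℝ → ℝ
  continuousOn : ∀ i, ContinuousOn (arc i) (Set.Icc 0 1)
  bottom : ∀ i, arc i 0 = (i : ℝ) + 1
  top : ∃ π : Equiv.Perm (Fin n), ∀ i, arc i 1 = (π i : ℝ) + 1
  no_triple : ∀ i j k, i ≠ j → j ≠ k → i ≠ k → ∀ y ∈ Set.Icc (0 : ℝ) 1,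
    ¬ (arc i y = arc j y ∧ arc j y = arc k y)

namespace Configuration

variable {n : ℕ}

/-- The arc `i` as a subset of the plane. -/
def arcSet (C : Configuration n) (i : Fin n) : Set (ℝ × ℝ) :=
  {z | z.2 ∈ Set.Icc (0 : ℝ) 1 ∧ z.1 = C.arc i z.2}

/-- Two configurations are equivalent (represent the same twin) if they are connected by a
homotopy through configurations, with the ends of the arcs fixed. -/
def Equivalent (C C' : Configuration n) : Prop :=
  ∃ H : ℝ → Configuration n,
    (∀ i, ContinuousOn (fun z : ℝ × ℝ => (H z.1).arc i z.2)
      (Set.Icc (0 : ℝ) 1 ×ˢ Set.Icc (0 : ℝ) 1)) ∧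
    (∀ i, ∀ y ∈ Set.Icc (0 : ℝ) 1, (H 0).arc i y = C.arc i y) ∧
    (∀ i, ∀ y ∈ Set.Icc (0 : ℝ) 1, (H 1).arc i y = C'.arc i y) ∧
    (∀ t ∈ Set.Icc (0 : ℝ) 1, ∀ i, (H t).arc i 0 = C.arc i 0 ∧ (H t).arc i 1 = C.arc i 1)

end Configuration

/-- A diagram: a configuration whose arcs are smooth (restrictions to `[0, 1]` of smooth functions
on `ℝ`) and all of whose double points are transverse.  Double points lie in `0 < y < 1`, because
distinct arcs have distinct ends. -/
structure Diagram (n : ℕ) extends Configuration n where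
  smooth : ∀ i, ∃ g : ℝ → ℝ, ContDiff ℝ ∞ g ∧ Set.EqOn (arc i) g (Set.Icc 0 1)
  transverse : ∀ i j, i ≠ j → ∀ y ∈ Set.Icc (0 : ℝ) 1,
    arc i y = arc j y → deriv (arc i) y ≠ deriv (arc j) y

namespace Diagram

variable {n : ℕ}

/-- The arcs `i` (left side) and `j` (right side) bound a bigon with its corners at the double
points of height `a < b`: the closed disc between the two arcs meets no other arc. -/
def IsBigon (D : Diagram n) (i j : Fin n) (a b : ℝ) : Prop :=
  0 ≤ a ∧ a < b ∧ b ≤ 1 ∧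
  D.arc i a = D.arc j a ∧ D.arc i b = D.arc j b ∧
  (∀ y ∈ Set.Ioo a b, D.arc i y < D.arc j y) ∧
  (∀ k, k ≠ i → k ≠ j → ∀ y ∈ Set.Icc a b, D.arc k y ∉ Set.Icc (D.arc i y) (D.arc j y))

/-- No bigon with two double points as corners.  (Two-sided regions cut off by the line `y = 0` or
`y = 1`, which are adjacent to the exterior of the strip, are allowed.) -/
def BigonFree (D : Diagram n) : Prop :=
  ∀ i j a b, ¬ D.IsBigon i j a b

/-- `D'` is obtained from `D` by a `(-2)` move: a bigon bounded by the arcs `i` and `j` is removed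
inside a disc at the heights `c ≤ y ≤ d` that meets no other arc.  In the disc, `i` and `j` have in
`D` just the two corners of the bigon as common points, and none in `D'`; outside the disc nothing
changes. -/
def MinusTwo (D D' : Diagram n) : Prop :=
  ∃ (i j : Fin n) (a b c d : ℝ), D.IsBigon i j a b ∧ 0 ≤ c ∧ c < a ∧ b < d ∧ d ≤ 1 ∧
    (∀ k, k ≠ i → k ≠ j → ∀ y ∈ Set.Icc (0 : ℝ) 1, D'.arc k y = D.arc k y) ∧
    (∀ k, ∀ y ∈ Set.Icc (0 : ℝ) 1, y ∉ Set.Ioo c d → D'.arc k y = D.arc k y) ∧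
    (∀ y ∈ Set.Icc c d, D.arc i y = D.arc j y → y = a ∨ y = b) ∧
    (∀ y ∈ Set.Icc c d, D'.arc i y ≠ D'.arc j y) ∧
    (∀ k, k ≠ i → k ≠ j → ∀ y ∈ Set.Icc c d,
      (D.arc k y < D.arc i y ∧ D.arc k y < D.arc j y ∧
        D.arc k y < D'.arc i y ∧ D.arc k y < D'.arc j y) ∨
      (D.arc i y < D.arc k y ∧ D.arc j y < D.arc k y ∧
        D'.arc i y < D.arc k y ∧ D'.arc j y < D.arc k y))

/-- `R` is a bigon-free diagram obtained from `D` by successive `(-2)` moves. -/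
def IsReduction (D R : Diagram n) : Prop :=
  Relation.ReflTransGen MinusTwo D R ∧ R.BigonFree

/-- `D` is a representative of (the twin of) the configuration `p`. -/
def Represents (D : Diagram n) (p : Configuration n) : Prop :=
  p.Equivalent D.toConfiguration

/-- A smooth diffeomorphism of the plane that fixes all ends of arcs carries `D` to `D'`. -/
def PlaneDiffeomorphic (D D' : Diagram n) : Prop :=
  ∃ Φ : ℝ × ℝ ≃ ℝ × ℝ, ContDiff ℝ ∞ Φ ∧ ContDiff ℝ ∞ Φ.symm ∧
    (∀ m : Fin n, Φ ((m : ℝ) + 1, 0) = ((m : ℝ) + 1, 0) ∧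
      Φ ((m : ℝ) + 1, 1) = ((m : ℝ) + 1, 1)) ∧
    ∀ i, Φ '' D.arcSet i = D'.arcSet i

end Diagram

/-! Existence of a representative is an approximation argument. Compactness keeps a configuration at
a positive distance from triple points, so polynomial arcs close to the given ones and with the same
ends are reached by a straight-line homotopy; small multiples of `X (1 - X)` make all crossings
transverse (`Diagram.exists_represents`). Every bigon can be removed, a (-2) move is a homotopy, and
it lowers the finite number of double points, so reduction terminates
(`Diagram.exists_isReduction`).

For uniqueness, record for each arc the list of the arcs that it crosses, in order. These lists
forget only the relative heights of crossings that can be slid past each other: diagrams with the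
same lists are diffeomorphic (`Diagram.planeDiffeomorphic_of_reads`). Indeed the topmost double
point of one diagram can be pulled up to the same height in both, and induction on the number of
remaining crossings leads to two diagrams whose arcs are in the same order at every height. These
are matched by a diffeomorphism preserving all horizontal lines, patched together from local ones by
convex combination (`Diagram.planeDiffeomorphic_of_same_order`).

It remains to see that equivalent bigon-free diagrams have the same lists. A finely sampled path of
positions has a state: a swap of two arcs puts each on the list of the other, but if each is already
the last partner of the other, these entries are cancelled instead (`crossPairs`). This is reduction
of words in involutions, distant ones commuting, carried out on the lists. Since there are no triple
points, only disjoint pairs can swap within a small piece of a homotopy, and then the change of the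
state depends on the initial and the final position alone. Hence the final state is invariant under
homotopy (`Configuration.Equivalent.exists_mesh`). In a bigon-free diagram a cancellation would
exhibit a bigon, so its final state consists of its lists (`Diagram.BigonFree.reads_stateAlong`). -/

open Set Filter Topology

/-! ### Smooth division by a linear factor. -/

section Division

theorem hasDerivAt_moment {g : ℝ → ℝ} (hg : ContDiff ℝ ∞ g) (m : ℕ) (y : ℝ) :
    HasDerivAt (fun y => ∫ t in (0 : ℝ)..1, t ^ m * g (t * y))
      (∫ t in (0 : ℝ)..1, t ^ (m + 1) * deriv g (t * y)) y := by
  have hc : Continuous g := hg.continuous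
  have hc' : Continuous (deriv g) := hg.continuous_deriv (by simp)
  obtain ⟨C, hC⟩ := (isCompact_Icc (a := -(|y| + 1)) (b := |y| + 1)).exists_bound_of_continuousOn
    hc'.continuousOn
  refine (intervalIntegral.hasDerivAt_integral_of_dominated_loc_of_deriv_le
    (F := fun y t => t ^ m * g (t * y)) (F' := fun y t => t ^ (m + 1) * deriv g (t * y))
    (bound := fun _ => C)
    (Metric.ball_mem_nhds y one_pos) ?_ ?_ ?_ ?_ ?_ ?_).2
  · exact Eventually.of_forall fun z =>
      (by fun_prop : Continuous fun t : ℝ => t ^ m * g (t * z)).aestronglyMeasurable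
  · exact (by fun_prop : Continuous fun t : ℝ => t ^ m * g (t * y)).intervalIntegrable _ _
  · exact (by fun_prop : Continuous fun t : ℝ =>
      t ^ (m + 1) * deriv g (t * y)).aestronglyMeasurable
  · refine Eventually.of_forall fun t ht z hz => ?_
    rw [uIoc_of_le zero_le_one] at ht
    rw [norm_mul, norm_pow]
    have h1 : ‖t‖ ≤ 1 := by rw [Real.norm_eq_abs, abs_of_pos ht.1]; exact ht.2
    have hz' : |z| ≤ |y| + 1 := by
      have h2 := abs_sub_abs_le_abs_sub z y
      rw [Metric.mem_ball, Real.dist_eq] at hz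
      linarith
    have h3 : |t * z| ≤ |y| + 1 := by
      rw [abs_mul]
      calc |t| * |z| ≤ 1 * |z| := by gcongr; exact h1
        _ ≤ _ := by linarith
    have h4 := hC (t * z) (abs_le.1 h3)
    calc ‖t‖ ^ (m + 1) * ‖deriv g (t * z)‖ ≤ 1 * ‖deriv g (t * z)‖ := by
          gcongr; exact pow_le_one₀ (norm_nonneg _) h1
      _ ≤ C := by linarith
  · exact intervalIntegrable_const
  · refine Eventually.of_forall fun t _ z _ => ?_
    have h1 : HasDerivAt g (deriv g (t * z)) (t * z) :=
      (hg.differentiable (by simp) _).hasDerivAt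
    have h2 : HasDerivAt (fun z => t * z) t z := by simpa using (hasDerivAt_id z).const_mul t
    have h3 := (h1.comp z h2).const_mul (t ^ m)
    rw [show t ^ m * (deriv g (t * z) * t) = t ^ (m + 1) * deriv g (t * z) by ring] at h3
    exact h3

/-- Differentiation in `y` brings out a factor `t` and replaces `g` by its derivative. The weight `t
^ m` is there so that the derivative is an integral of the same kind and the induction on the order
of differentiability closes. -/
theorem contDiff_moment {g : ℝ → ℝ} (hg : ContDiff ℝ ∞ g) (m : ℕ) :
    ContDiff ℝ ∞ (fun y => ∫ t in (0 : ℝ)..1, t ^ m * g (t * y)) := by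
  rw [contDiff_infty]
  intro k
  induction k generalizing g m with
  | zero =>
    exact contDiff_zero.2 (continuous_iff_continuousAt.2 fun y =>
      (hasDerivAt_moment hg m y).continuousAt)
  | succ k ih =>
    have : ((k + 1 : ℕ) : WithTop ℕ∞) = (k : WithTop ℕ∞) + 1 := by norm_cast
    rw [this, contDiff_succ_iff_deriv]
    refine ⟨fun y => (hasDerivAt_moment hg m y).differentiableAt, by simp, ?_⟩
    rw [funext fun y => (hasDerivAt_moment hg m y).deriv]
    exact ih (contDiff_infty_iff_deriv.1 hg).2 (m + 1)

/-- Hadamard's lemma in one variable. -/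
theorem exists_contDiff_eq_add_mul {h : ℝ → ℝ} (hh : ContDiff ℝ ∞ h) (a : ℝ) :
    ∃ k : ℝ → ℝ, ContDiff ℝ ∞ k ∧ k a = deriv h a ∧ ∀ y, h y = h a + (y - a) * k y := by
  have hg : ContDiff ℝ ∞ (fun z => deriv h (a + z)) :=
    (contDiff_infty_iff_deriv.1 hh).2.comp (contDiff_const.add contDiff_id)
  refine ⟨fun y => ∫ t in (0 : ℝ)..1, t ^ 0 * (fun z => deriv h (a + z)) (t * (y - a)),
    (contDiff_moment hg 0).comp (contDiff_id.sub contDiff_const), by simp, fun y => ?_⟩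
  have hd : ∀ t : ℝ, HasDerivAt (fun t => h (a + t * (y - a)))
      ((y - a) * deriv h (a + t * (y - a))) t := fun t => by
    have h1 : HasDerivAt h (deriv h (a + t * (y - a))) (a + t * (y - a)) :=
      (hh.differentiable (by simp) _).hasDerivAt
    have h2 : HasDerivAt (fun t => a + t * (y - a)) (y - a) t := by
      simpa using ((hasDerivAt_id t).mul_const (y - a)).const_add a
    rw [mul_comm]
    exact h1.comp t h2
  have hc : Continuous (deriv h) := hh.continuous_deriv (by simp)
  have := intervalIntegral.integral_eq_sub_of_hasDerivAt (a := 0) (b := 1) (fun t _ => hd t)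
    ((by fun_prop : Continuous fun t => (y - a) * deriv h (a + t * (y - a))).intervalIntegrable _ _)
  rw [intervalIntegral.integral_const_mul] at this
  simp only [pow_zero, one_mul, zero_mul, add_zero, add_sub_cancel] at this ⊢
  linarith

end Division

/-! ### Diffeomorphisms of the plane that preserve the horizontal lines. -/

section FiberDiffeo

/-- By injectivity of `Φ`, the local inverse given by the inverse function theorem agrees with
`Φ.symm` near each point. -/
theorem contDiff_symm_of_forall_hasFDerivAt {E : Type*} [NormedAddCommGroup E] [NormedSpace ℝ E]
    [CompleteSpace E] (Φ : E ≃ E) (hΦ : ContDiff ℝ ∞ Φ)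
    (h : ∀ z, ∃ f' : E ≃L[ℝ] E, HasFDerivAt Φ (f' : E →L[ℝ] E) z) : ContDiff ℝ ∞ Φ.symm := by
  rw [contDiff_iff_contDiffAt]
  intro w
  obtain ⟨z, rfl⟩ := Φ.surjective w
  obtain ⟨f', hf'⟩ := h z
  have hn : (∞ : WithTop ℕ∞) ≠ 0 := by simp
  have h1 := hΦ.contDiffAt.to_localInverse (a := z) hf' hn
  refine h1.congr_of_eventuallyEq ?_
  have h2 := (hΦ.contDiffAt.hasStrictFDerivAt' hf' hn).eventually_right_inverse
  filter_upwards [h2] with y hy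
  rw [Equiv.symm_apply_eq]
  exact hy.symm

/-- A smooth family of increasing bijections of the line is a diffeomorphism of the plane. -/
theorem exists_fiber_diffeo (φ : ℝ × ℝ → ℝ) (hφ : ContDiff ℝ ∞ φ)
    (hpos : ∀ y x, ∃ d, 0 < d ∧ HasDerivAt (fun x => φ (x, y)) d x)
    (htop : ∀ y, Tendsto (fun x => φ (x, y)) atTop atTop)
    (hbot : ∀ y, Tendsto (fun x => φ (x, y)) atBot atBot) :
    ∃ Φ : ℝ × ℝ ≃ ℝ × ℝ, ContDiff ℝ ∞ Φ ∧ ContDiff ℝ ∞ Φ.symm ∧ ∀ z, Φ z = (φ z, z.2) := by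
  have hmono : ∀ y, StrictMono (fun x => φ (x, y)) := fun y =>
    strictMono_of_deriv_pos fun x => by
      obtain ⟨d, hd, h⟩ := hpos y x
      rwa [h.deriv]
  have hsurj : ∀ y, Function.Surjective (fun x => φ (x, y)) := fun y =>
    Continuous.surjective (hφ.continuous.comp (by fun_prop)) (htop y) (hbot y)
  have hbij : Function.Bijective (fun z : ℝ × ℝ => (φ z, z.2)) := by
    constructor
    · rintro ⟨x, y⟩ ⟨x', y'⟩ h
      simp only [Prod.mk.injEq] at h
      obtain ⟨h1, rfl⟩ := h
      rw [(hmono y).injective h1]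
    · rintro ⟨x, y⟩
      obtain ⟨x', hx'⟩ := hsurj y x
      exact ⟨(x', y), by simpa using hx'⟩
  have hsm : ContDiff ℝ ∞ (Equiv.ofBijective _ hbij) := hφ.prodMk contDiff_snd
  refine ⟨Equiv.ofBijective _ hbij, hsm, contDiff_symm_of_forall_hasFDerivAt _ hsm ?_,
    fun z => rfl⟩
  rintro ⟨x, y⟩
  obtain ⟨d, hd, hder⟩ := hpos y x
  have hf : HasFDerivAt φ (fderiv ℝ φ (x, y)) (x, y) :=
    (hφ.differentiable (by simp) _).hasFDerivAt
  have h1 : fderiv ℝ φ (x, y) (1, 0) = d := by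
    have h2 : HasDerivAt (fun x : ℝ => (x, y)) ((1 : ℝ), (0 : ℝ)) x :=
      (hasDerivAt_id x).prodMk (hasDerivAt_const x y)
    exact (hf.comp_hasDerivAt x h2).unique hder
  set L := fderiv ℝ φ (x, y) with hL
  have h3 : ∀ u v : ℝ, L (u, v) = u * d + L (0, v) := fun u v => by
    have : ((u, v) : ℝ × ℝ) = u • ((1 : ℝ), (0 : ℝ)) + (0, v) := by simp
    rw [this, map_add, map_smul, h1, smul_eq_mul]
  let M : ℝ × ℝ →L[ℝ] ℝ × ℝ := L.prod (ContinuousLinearMap.snd ℝ ℝ ℝ)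
  -- The derivative `M` is triangular with diagonal entries `d` and `1`; this is its inverse.
  let N : ℝ × ℝ →L[ℝ] ℝ × ℝ :=
    (d⁻¹ • (ContinuousLinearMap.fst ℝ ℝ ℝ -
      L.comp ((0 : ℝ × ℝ →L[ℝ] ℝ).prod (ContinuousLinearMap.snd ℝ ℝ ℝ)))).prod
      (ContinuousLinearMap.snd ℝ ℝ ℝ)
  have hMN : Function.RightInverse N M := by
    rintro ⟨u, v⟩
    simp only [M, N, ContinuousLinearMap.prod_apply, _root_.smul_apply,
      _root_.sub_apply, ContinuousLinearMap.comp_apply,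
      _root_.zero_apply, ContinuousLinearMap.coe_fst', ContinuousLinearMap.coe_snd',
      smul_eq_mul, Prod.mk.injEq, and_true]
    rw [h3]; field_simp; ring
  have hNM : Function.LeftInverse N M := by
    rintro ⟨u, v⟩
    simp only [M, N, ContinuousLinearMap.prod_apply, _root_.smul_apply,
      _root_.sub_apply, ContinuousLinearMap.comp_apply,
      _root_.zero_apply, ContinuousLinearMap.coe_fst', ContinuousLinearMap.coe_snd',
      smul_eq_mul, Prod.mk.injEq, and_true]
    rw [h3 u v]; field_simp; ring
  refine ⟨ContinuousLinearEquiv.equivOfInverse M N hNM hMN, ?_⟩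
  exact hf.prodMk hasFDerivAt_snd

end FiberDiffeo

/-! ### Families of increasing diffeomorphisms of the line and their gluing in the `x`-direction. -/

section IncreasingFamily

/-- A smooth family, parametrized by `y ∈ U`, of increasing diffeomorphisms of the line. -/
structure IncreasingFamily (U : Set ℝ) (φ : ℝ × ℝ → ℝ) : Prop where
  isOpen : IsOpen U
  contDiffOn : ContDiffOn ℝ ∞ φ (univ ×ˢ U)
  deriv_pos : ∀ y ∈ U, ∀ x, ∃ d, 0 < d ∧ HasDerivAt (fun x => φ (x, y)) d x
  atTop : ∀ y ∈ U, Tendsto (fun x => φ (x, y)) atTop atTop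
  atBot : ∀ y ∈ U, Tendsto (fun x => φ (x, y)) atBot atBot

namespace IncreasingFamily

variable {U V : Set ℝ} {φ A B : ℝ × ℝ → ℝ} {y₀ : ℝ}

theorem mono (h : IncreasingFamily U φ) (hV : IsOpen V) (hVU : V ⊆ U) : IncreasingFamily V φ :=
  ⟨hV, h.contDiffOn.mono (prod_mono le_rfl hVU), fun y hy => h.deriv_pos y (hVU hy),
    fun y hy => h.atTop y (hVU hy), fun y hy => h.atBot y (hVU hy)⟩

theorem continuousAt (h : IncreasingFamily U φ) {y : ℝ} (hy : y ∈ U) (x : ℝ) :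
    ContinuousAt φ (x, y) :=
  h.contDiffOn.continuousOn.continuousAt ((isOpen_univ.prod h.isOpen).mem_nhds ⟨trivial, hy⟩)

theorem strictMono (h : IncreasingFamily U φ) {y : ℝ} (hy : y ∈ U) :
    StrictMono (fun x => φ (x, y)) :=
  strictMono_of_deriv_pos fun x => by
    obtain ⟨d, hd, h⟩ := h.deriv_pos y hy x
    rwa [h.deriv]

theorem affine (hU : IsOpen U) {α β : ℝ → ℝ} (hα : ContDiffOn ℝ ∞ α U) (hβ : ContDiffOn ℝ ∞ β U)
    (hpos : ∀ y ∈ U, 0 < β y) : IncreasingFamily U (fun z => α z.2 + β z.2 * z.1) := by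
  refine ⟨hU, ?_, fun y hy x => ⟨β y, hpos y hy, ?_⟩, fun y hy => ?_, fun y hy => ?_⟩
  · have h2 : MapsTo (Prod.snd : ℝ × ℝ → ℝ) (univ ×ˢ U) U := fun z hz => hz.2
    exact (hα.comp contDiff_snd.contDiffOn h2).add
      ((hβ.comp contDiff_snd.contDiffOn h2).mul contDiff_fst.contDiffOn)
  · simpa using ((hasDerivAt_id x).const_mul (β y)).const_add (α y)
  · exact tendsto_atTop_add_const_left _ (α y) (tendsto_id.const_mul_atTop (hpos y hy))
  · exact tendsto_atBot_add_const_left _ (α y) (tendsto_id.const_mul_atBot (hpos y hy))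

/-- Two families can be joined at a point where the second one is larger. -/
theorem glue_at (hA : IncreasingFamily U A) (hB : IncreasingFamily U B) (hy : y₀ ∈ U) {x₀ r : ℝ}
    (hr : 0 < r) (hlt : A (x₀, y₀) < B (x₀, y₀)) :
    ∃ V φ, V ⊆ U ∧ y₀ ∈ V ∧ IncreasingFamily V φ ∧
      ∀ y ∈ V, (∀ x ≤ x₀ - r, φ (x, y) = A (x, y)) ∧ ∀ x, x₀ + r ≤ x → φ (x, y) = B (x, y) := by
  have hev : ∀ᶠ z in 𝓝 x₀ ×ˢ 𝓝 y₀, A z < B z := by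
    rw [← nhds_prod_eq]
    exact (hA.continuousAt hy x₀).eventually_lt (hB.continuousAt hy x₀) hlt
  obtain ⟨P, hP, Q, hQ, hPQ⟩ := eventually_prod_iff.1 hev
  obtain ⟨ε, hε, hball⟩ := Metric.eventually_nhds_iff.1 hP
  obtain ⟨W, hW, hWo, hyW⟩ := eventually_nhds_iff.1 hQ
  set δ := min r (ε / 2) with hδ
  have hδ0 : 0 < δ := lt_min hr (half_pos hε)
  have hδr : δ ≤ r := min_le_left _ _
  have hδε : δ < ε := (min_le_right _ _).trans_lt (half_lt_self hε)
  let s : ℝ → ℝ := fun x => Real.smoothTransition ((x - x₀ + δ) / (2 * δ))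
  have hs : ContDiff ℝ ∞ s :=
    Real.smoothTransition.contDiff.comp (by fun_prop)
  have hs0 : ∀ x ≤ x₀ - δ, s x = 0 := fun x hx => by
    refine Real.smoothTransition.zero_of_nonpos (div_nonpos_of_nonpos_of_nonneg ?_ ?_) <;> linarith
  have hs1 : ∀ x, x₀ + δ ≤ x → s x = 1 := fun x hx => by
    refine Real.smoothTransition.one_of_one_le ?_
    rw [le_div_iff₀ (by linarith)]; linarith
  have hsm : Monotone s := fun x x' h => Real.smoothTransition.monotone (by gcongr)
  have hsle : ∀ x, s x ≤ 1 := fun x => Real.smoothTransition.le_one _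
  have hsnn : ∀ x, 0 ≤ s x := fun x => Real.smoothTransition.nonneg _
  have hlo : ∀ y, ∀ x ≤ x₀ - δ, A (x, y) + s x * (B (x, y) - A (x, y)) = A (x, y) :=
    fun y x hx => by rw [hs0 x hx]; ring
  have hhi : ∀ y, ∀ x, x₀ + δ ≤ x → A (x, y) + s x * (B (x, y) - A (x, y)) = B (x, y) :=
    fun y x hx => by rw [hs1 x hx]; ring
  refine ⟨U ∩ W, fun z => A z + s z.1 * (B z - A z), inter_subset_left, ⟨hy, hyW⟩,
    ⟨hA.isOpen.inter hWo, ?_, ?_, ?_, ?_⟩, fun y _ => ⟨fun x hx => hlo y x (by linarith),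
      fun x hx => hhi y x (by linarith)⟩⟩
  · have hsub : (univ : Set ℝ) ×ˢ (U ∩ W) ⊆ univ ×ˢ U := prod_mono le_rfl inter_subset_left
    have hA' := hA.contDiffOn.mono hsub
    exact hA'.add ((hs.comp contDiff_fst).contDiffOn.mul ((hB.contDiffOn.mono hsub).sub hA'))
  · rintro y ⟨hyU, hyW'⟩ x
    obtain ⟨a, ha, hda⟩ := hA.deriv_pos y hyU x
    obtain ⟨b, hb, hdb⟩ := hB.deriv_pos y hyU x
    have hds : HasDerivAt s (deriv s x) x := (hs.differentiable (by simp) x).hasDerivAt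
    rcases lt_or_ge x (x₀ - δ) with hx | hx
    · refine ⟨a, ha, hda.congr_of_eventuallyEq ?_⟩
      filter_upwards [Iio_mem_nhds hx] with x' hx' using hlo y x' (le_of_lt hx')
    rcases lt_or_ge (x₀ + δ) x with hx' | hx'
    · refine ⟨b, hb, hdb.congr_of_eventuallyEq ?_⟩
      filter_upwards [Ioi_mem_nhds hx'] with x' hx' using hhi y x' (le_of_lt hx')
    -- The derivative is `(1 - s) a + s b + s' (B - A)`. The first two terms have a positive sum,
    -- and the last is nonnegative because the step function `s` varies only where `A < B`.
    refine ⟨_, ?_, hda.add (hds.mul (hdb.sub hda))⟩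
    have hAB : A (x, y) < B (x, y) := by
      refine hPQ (hball ?_) (hW y hyW')
      rw [Real.dist_eq, abs_lt]; constructor <;> linarith
    have h1 : 0 ≤ deriv s x * (B (x, y) - A (x, y)) :=
      mul_nonneg hsm.deriv_nonneg (by linarith)
    have h2 : 0 < a + s x * (b - a) := by
      have h3 := hsle x
      have h4 := hsnn x
      rcases h4.eq_or_lt with h | h
      · rw [← h]; simpa using ha
      · nlinarith [mul_pos h hb, mul_nonneg (sub_nonneg.2 h3) ha.le]
    linarith
  · intro y hy
    refine (hB.atTop y hy.1).congr' ?_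
    filter_upwards [eventually_ge_atTop (x₀ + δ)] with x hx using (hhi y x hx).symm
  · intro y hy
    refine (hA.atBot y hy.1).congr' ?_
    filter_upwards [eventually_le_atBot (x₀ - δ)] with x hx using (hlo y x hx).symm

/-- Two families can be joined between points `p < m` if the values there are in order. -/
theorem glue (hA : IncreasingFamily U A) (hB : IncreasingFamily U B) (hy : y₀ ∈ U) {p m : ℝ}
    (hpm : p < m) (hlt : A (p, y₀) < B (m, y₀)) :
    ∃ V φ, ∃ τ > 0, V ⊆ U ∧ y₀ ∈ V ∧ IncreasingFamily V φ ∧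
      ∀ y ∈ V, (∀ x ≤ p + τ, φ (x, y) = A (x, y)) ∧ ∀ x, m - τ ≤ x → φ (x, y) = B (x, y) := by
  have hcA : ContinuousAt (fun τ => A (p + τ, y₀)) 0 := by
    refine ContinuousAt.comp (f := fun τ => (p + τ, y₀)) (x := (0 : ℝ)) (g := A) ?_ (by fun_prop)
    simpa using hA.continuousAt hy p
  have hcB : ContinuousAt (fun τ => B (m - τ, y₀)) 0 := by
    refine ContinuousAt.comp (f := fun τ => (m - τ, y₀)) (x := (0 : ℝ)) (g := B) ?_ (by fun_prop)
    simpa using hB.continuousAt hy m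
  have hev : ∀ᶠ τ in 𝓝 (0 : ℝ), A (p + τ, y₀) < B (m - τ, y₀) :=
    hcA.eventually_lt hcB (by simpa using hlt)
  obtain ⟨ε, hε, hball⟩ := Metric.eventually_nhds_iff.1 hev
  obtain ⟨τ, hτ0, hτ⟩ := exists_between (show 0 < min ε ((m - p) / 4) from
    lt_min hε (by linarith))
  have hτε : τ < ε := hτ.trans_le (min_le_left _ _)
  have hτm : τ < (m - p) / 4 := hτ.trans_le (min_le_right _ _)
  have hAB : A (p + τ, y₀) < B (m - τ, y₀) := hball (by
    rw [Real.dist_eq, sub_zero, abs_of_pos hτ0]; exact hτε)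
  set a := A (p + τ, y₀) with ha
  set b := B (m - τ, y₀) with hb
  -- The two families are joined through an affine map that takes the value `a + e` at `p + τ` and
  -- `b - e` at `m - τ`, so that `glue_at` applies at both points.
  set e := (b - a) / 3 with he
  set β := e / (m - p - 2 * τ) with hβ
  have hden : 0 < m - p - 2 * τ := by linarith
  have hβ0 : 0 < β := div_pos (by linarith) hden
  have hC : IncreasingFamily U (fun z => (a + e - β * (p + τ)) + β * z.1) :=
    affine (α := fun _ => (a + e - β * (p + τ))) (β := fun _ => β) hA.isOpen contDiffOn_const
      contDiffOn_const (fun _ _ => hβ0)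
  obtain ⟨V₁, φ₁, hV₁, hy₁, hφ₁, h₁⟩ := hA.glue_at hC hy (x₀ := p + τ) (half_pos hτ0)
    (by simp only; rw [← ha]; linarith)
  obtain ⟨V₂, φ₂, hV₂, hy₂, hφ₂, h₂⟩ := hφ₁.glue_at (hB.mono hφ₁.isOpen hV₁) hy₁ (x₀ := m - τ) (half_pos hτ0)
    (by
      rw [(h₁ y₀ hy₁).2 (m - τ) (by linarith), ← hb]
      have : β * (m - p - 2 * τ) = e := by rw [hβ]; field_simp
      simp only
      linarith)
  refine ⟨V₂, φ₂, τ / 2, half_pos hτ0, hV₂.trans hV₁, hy₂, hφ₂, fun y hy => ⟨fun x hx => ?_, fun x hx => ?_⟩⟩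
  · rw [(h₂ y hy).1 x (by linarith), (h₁ y (hV₂ hy)).1 x (by linarith)]
  · rw [(h₂ y hy).2 x (by linarith)]

end IncreasingFamily

end IncreasingFamily

namespace Configuration

variable {n : ℕ}

theorem arc_zero_ne (C : Configuration n) {i j : Fin n} (h : i ≠ j) : C.arc i 0 ≠ C.arc j 0 := by
  rw [C.bottom, C.bottom]
  intro h'
  exact h (Fin.ext (by exact_mod_cast add_right_cancel h'))

theorem arc_one_ne (C : Configuration n) {i j : Fin n} (h : i ≠ j) : C.arc i 1 ≠ C.arc j 1 := by
  obtain ⟨π, hπ⟩ := C.top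
  rw [hπ, hπ]
  intro h'
  exact h (π.injective (Fin.ext (by exact_mod_cast add_right_cancel h')))

theorem mem_Ioo_of_arc_eq (C : Configuration n) {i j : Fin n} (h : i ≠ j) {y : ℝ}
    (hy : y ∈ Icc (0 : ℝ) 1) (he : C.arc i y = C.arc j y) : y ∈ Ioo (0 : ℝ) 1 := by
  refine ⟨hy.1.lt_of_ne ?_, hy.2.lt_of_ne ?_⟩
  · rintro rfl; exact C.arc_zero_ne h he
  · rintro rfl; exact C.arc_one_ne h he

end Configuration

/-! ### Fibrewise maps that carry one family of arcs to another. -/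

/-- At most one other arc passes through the point of `i₀`. If there is one, both differences of the
two arcs are `y - y₀` times smooth functions `k` and `k'` of the same sign, so the map affine in `x`
with slope `k' / k` carries both arcs to their targets, smoothly across the double point. A single
arc only needs a translation. -/
theorem IncreasingFamily.exists_cluster {ι : Type*} {f f' : ι → ℝ → ℝ}
    (hf : ∀ i, ContDiff ℝ ∞ (f i)) (hf' : ∀ i, ContDiff ℝ ∞ (f' i)) (y₀ : ℝ)
    (h3 : ∀ i j k, i ≠ j → j ≠ k → i ≠ k → ¬ (f i y₀ = f j y₀ ∧ f j y₀ = f k y₀))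
    (htr : ∀ i j, i ≠ j → f i y₀ = f j y₀ → f' i y₀ = f' j y₀ ∧
      0 < deriv (fun y => f i y - f j y) y₀ * deriv (fun y => f' i y - f' j y) y₀) (i₀ : ι) :
    ∃ U L, y₀ ∈ U ∧ IncreasingFamily U L ∧
      ∀ i, f i y₀ = f i₀ y₀ → ∀ y ∈ U, L (f i y, y) = f' i y := by
  by_cases hj : ∃ j, j ≠ i₀ ∧ f j y₀ = f i₀ y₀
  · obtain ⟨j, hj, hje⟩ := hj
    obtain ⟨k, hk, hka, hkf⟩ := exists_contDiff_eq_add_mul ((hf j).sub (hf i₀)) y₀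
    obtain ⟨k', hk', hka', hkf'⟩ := exists_contDiff_eq_add_mul ((hf' j).sub (hf' i₀)) y₀
    obtain ⟨he', hpos⟩ := htr j i₀ hj hje
    have hpos' : 0 < k y₀ * k' y₀ := by rw [hka, hka']; exact hpos
    have hopen : IsOpen {y | 0 < k y * k' y} :=
      isOpen_lt continuous_const (hk.continuous.mul hk'.continuous)
    have hβ : ContDiffOn ℝ ∞ (fun y => k' y / k y) {y | 0 < k y * k' y} :=
      hk'.contDiffOn.div hk.contDiffOn fun y hy h0 => by simp [h0] at hy
    refine ⟨_, _, hpos', IncreasingFamily.affine (α := fun y => f' i₀ y - k' y / k y * f i₀ y)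
      (β := fun y => k' y / k y) hopen ((hf' i₀).contDiffOn.sub (hβ.mul (hf i₀).contDiffOn)) hβ
      fun y hy => ?_, ?_⟩
    · have hy' : 0 < k y * k' y := hy
      have hk0 : k y ≠ 0 := fun h0 => by simp [h0] at hy'
      rw [show k' y / k y = k y * k' y / (k y) ^ 2 by field_simp]
      positivity
    · intro i hi y hy
      have hy' : 0 < k y * k' y := hy
      have hk0 : k y ≠ 0 := fun h0 => by simp [h0] at hy'
      by_cases hii : i = i₀
      · subst hii; simp
      have hij : i = j := by
        by_contra hij
        exact h3 i i₀ j hii (Ne.symm hj) hij ⟨hi, hje.symm⟩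
      subst hij
      have e1 := hkf y
      have e2 := hkf' y
      rw [hje, he'] at *
      simp only [sub_self, zero_add] at e1 e2
      have e3 : f i y = f i₀ y + (y - y₀) * k y := by linarith
      have e4 : f' i y = f' i₀ y + (y - y₀) * k' y := by linarith
      simp only
      rw [e3, e4]
      field_simp
      ring
  · push Not at hj
    refine ⟨univ, _, trivial, IncreasingFamily.affine (α := fun y => f' i₀ y - f i₀ y)
      (β := fun _ => 1) isOpen_univ ((hf' i₀).sub (hf i₀)).contDiffOn contDiffOn_const
      fun _ _ => one_pos, fun i hi y _ => ?_⟩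
    have : i = i₀ := by
      by_contra h
      exact hj i h hi
    subst this
    simp

/-- The positions at height `y₀` are treated from left to right: the map for the positions already
treated is glued to the cluster map of the next position, which is possible because the target
positions are in the same order. -/
theorem IncreasingFamily.exists_local {ι : Type*} [Finite ι] {f f' : ι → ℝ → ℝ}
    (hf : ∀ i, ContDiff ℝ ∞ (f i)) (hf' : ∀ i, ContDiff ℝ ∞ (f' i)) (y₀ : ℝ)
    (hlt : ∀ i j, f i y₀ < f j y₀ → f' i y₀ < f' j y₀)
    (h3 : ∀ i j k, i ≠ j → j ≠ k → i ≠ k → ¬ (f i y₀ = f j y₀ ∧ f j y₀ = f k y₀))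
    (htr : ∀ i j, i ≠ j → f i y₀ = f j y₀ → f' i y₀ = f' j y₀ ∧
      0 < deriv (fun y => f i y - f j y) y₀ * deriv (fun y => f' i y - f' j y) y₀) :
    ∃ U φ, y₀ ∈ U ∧ IncreasingFamily U φ ∧ ∀ i, ∀ y ∈ U, φ (f i y, y) = f' i y := by
  cases nonempty_fintype ι
  classical
  suffices H : ∀ s : Finset ℝ, ∃ U φ, y₀ ∈ U ∧ IncreasingFamily U φ ∧
      ∀ i, f i y₀ ∈ s → ∀ y ∈ U, φ (f i y, y) = f' i y by
    obtain ⟨U, φ, h1, h2, h3⟩ := H (Finset.univ.image fun i => f i y₀)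
    exact ⟨U, φ, h1, h2, fun i => h3 i (by simp)⟩
  intro s
  induction s using Finset.induction_on_max with
  | empty =>
    exact ⟨univ, _, trivial, IncreasingFamily.affine (α := fun _ => 0) (β := fun _ => 1)
      isOpen_univ contDiffOn_const contDiffOn_const fun _ _ => one_pos, by simp⟩
  | insert a s hs ih =>
    obtain ⟨U, φ, hyU, hφ, hU⟩ := ih
    by_cases ha : ∃ i, f i y₀ = a
    swap
    · push Not at ha
      refine ⟨U, φ, hyU, hφ, fun i hi => hU i ?_⟩
      simpa [ha i] using hi
    obtain ⟨i₀, rfl⟩ := ha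
    obtain ⟨W, L, hyW, hL, hW⟩ := exists_cluster hf hf' y₀ h3 htr i₀
    rcases (Finset.univ.filter fun i => f i y₀ ∈ s).eq_empty_or_nonempty with he | hne
    · refine ⟨W, L, hyW, hL, fun i hi => hW i ?_⟩
      rcases Finset.mem_insert.1 hi with hi | hi
      · exact hi
      · exact absurd (show i ∈ Finset.univ.filter fun i => f i y₀ ∈ s by simpa using hi)
          (by simp [he])
    obtain ⟨i₁, hi₁, hmax⟩ := Finset.exists_max_image _ (fun i => f i y₀) hne
    have hi₁s : f i₁ y₀ ∈ s := by simpa using hi₁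
    have hUo := hφ.isOpen.inter hL.isOpen
    obtain ⟨V, ψ, τ, hτ, hVU, hyV, hψ, hV⟩ := (hφ.mono hUo inter_subset_left).glue
      (hL.mono hUo inter_subset_right) ⟨hyU, hyW⟩ (hs _ hi₁s)
      (by rw [hU i₁ hi₁s y₀ hyU, hW i₀ rfl y₀ hyW]; exact hlt _ _ (hs _ hi₁s))
    have hev : ∀ᶠ y in 𝓝 y₀, ∀ i, |f i y - f i y₀| < τ := eventually_all.2 fun i => by
      have : Tendsto (fun y => |f i y - f i y₀|) (𝓝 y₀) (𝓝 |f i y₀ - f i y₀|) :=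
        ((hf i).continuous.sub continuous_const).abs.tendsto y₀
      rw [sub_self, abs_zero] at this
      exact this.eventually_lt_const hτ
    obtain ⟨T, hT, hTo, hyT⟩ := eventually_nhds_iff.1 hev
    refine ⟨V ∩ T, ψ, ⟨hyV, hyT⟩, hψ.mono (hψ.isOpen.inter hTo) inter_subset_left, ?_⟩
    rintro i hi y ⟨hy1, hy2⟩
    have hd := abs_lt.1 (hT y hy2 i)
    rcases Finset.mem_insert.1 hi with hi | hi
    · rw [(hV y hy1).2 _ (by linarith), hW i hi y (hVU hy1).2]
    · have := hmax i (by simpa using hi)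
      rw [(hV y hy1).1 _ (by linarith), hU i hi y (hVU hy1).1]

/-- Positive derivatives, limits at infinity and prescribed values all survive convex combination,
so a partition of unity in `y` suffices. The value `w` is required of each family only where that
family is controlled. -/
theorem IncreasingFamily.glue_param {S S₁ S₂ : Set ℝ} {A B : ℝ × ℝ → ℝ} {u v : ℝ}
    (hA : IncreasingFamily S₁ A) (hB : IncreasingFamily S₂ B) (hS : IsOpen S) (huv : u < v)
    (h1 : S ∩ Iic v ⊆ S₁) (h2 : S ∩ Ici u ⊆ S₂) :
    ∃ φ, IncreasingFamily S φ ∧ ∀ x, ∀ y ∈ S, ∀ w, (y ∈ S₁ → A (x, y) = w) →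
      (y ∈ S₂ → B (x, y) = w) → φ (x, y) = w := by
  let s : ℝ → ℝ := fun y => Real.smoothTransition ((y - u) / (v - u))
  have hs : ContDiff ℝ ∞ s := Real.smoothTransition.contDiff.comp (by fun_prop)
  have hs0 : ∀ y ≤ u, s y = 0 := fun x hx => by
    refine Real.smoothTransition.zero_of_nonpos (div_nonpos_of_nonpos_of_nonneg ?_ ?_) <;> linarith
  have hs1 : ∀ y, v ≤ y → s y = 1 := fun x hx => by
    refine Real.smoothTransition.one_of_one_le ?_
    rw [le_div_iff₀ (by linarith)]; linarith
  have hsle : ∀ x, s x ≤ 1 := fun x => Real.smoothTransition.le_one _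
  have hsnn : ∀ x, 0 ≤ s x := fun x => Real.smoothTransition.nonneg _
  let φ : ℝ × ℝ → ℝ := fun z => (1 - s z.2) * A z + s z.2 * B z
  have hlo : ∀ x, ∀ y ≤ u, φ (x, y) = A (x, y) := fun x y hy => by simp [φ, hs0 y hy]
  have hhi : ∀ x, ∀ y, v ≤ y → φ (x, y) = B (x, y) := fun x y hy => by simp [φ, hs1 y hy]
  have hcase : ∀ y ∈ S, (y ≤ u ∧ y ∈ S₁) ∨ (v ≤ y ∧ y ∈ S₂) ∨
      (y ∈ S₁ ∧ y ∈ S₂ ∧ 0 < 1 - s y ∧ 0 < s y) := by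
    intro y hy
    rcases le_or_gt y u with h | h
    · exact Or.inl ⟨h, h1 ⟨hy, (h.trans huv.le)⟩⟩
    rcases le_or_gt v y with h' | h'
    · exact Or.inr (Or.inl ⟨h', h2 ⟨hy, huv.le.trans h'⟩⟩)
    · refine Or.inr (Or.inr ⟨h1 ⟨hy, h'.le⟩, h2 ⟨hy, h.le⟩, ?_, ?_⟩)
      · have := Real.smoothTransition.lt_one_of_lt_one
          (x := (y - u) / (v - u)) ((div_lt_one (by linarith)).2 (by linarith))
        simp only [s]; linarith
      · exact Real.smoothTransition.pos_of_pos (div_pos (by linarith) (by linarith))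
  refine ⟨φ, ⟨hS, ?_, ?_, ?_, ?_⟩, ?_⟩
  · rintro ⟨x, y⟩ ⟨_, hy⟩
    apply ContDiffAt.contDiffWithinAt
    have hsm : ContDiffAt ℝ ∞ (fun z : ℝ × ℝ => s z.2) (x, y) :=
      (hs.comp contDiff_snd).contDiffAt
    have hA' : y ∈ S₁ → ContDiffAt ℝ ∞ A (x, y) := fun h =>
      hA.contDiffOn.contDiffAt ((isOpen_univ.prod hA.isOpen).mem_nhds ⟨trivial, h⟩)
    have hB' : y ∈ S₂ → ContDiffAt ℝ ∞ B (x, y) := fun h =>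
      hB.contDiffOn.contDiffAt ((isOpen_univ.prod hB.isOpen).mem_nhds ⟨trivial, h⟩)
    rcases lt_or_ge y u with h | h
    · refine (hA' (h1 ⟨hy, (h.trans huv).le⟩)).congr_of_eventuallyEq ?_
      filter_upwards [(isOpen_univ.prod isOpen_Iio).mem_nhds
        (show (x, y) ∈ univ ×ˢ Iio u from ⟨trivial, h⟩)] with z hz using hlo z.1 z.2 (le_of_lt hz.2)
    rcases lt_or_ge v y with h' | h'
    · refine (hB' (h2 ⟨hy, (huv.trans h').le⟩)).congr_of_eventuallyEq ?_
      filter_upwards [(isOpen_univ.prod isOpen_Ioi).mem_nhds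
        (show (x, y) ∈ univ ×ˢ Ioi v from ⟨trivial, h'⟩)] with z hz
        using hhi z.1 z.2 (le_of_lt hz.2)
    exact ((contDiffAt_const.sub hsm).mul (hA' (h1 ⟨hy, h'⟩))).add (hsm.mul (hB' (h2 ⟨hy, h⟩)))
  · intro y hy x
    rcases hcase y hy with ⟨h, h'⟩ | ⟨h, h'⟩ | ⟨h, h', h3, h4⟩
    · simp only [hlo _ y h]; exact hA.deriv_pos y h' x
    · simp only [hhi _ y h]; exact hB.deriv_pos y h' x
    · obtain ⟨a, ha, hda⟩ := hA.deriv_pos y h x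
      obtain ⟨b, hb, hdb⟩ := hB.deriv_pos y h' x
      exact ⟨(1 - s y) * a + s y * b, by positivity, HasDerivAt.add (hda.const_mul (1 - s y)) (hdb.const_mul (s y))⟩
  · intro y hy
    rcases hcase y hy with ⟨h, h'⟩ | ⟨h, h'⟩ | ⟨h, h', h3, h4⟩
    · simp only [hlo _ y h]; exact hA.atTop y h'
    · simp only [hhi _ y h]; exact hB.atTop y h'
    · exact ((hA.atTop y h).const_mul_atTop h3).atTop_add_atTop ((hB.atTop y h').const_mul_atTop h4)
  · intro y hy
    rcases hcase y hy with ⟨h, h'⟩ | ⟨h, h'⟩ | ⟨h, h', h3, h4⟩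
    · simp only [hlo _ y h]; exact hA.atBot y h'
    · simp only [hhi _ y h]; exact hB.atBot y h'
    · exact ((hA.atBot y h).const_mul_atBot h3).atBot_add_atBot ((hB.atBot y h').const_mul_atBot h4)
  · intro x y hy w hw1 hw2
    rcases hcase y hy with ⟨h, h'⟩ | ⟨h, h'⟩ | ⟨h, h', h3, h4⟩
    · rw [hlo x y h, hw1 h']
    · rw [hhi x y h, hw2 h']
    · simp only [φ]; rw [hw1 h, hw2 h']; ring

/-- Local increasing families satisfying interpolation conditions at the heights in `[0, 1]` can be
patched to a global one. -/
theorem IncreasingFamily.exists_global {ι : Type*} {f f' : ι → ℝ → ℝ}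
    (hloc : ∀ y₀ ∈ Icc (0 : ℝ) 1, ∃ U φ, y₀ ∈ U ∧ IncreasingFamily U φ ∧
      ∀ i, ∀ y ∈ U, φ (f i y, y) = f' i y) :
    ∃ φ, IncreasingFamily univ φ ∧ ∀ i, ∀ y ∈ Icc (0 : ℝ) 1, φ (f i y, y) = f' i y := by
  have hid : ∀ U : Set ℝ, IsOpen U → IncreasingFamily U (fun z => z.1) := fun U hU => by
    simpa using IncreasingFamily.affine (α := fun _ => 0) (β := fun _ => 1)
      hU contDiffOn_const contDiffOn_const fun _ _ => one_pos
  choose! U φ hyU hφ hU using hloc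
  obtain ⟨t, ht0, htm, ⟨m, hm⟩, ht⟩ := exists_monotone_Icc_subset_open_cover_Icc
    (zero_le_one (α := ℝ)) (c := fun y : Icc (0 : ℝ) 1 => Subtype.val ⁻¹' U y)
    (fun y => (hφ y y.2).isOpen.preimage continuous_subtype_val)
    (fun y _ => mem_iUnion.2 ⟨y, hyU y y.2⟩)
  -- Along the partition the family is kept on a whole ray reaching beyond `t k`. It starts as the
  -- identity below `0`, where nothing is prescribed, and is extended over the next interval by
  -- blending just below `t k`.
  have H : ∀ k, ∃ b > (t k : ℝ), ∃ ψ, IncreasingFamily (Iio b) ψ ∧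
      ∀ i, ∀ y ∈ Iio b, y ∈ Icc (0 : ℝ) 1 → ψ (f i y, y) = f' i y := by
    intro k
    induction k with
    | zero =>
      have h0 := hyU 0 (by simp)
      have hf0 := hφ 0 (by simp)
      obtain ⟨e, he, hball⟩ := Metric.isOpen_iff.1 hf0.isOpen 0 h0
      rw [Real.ball_eq_Ioo] at hball
      obtain ⟨ψ, hψ, hψ'⟩ := (hid (Iio 0) isOpen_Iio).glue_param (S := Iio e) (u := -e / 2)
        (v := -e / 4) hf0 isOpen_Iio (by linarith)
        (fun y hy => by simp only [mem_inter_iff, mem_Iio, mem_Iic] at hy ⊢; linarith [hy.2])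
        (fun y hy => hball (by
          simp only [mem_inter_iff, mem_Iio, mem_Ici, mem_Ioo] at hy ⊢
          constructor <;> linarith [hy.1, hy.2]))
      refine ⟨e, by rw [ht0]; exact he, ψ, hψ, fun i y hy hy1 => ?_⟩
      exact hψ' _ y hy _ (fun h => absurd hy1.1 (not_le.2 h)) fun h => hU 0 (by simp) i y h
    | succ k ih =>
      obtain ⟨b, hb, ψ, hψ, hψ'⟩ := ih
      obtain ⟨y₀, hy₀⟩ := ht k
      have hf0 := hφ y₀ y₀.2
      have hk : (t k : ℝ) ∈ U y₀ := hy₀ ⟨le_rfl, htm k.le_succ⟩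
      have hk1 : (t (k + 1) : ℝ) ∈ U y₀ := hy₀ ⟨htm k.le_succ, le_rfl⟩
      obtain ⟨e, he, hball⟩ := Metric.isOpen_iff.1 hf0.isOpen _ hk
      obtain ⟨e', he', hball'⟩ := Metric.isOpen_iff.1 hf0.isOpen _ hk1
      rw [Real.ball_eq_Ioo] at hball hball'
      obtain ⟨χ, hχ, hχ'⟩ := hψ.glue_param (S := Iio (t (k + 1) + e')) (u := t k - e / 2)
        (v := t k) hf0 isOpen_Iio (by linarith)
        (fun y hy => by simp only [mem_inter_iff, mem_Iio, mem_Iic] at hy ⊢; linarith [hy.2])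
        (fun y hy => by
          simp only [mem_inter_iff, mem_Iio, mem_Ici] at hy
          rcases lt_or_ge y (t k) with h | h
          · exact hball ⟨by linarith [hy.2], by linarith⟩
          rcases le_or_gt y (t (k + 1)) with h' | h'
          · have hy01 : y ∈ Icc (0 : ℝ) 1 := ⟨(t k).2.1.trans h, h'.trans (t (k + 1)).2.2⟩
            exact hy₀ (show (⟨y, hy01⟩ : Icc (0 : ℝ) 1) ∈ _ from ⟨h, h'⟩)
          · exact hball' ⟨by linarith, hy.1⟩)
      refine ⟨t (k + 1) + e', by linarith, χ, hχ, fun i y hy hy1 => ?_⟩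
      exact hχ' _ y hy _ (fun h => hψ' i y h hy1) fun h => hU y₀ y₀.2 i y h
  obtain ⟨b, hb, ψ, hψ, hψ'⟩ := H m
  rw [hm m le_rfl] at hb
  change (1 : ℝ) < b at hb
  obtain ⟨χ, hχ, hχ'⟩ := hψ.glue_param (S := univ) (u := 1 + (b - 1) / 3)
    (v := 1 + 2 * (b - 1) / 3) (hid (Ioi 1) isOpen_Ioi) isOpen_univ (by linarith)
    (fun y hy => by simp only [univ_inter, mem_Iio, mem_Iic] at hy ⊢; linarith)
    (fun y hy => by simp only [univ_inter, mem_Ici, mem_Ioi] at hy ⊢; linarith)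
  refine ⟨χ, hχ, fun i y hy => hχ' _ y trivial _ (fun h => hψ' i y h hy) fun h => ?_⟩
  exact absurd hy.2 (not_le.2 h)

/-! ### Diagrams with the same order of arcs at every height. -/

namespace Diagram

variable {n : ℕ}

theorem deriv_eq_of_eqOn {g h : ℝ → ℝ} (hgh : EqOn g h (Icc 0 1)) {y : ℝ}
    (hy : y ∈ Ioo (0 : ℝ) 1) : deriv g y = deriv h y :=
  Filter.EventuallyEq.deriv_eq (hgh.eventuallyEq_of_mem (Icc_mem_nhds hy.1 hy.2))

/-- Diagrams whose arcs are in the same order at every height are diffeomorphic. -/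
theorem planeDiffeomorphic_of_same_order (D D' : Diagram n)
    (hlt : ∀ i j, ∀ y ∈ Icc (0 : ℝ) 1, D.arc i y < D.arc j y ↔ D'.arc i y < D'.arc j y)
    (htop : ∀ i, D.arc i 1 = D'.arc i 1) : D.PlaneDiffeomorphic D' := by
  choose f hf hfe using D.smooth
  choose f' hf' hfe' using D'.smooth
  have heq : ∀ i j, ∀ y ∈ Icc (0 : ℝ) 1, D.arc i y = D.arc j y → D'.arc i y = D'.arc j y := by
    intro i j y hy h
    have h1 := hlt i j y hy
    have h2 := hlt j i y hy
    simp only [h, lt_irrefl, false_iff, not_lt] at h1 h2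
    exact le_antisymm h2 h1
  obtain ⟨φ, hφ, hφf⟩ := IncreasingFamily.exists_global (f := f) (f' := f') fun y₀ hy₀ => by
    refine IncreasingFamily.exists_local hf hf' y₀ (fun i j h => ?_) (fun i j k hij hjk hik => ?_)
      fun i j hij h => ?_
    · rw [← hfe i hy₀, ← hfe j hy₀] at h
      rw [← hfe' i hy₀, ← hfe' j hy₀]
      exact (hlt i j y₀ hy₀).1 h
    · rw [← hfe i hy₀, ← hfe j hy₀, ← hfe k hy₀]
      exact D.no_triple i j k hij hjk hik y₀ hy₀
    · rw [← hfe i hy₀, ← hfe j hy₀] at h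
      have h' := heq i j y₀ hy₀ h
      have hy₁ := D.mem_Ioo_of_arc_eq hij hy₀ h
      have ht := D.transverse i j hij y₀ hy₀ h
      have ht' := D'.transverse i j hij y₀ hy₀ h'
      rw [deriv_eq_of_eqOn (hfe i) hy₁, deriv_eq_of_eqOn (hfe j) hy₁] at ht
      rw [deriv_eq_of_eqOn (hfe' i) hy₁, deriv_eq_of_eqOn (hfe' j) hy₁] at ht'
      refine ⟨by rw [← hfe' i hy₀, ← hfe' j hy₀]; exact h', ?_⟩
      obtain ⟨k, hk, hka, hkf⟩ := exists_contDiff_eq_add_mul ((hf i).sub (hf j)) y₀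
      obtain ⟨k', hk', hka', hkf'⟩ := exists_contDiff_eq_add_mul ((hf' i).sub (hf' j)) y₀
      have hda : ∀ g : ℝ → ℝ, ContDiff ℝ ∞ g → DifferentiableAt ℝ g y₀ :=
        fun g hg => hg.differentiable (by simp) _
      have hn : deriv (fun y => f i y - f j y) y₀ ≠ 0 := by
        rw [deriv_fun_sub (hda _ (hf i)) (hda _ (hf j))]; exact sub_ne_zero.2 ht
      have hn' : deriv (fun y => f' i y - f' j y) y₀ ≠ 0 := by
        rw [deriv_fun_sub (hda _ (hf' i)) (hda _ (hf' j))]; exact sub_ne_zero.2 ht'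
      rw [← hka] at hn ⊢
      rw [← hka'] at hn' ⊢
      -- If the two differences had slopes of opposite signs at `y₀`, they would have opposite signs
      -- just above `y₀`, against the common order of the arcs.
      by_contra hneg
      have hneg' : k y₀ * k' y₀ < 0 := (not_lt.1 hneg).lt_of_ne (mul_ne_zero hn hn')
      have hev : ∀ᶠ y in 𝓝 y₀, k y * k' y < 0 :=
        (hk.continuous.mul hk'.continuous).continuousAt.eventually_lt_const hneg'
      obtain ⟨y, hky, hyy, hy1⟩ := ((hev.filter_mono nhdsWithin_le_nhds).and
        (Ioo_mem_nhdsGT hy₁.2)).exists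
      have hy : y ∈ Icc (0 : ℝ) 1 := ⟨hy₁.1.le.trans hyy.le, hy1.le⟩
      have e1 := hkf y
      have e2 := hkf' y
      rw [← hfe i hy, ← hfe j hy, ← hfe i hy₀, ← hfe j hy₀, h] at e1
      rw [← hfe' i hy, ← hfe' j hy, ← hfe' i hy₀, ← hfe' j hy₀, h'] at e2
      have e3 : (D.arc i y - D.arc j y) * (D'.arc i y - D'.arc j y) < 0 := by
        rw [e1, e2]
        have : 0 < (y - y₀) ^ 2 := by have : 0 < y - y₀ := by linarith
                                      positivity
        nlinarith
      rcases lt_trichotomy (D.arc i y) (D.arc j y) with hc | hc | hc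
      · have := (hlt i j y hy).1 hc
        nlinarith
      · rw [hc] at e3; simp at e3
      · have := (hlt j i y hy).1 hc
        nlinarith
  obtain ⟨Φ, h1, h2, h3⟩ := exists_fiber_diffeo φ
    (by simpa [contDiffOn_univ] using hφ.contDiffOn) (fun y => hφ.deriv_pos y trivial)
    (fun y => hφ.atTop y trivial) (fun y => hφ.atBot y trivial)
  have key : ∀ i, ∀ y ∈ Icc (0 : ℝ) 1, Φ (D.arc i y, y) = (D'.arc i y, y) := fun i y hy => by
    rw [h3, hfe i hy, hφf i y hy, hfe' i hy]
  refine ⟨Φ, h1, h2, fun m => ⟨?_, ?_⟩, fun i => ?_⟩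
  · have := key m 0 (by simp)
    rwa [D.bottom, D'.bottom] at this
  · obtain ⟨π, hπ⟩ := D.top
    have := key (π.symm m) 1 (by simp)
    rw [← htop, hπ] at this
    simpa using this
  · ext ⟨x, y⟩
    simp only [Configuration.arcSet, mem_image, mem_ofPred_eq, Prod.exists]
    constructor
    · rintro ⟨x', y', ⟨hy', rfl⟩, h⟩
      rw [key i y' hy'] at h
      cases h
      exact ⟨hy', rfl⟩
    · rintro ⟨hy, rfl⟩
      exact ⟨_, y, ⟨hy, rfl⟩, key i y hy⟩

theorem PlaneDiffeomorphic.symm {D D' : Diagram n} (h : D.PlaneDiffeomorphic D') :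
    D'.PlaneDiffeomorphic D := by
  obtain ⟨Φ, h1, h2, h3, h4⟩ := h
  refine ⟨Φ.symm, h2, h1, fun m => ⟨?_, ?_⟩, fun i => ?_⟩
  · rw [Equiv.symm_apply_eq]; exact (h3 m).1.symm
  · rw [Equiv.symm_apply_eq]; exact (h3 m).2.symm
  · rw [← h4 i, Equiv.symm_image_image]

theorem PlaneDiffeomorphic.trans {D D' D'' : Diagram n} (h : D.PlaneDiffeomorphic D')
    (h' : D'.PlaneDiffeomorphic D'') : D.PlaneDiffeomorphic D'' := by
  obtain ⟨Φ, h1, h2, h3, h4⟩ := h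
  obtain ⟨Ψ, k1, k2, k3, k4⟩ := h'
  refine ⟨Φ.trans Ψ, k1.comp h1, h2.comp k2, fun m => ⟨?_, ?_⟩, fun i => ?_⟩
  · rw [Equiv.trans_apply, (h3 m).1, (k3 m).1]
  · rw [Equiv.trans_apply, (h3 m).2, (k3 m).2]
  · rw [← k4 i, ← h4 i, Equiv.coe_trans, image_comp]

end Diagram

/-! ### Uniform margins and isolated heights. -/

section RealLemmas

/-- The margin is the minimum of `h - g` on the compact interval. The eventual form lets finitely
many such margins be intersected. -/
theorem eventually_forall_add_lt {g h : ℝ → ℝ} {c d : ℝ} (hg : ContinuousOn g (Icc c d))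
    (hh : ContinuousOn h (Icc c d)) (hlt : ∀ y ∈ Icc c d, g y < h y) :
    ∀ᶠ ε in 𝓝[>] (0 : ℝ), ∀ y ∈ Icc c d, g y + ε < h y := by
  rcases (Icc c d).eq_empty_or_nonempty with he | hne
  · simp [he]
  obtain ⟨y₀, hy₀, hmin⟩ := isCompact_Icc.exists_isMinOn hne (hh.sub hg)
  filter_upwards [Ioo_mem_nhdsGT (show 0 < h y₀ - g y₀ from sub_pos.2 (hlt y₀ hy₀))] with ε hε y hy
  have h1 : h y₀ - g y₀ ≤ h y - g y := hmin hy
  linarith [hε.2]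

theorem Set.Finite.exists_lt_left {E : Set ℝ} (hE : E.Finite) {p a : ℝ} (hpa : p < a) :
    ∃ c, p < c ∧ c < a ∧ ∀ y ∈ E, c ≤ y → a ≤ y := by
  have h : (E \ {a})ᶜ ∈ 𝓝 a := (hE.subset sdiff_subset).isClosed.isOpen_compl.mem_nhds (by simp)
  obtain ⟨l, hl, hla⟩ := exists_Ioc_subset_of_mem_nhds h ⟨p, hpa⟩
  obtain ⟨c, hc, hca⟩ := _root_.exists_between (max_lt hl hpa)
  refine ⟨c, (le_max_right _ _).trans_lt hc, hca, fun y hy hcy => ?_⟩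
  by_contra hya
  push Not at hya
  exact hla ⟨((le_max_left _ _).trans_lt hc).trans_le hcy, hya.le⟩ ⟨hy, hya.ne⟩

theorem Set.Finite.exists_gt_right {E : Set ℝ} (hE : E.Finite) {p a : ℝ} (hpa : a < p) :
    ∃ c, c < p ∧ a < c ∧ ∀ y ∈ E, y ≤ c → y ≤ a := by
  have h : (E \ {a})ᶜ ∈ 𝓝 a := (hE.subset sdiff_subset).isClosed.isOpen_compl.mem_nhds (by simp)
  obtain ⟨l, hl, hla⟩ := exists_Ico_subset_of_mem_nhds h ⟨p, hpa⟩
  obtain ⟨c, hca, hc⟩ := _root_.exists_between (lt_min hl hpa)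
  refine ⟨c, hc.trans_le (min_le_right _ _), hca, fun y hy hcy => ?_⟩
  by_contra hya
  push Not at hya
  exact hla ⟨hya.le, hcy.trans_lt (hc.trans_le (min_le_left _ _))⟩ ⟨hy, hya.ne'⟩

end RealLemmas

/-! ### Double points, separation of arcs, and the equivalence relation. -/

namespace Configuration

variable {n : ℕ}

/-- The arc `i` meets the arc `j ≠ i` at height `y`. -/
def Meets (C : Configuration n) (i : Fin n) (y : ℝ) (j : Fin n) : Prop :=
  i ≠ j ∧ y ∈ Icc (0 : ℝ) 1 ∧ C.arc i y = C.arc j y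

variable {C : Configuration n} {i j k : Fin n} {y : ℝ}

theorem Meets.symm (h : C.Meets i y j) : C.Meets j y i := ⟨h.1.symm, h.2.1, h.2.2.symm⟩

theorem Meets.unique (h : C.Meets i y j) (h' : C.Meets i y k) : j = k := by
  by_contra hjk
  exact C.no_triple j i k h.1.symm h'.1 hjk y h.2.1 ⟨h.2.2.symm, h'.2.2⟩

theorem Meets.mem_Ioo (h : C.Meets i y j) : y ∈ Ioo (0 : ℝ) 1 :=
  C.mem_Ioo_of_arc_eq h.1 h.2.1 h.2.2

/-- The order of two arcs does not change on an interval on which they do not meet. -/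
theorem arc_lt_of_not_meets {S : Set ℝ} (hS : IsPreconnected S) (hS1 : S ⊆ Icc 0 1) (hij : i ≠ j)
    (hne : ∀ y ∈ S, ¬ C.Meets i y j) {y z : ℝ} (hy : y ∈ S) (hz : z ∈ S)
    (h : C.arc i y < C.arc j y) : C.arc i z < C.arc j z := by
  by_contra hlt
  obtain ⟨w, hw, he⟩ := hS.intermediate_value₂ hy hz ((C.continuousOn i).mono hS1)
    ((C.continuousOn j).mono hS1) h.le (not_lt.1 hlt)
  exact hne w hw ⟨hij, hS1 hw, he⟩

/-- Since `i` and `j` coincide at `y₀`, the arc `k` is there on the same side of both, and it cannot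
change sides without meeting them. -/
theorem separated_of_not_meets {c d y₀ : ℝ} (hc : 0 ≤ c) (hd : d ≤ 1)
    (hy₀ : y₀ ∈ Icc c d) (hm : C.Meets i y₀ j)
    (hne : ∀ k, k ≠ i → k ≠ j → ∀ y ∈ Icc c d, ¬ C.Meets i y k ∧ ¬ C.Meets j y k) :
    ∀ k, k ≠ i → k ≠ j → (∀ y ∈ Icc c d, C.arc k y < C.arc i y ∧ C.arc k y < C.arc j y) ∨
      (∀ y ∈ Icc c d, C.arc i y < C.arc k y ∧ C.arc j y < C.arc k y) := by
  intro k hki hkj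
  have hS1 : Icc c d ⊆ Icc (0 : ℝ) 1 := Icc_subset_Icc hc hd
  have hi : ∀ y ∈ Icc c d, ¬ C.Meets i y k := fun y hy => (hne k hki hkj y hy).1
  have hj : ∀ y ∈ Icc c d, ¬ C.Meets j y k := fun y hy => (hne k hki hkj y hy).2
  have hi' : ∀ y ∈ Icc c d, ¬ C.Meets k y i := fun y hy h => hi y hy h.symm
  have hj' : ∀ y ∈ Icc c d, ¬ C.Meets k y j := fun y hy h => hj y hy h.symm
  have hne0 : C.arc i y₀ ≠ C.arc k y₀ := fun h => hi y₀ hy₀ ⟨hki.symm, hS1 hy₀, h⟩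
  rcases hne0.lt_or_gt with h | h
  · exact Or.inr fun y hy => ⟨arc_lt_of_not_meets isPreconnected_Icc hS1 hki.symm hi hy₀ hy h,
      arc_lt_of_not_meets isPreconnected_Icc hS1 hkj.symm hj hy₀ hy (hm.2.2 ▸ h)⟩
  · exact Or.inl fun y hy => ⟨arc_lt_of_not_meets isPreconnected_Icc hS1 hki hi' hy₀ hy h,
      arc_lt_of_not_meets isPreconnected_Icc hS1 hkj hj' hy₀ hy (hm.2.2 ▸ h)⟩

/-- This uniform margin is the room in which `i` and `j` can be moved without touching another arc.
-/
theorem exists_gap {c d y₀ : ℝ} (hc : 0 ≤ c) (hd : d ≤ 1)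
    (hy₀ : y₀ ∈ Icc c d) (hm : C.Meets i y₀ j)
    (hne : ∀ k, k ≠ i → k ≠ j → ∀ y ∈ Icc c d, ¬ C.Meets i y k ∧ ¬ C.Meets j y k) :
    ∃ ε > 0, ∀ k, k ≠ i → k ≠ j →
      (∀ y ∈ Icc c d, C.arc k y + ε < C.arc i y ∧ C.arc k y + ε < C.arc j y) ∨
      (∀ y ∈ Icc c d, C.arc i y + ε < C.arc k y ∧ C.arc j y + ε < C.arc k y) := by
  have hS1 : Icc c d ⊆ Icc (0 : ℝ) 1 := Icc_subset_Icc hc hd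
  have hcont : ∀ k, ContinuousOn (C.arc k) (Icc c d) := fun k => (C.continuousOn k).mono hS1
  have hev : ∀ᶠ ε in 𝓝[>] (0 : ℝ), ∀ k, k ≠ i → k ≠ j →
      (∀ y ∈ Icc c d, C.arc k y + ε < C.arc i y ∧ C.arc k y + ε < C.arc j y) ∨
      (∀ y ∈ Icc c d, C.arc i y + ε < C.arc k y ∧ C.arc j y + ε < C.arc k y) := by
    refine eventually_all.2 fun k => ?_
    by_cases hki : k = i
    · simp [hki]
    by_cases hkj : k = j
    · simp [hkj]
    rcases separated_of_not_meets hc hd hy₀ hm hne k hki hkj with h | h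
    · filter_upwards [eventually_forall_add_lt (hcont k) (hcont i) fun y hy => (h y hy).1,
        eventually_forall_add_lt (hcont k) (hcont j) fun y hy => (h y hy).2] with ε h1 h2 _ _
      exact Or.inl fun y hy => ⟨h1 y hy, h2 y hy⟩
    · filter_upwards [eventually_forall_add_lt (hcont i) (hcont k) fun y hy => (h y hy).1,
        eventually_forall_add_lt (hcont j) (hcont k) fun y hy => (h y hy).2] with ε h1 h2 _ _
      exact Or.inr fun y hy => ⟨h1 y hy, h2 y hy⟩
  obtain ⟨ε, h, hε⟩ := (hev.and self_mem_nhdsWithin).exists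
  exact ⟨ε, hε, h⟩

/-- Moving only the points `i` and `j`, without meeting others, creates no triple point. -/
theorem no_triple_of_separated {x x₀ : Fin n → ℝ}
    (h₀ : ∀ p q r, p ≠ q → q ≠ r → p ≠ r → ¬ (x₀ p = x₀ q ∧ x₀ q = x₀ r))
    (hx : ∀ q, q ≠ i → q ≠ j → x q = x₀ q)
    (hi : ∀ q, q ≠ i → q ≠ j → x i ≠ x q) (hj : ∀ q, q ≠ i → q ≠ j → x j ≠ x q) :
    ∀ p q r, p ≠ q → q ≠ r → p ≠ r → ¬ (x p = x q ∧ x q = x r) := by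
  intro p q r hpq hqr hpr ⟨h1, h2⟩
  have h0 := h₀ p q r hpq hqr hpr
  have := hx p; have := hx q; have := hx r
  have := hi p; have := hi q; have := hi r
  have := hj p; have := hj q; have := hj r
  grind

theorem Equivalent.of_linear {C C' : Configuration n}
    (h0 : ∀ i, C'.arc i 0 = C.arc i 0) (h1 : ∀ i, C'.arc i 1 = C.arc i 1)
    (h : ∀ t ∈ Icc (0 : ℝ) 1, ∀ y ∈ Icc (0 : ℝ) 1, ∀ i j k, i ≠ j → j ≠ k → i ≠ k →
      ¬ ((1 - t) * C.arc i y + t * C'.arc i y = (1 - t) * C.arc j y + t * C'.arc j y ∧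
        (1 - t) * C.arc j y + t * C'.arc j y = (1 - t) * C.arc k y + t * C'.arc k y)) :
    C.Equivalent C' := by
  -- A homotopy has to supply a configuration for every real parameter, so the parameter is clamped
  -- to `[0, 1]`.
  let τ : ℝ → ℝ := fun t => projIcc (0 : ℝ) 1 zero_le_one t
  have hτc : Continuous τ := continuous_subtype_val.comp continuous_projIcc
  have hτ : ∀ t ∈ Icc (0 : ℝ) 1, τ t = t := fun t ht => by simp only [τ]; rw [projIcc_of_mem _ ht]
  refine ⟨fun t => ⟨fun i y => (1 - τ t) * C.arc i y + τ t * C'.arc i y, fun i => ?_, fun i => ?_,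
    ?_, ?_⟩, fun i => ?_, fun i y _ => ?_, fun i y _ => ?_, fun t _ i => ⟨?_, ?_⟩⟩
  · exact (continuousOn_const.mul (C.continuousOn i)).add
      (continuousOn_const.mul (C'.continuousOn i))
  · simp only [h0, C.bottom]; ring
  · obtain ⟨π, hπ⟩ := C.top
    exact ⟨π, fun i => by simp only [h1, hπ]; ring⟩
  · intro i j k hij hjk hik y hy
    exact h (τ t) (projIcc (0 : ℝ) 1 zero_le_one t).2 y hy i j k hij hjk hik
  · have hm : MapsTo (Prod.snd : ℝ × ℝ → ℝ) (Icc 0 1 ×ˢ Icc 0 1) (Icc 0 1) := fun z hz => hz.2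
    have h3 : Continuous (fun z : ℝ × ℝ => τ z.1) := hτc.comp continuous_fst
    exact ((continuous_const.sub h3).continuousOn.mul
      ((C.continuousOn i).comp continuousOn_snd hm)).add
      (h3.continuousOn.mul ((C'.continuousOn i).comp continuousOn_snd hm))
  · simp [hτ 0 (by simp)]
  · simp [hτ 1 (by simp)]
  · simp only [h0]; ring
  · simp only [h1]; ring

theorem Equivalent.symm {C C' : Configuration n} (h : C.Equivalent C') : C'.Equivalent C := by
  obtain ⟨H, hc, h0, h1, he⟩ := h
  refine ⟨fun t => H (1 - t), fun i => ?_, fun i y hy => ?_, fun i y hy => ?_, fun t ht i => ?_⟩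
  · refine (hc i).comp (f := fun z : ℝ × ℝ => (1 - z.1, z.2)) (by fun_prop) ?_
    rintro ⟨t, y⟩ ⟨ht, hy⟩
    simp only [mem_prod, mem_Icc] at *
    exact ⟨⟨by linarith, by linarith⟩, hy⟩
  · simp only [sub_zero]; exact h1 i y hy
  · simp only [sub_self]; exact h0 i y hy
  · have h2 := he (1 - t) ⟨by linarith [ht.2], by linarith [ht.1]⟩ i
    have h3 := he 1 (by simp) i
    rw [h2.1, h2.2, ← h3.1, ← h3.2, h1 i 0 (by simp), h1 i 1 (by simp)]
    simp

theorem Equivalent.arc_one {C C' : Configuration n} (h : C.Equivalent C') (i : Fin n) :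
    C.arc i 1 = C'.arc i 1 := by
  obtain ⟨H, hc, h0, h1, he⟩ := h
  rw [← (he 1 (by simp) i).2, h1 i 1 (by simp)]

theorem Equivalent.trans {C C' C'' : Configuration n} (h : C.Equivalent C')
    (h' : C'.Equivalent C'') : C.Equivalent C'' := by
  have harc := h.arc_one
  obtain ⟨H, hc, h0, h1, he⟩ := h
  obtain ⟨H', hc', h0', h1', he'⟩ := h'
  classical
  refine ⟨fun t => if t ≤ 1 / 2 then H (2 * t) else H' (2 * t - 1), fun i => ?_, fun i y hy => ?_,
    fun i y hy => ?_, fun t ht i => ?_⟩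
  · have hset : Icc (0 : ℝ) 1 ×ˢ Icc (0 : ℝ) 1 =
        (Icc (0 : ℝ) (1 / 2) ×ˢ Icc (0 : ℝ) 1) ∪ (Icc (1 / 2 : ℝ) 1 ×ˢ Icc (0 : ℝ) 1) := by
      rw [← union_prod, Icc_union_Icc_eq_Icc (by norm_num) (by norm_num)]
    rw [hset]
    refine ContinuousOn.union_of_isClosed ?_ ?_ (isClosed_Icc.prod isClosed_Icc)
      (isClosed_Icc.prod isClosed_Icc)
    · refine ((hc i).comp (f := fun z : ℝ × ℝ => (2 * z.1, z.2)) (by fun_prop) ?_).congr ?_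
      · rintro ⟨t, y⟩ ⟨ht, hy⟩
        simp only [mem_prod, mem_Icc] at *
        exact ⟨⟨by linarith, by linarith⟩, hy⟩
      · rintro ⟨t, y⟩ ⟨ht, hy⟩
        simp [show t ≤ 2⁻¹ by simpa using ht.2]
    · refine ((hc' i).comp (f := fun z : ℝ × ℝ => (2 * z.1 - 1, z.2)) (by fun_prop) ?_).congr ?_
      · rintro ⟨t, y⟩ ⟨ht, hy⟩
        simp only [mem_prod, mem_Icc] at *
        exact ⟨⟨by linarith, by linarith⟩, hy⟩
      · rintro ⟨t, y⟩ ⟨ht, hy⟩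
        -- At the seam `t = 1 / 2` the definition uses the first homotopy; its final position is the
        -- initial position of the second one.
        rcases ht.1.eq_or_lt with h | h
        · simp only at h
          subst h
          have e1 := h1 i y hy
          have e2 := h0' i y hy
          simp only [Function.comp_apply, le_refl, if_true]
          norm_num
          rw [e1, e2]
        · simp only at h
          simp [show ¬ t ≤ 2⁻¹ by simpa using h]
  · simp [h0 i y hy]
  · norm_num [h1' i y hy]
  · by_cases h : t ≤ 1 / 2
    · simp only [h, if_true]
      exact he (2 * t) ⟨by linarith [ht.1], by linarith⟩ i
    · simp only [h, if_false]
      have h2 := he' (2 * t - 1) ⟨by linarith, by linarith [ht.2]⟩ i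
      rw [h2.1, h2.2, harc i, C.bottom, C'.bottom]
      simp

end Configuration

/-! ### Double points of diagrams and local replacement of two arcs. -/

namespace Diagram

variable {n : ℕ} (D : Diagram n)

/-- An accumulation point of common points would itself be a double point, but a zero with nonzero
derivative is isolated. -/
theorem finite_meets (i j : Fin n) : {y | D.Meets i y j}.Finite := by
  by_cases hij : i = j
  · simp [Configuration.Meets, hij]
  by_contra hinf
  obtain ⟨f, hf, hfe⟩ := D.smooth i
  obtain ⟨g, hg, hge⟩ := D.smooth j
  obtain ⟨y, hy, hacc⟩ := Set.Infinite.exists_accPt_of_subset_isCompact hinf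
    (isCompact_Icc (a := (0 : ℝ)) (b := 1)) fun y hy => hy.2.1
  rw [accPt_iff_frequently_nhdsNE] at hacc
  have hfr : ∃ᶠ z in 𝓝[≠] y, f z - g z = 0 := hacc.mono fun z hz => by
    rw [← hfe hz.2.1, ← hge hz.2.1, hz.2.2, sub_self]
  have hfg : Continuous fun z => f z - g z := hf.continuous.sub hg.continuous
  have h0 : f y - g y = 0 :=
    (isClosed_singleton.preimage hfg).mem_of_frequently_of_tendsto
      (hfr.filter_mono nhdsWithin_le_nhds) tendsto_id
  have hm : D.arc i y = D.arc j y := by rw [hfe hy, hge hy]; linarith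
  have hy1 := D.mem_Ioo_of_arc_eq hij hy hm
  have ht := D.transverse i j hij y hy hm
  rw [deriv_eq_of_eqOn hfe hy1, deriv_eq_of_eqOn hge hy1] at ht
  exact hfr (((hf.differentiable (by simp) y).hasDerivAt.sub
    (hg.differentiable (by simp) y).hasDerivAt).eventually_ne (sub_ne_zero.2 ht))

/-- The set of heights of double points. -/
def heights : Set ℝ := {y | ∃ i j, D.Meets i y j}

theorem finite_heights : D.heights.Finite := by
  have : D.heights = ⋃ i, ⋃ j, {y | D.Meets i y j} := by ext; simp [heights]
  rw [this]
  exact finite_iUnion fun i => finite_iUnion fun j => D.finite_meets i j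

variable {D}

/-- Two arcs change sides at a transverse double point. -/
theorem arc_lt_flip {i j : Fin n} {a c d : ℝ} (hm : D.Meets i a j) (hc : 0 ≤ c) (hca : c < a)
    (had : a < d) (hd : d ≤ 1) (hne : ∀ y ∈ Icc c d, D.Meets i y j → y = a)
    (h : D.arc i c < D.arc j c) : D.arc j d < D.arc i d := by
  obtain ⟨f, hf, hfe⟩ := D.smooth i
  obtain ⟨g, hg, hge⟩ := D.smooth j
  have hy1 := hm.mem_Ioo
  have ht := D.transverse i j hm.1 a hm.2.1 hm.2.2
  rw [deriv_eq_of_eqOn hfe hy1, deriv_eq_of_eqOn hge hy1] at ht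
  obtain ⟨k, hk, hka, hkf⟩ := exists_contDiff_eq_add_mul (hf.sub hg) a
  rw [deriv_fun_sub (hf.differentiable (by simp) a) (hg.differentiable (by simp) a)] at hka
  have hka0 : k a ≠ 0 := by rw [hka]; exact sub_ne_zero.2 ht
  rw [← hfe hm.2.1, ← hge hm.2.1, hm.2.2, sub_self] at hkf
  have hIc : Icc c d ⊆ Icc 0 1 := Icc_subset_Icc hc hd
  have hval : ∀ y ∈ Icc c d, D.arc i y - D.arc j y = (y - a) * k y := fun y hy => by
    rw [hfe (hIc hy), hge (hIc hy), hkf]; ring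
  have hleft : ∀ y ∈ Ico c a, (y - a) * k y < 0 := fun y hy => by
    rw [← hval y ⟨hy.1, hy.2.le.trans had.le⟩, sub_neg]
    refine Configuration.arc_lt_of_not_meets (S := Ico c a) isPreconnected_Ico
      (fun z hz => hIc ⟨hz.1, hz.2.le.trans had.le⟩) hm.1 (fun z hz hmz => ?_)
      ⟨le_rfl, hca⟩ hy h
    exact hz.2.ne (hne z ⟨hz.1, hz.2.le.trans had.le⟩ hmz)
  -- On the left of `a` both `y - a` and the product with `k y` are negative, so `k` is positive
  -- there and `k a` is nonnegative in the limit; transversality excludes zero.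
  have hkpos : 0 < k a := by
    refine lt_of_le_of_ne ?_ hka0.symm
    have : ∀ᶠ y in 𝓝[<] a, 0 ≤ k y := by
      filter_upwards [Ico_mem_nhdsLT hca] with y hy
      have := hleft y hy
      have h1 : y - a < 0 := sub_neg.2 hy.2
      by_contra hneg
      push Not at hneg
      nlinarith
    exact ge_of_tendsto (hk.continuous.continuousAt.tendsto.mono_left nhdsWithin_le_nhds) this
  obtain ⟨y, hky, hy⟩ := (((hk.continuous.continuousAt.eventually_const_lt hkpos).filter_mono
    nhdsWithin_le_nhds).and (Ioc_mem_nhdsGT had)).exists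
  have hlt : D.arc j y < D.arc i y := by
    have := hval y ⟨hca.le.trans hy.1.le, hy.2⟩
    have h1 : 0 < (y - a) * k y := mul_pos (sub_pos.2 hy.1) hky
    linarith
  refine Configuration.arc_lt_of_not_meets (S := Ioc a d) isPreconnected_Ioc
    (fun z hz => hIc ⟨hca.le.trans hz.1.le, hz.2⟩) hm.1.symm (fun z hz hmz => ?_) hy ⟨had, le_rfl⟩
    hlt
  exact hz.1.ne' (hne z ⟨hca.le.trans hz.1.le, hz.2⟩ hmz.symm)

/-- A third arc in the closed disc would have to cross its boundary: in the open sides `i` and `j`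
meet nothing, and a crossing at a corner would be a triple point. -/
theorem exists_isBigon {i j : Fin n} {a b : ℝ} (hab : a < b) (ha : D.Meets i a j)
    (hb : D.Meets i b j) (hi : ∀ k, ∀ y ∈ Ioo a b, ¬ D.Meets i y k)
    (hj : ∀ k, ∀ y ∈ Ioo a b, ¬ D.Meets j y k) : ∃ i j, D.IsBigon i j a b := by
  have hsub : Ioo a b ⊆ Icc 0 1 := fun y hy => ⟨ha.2.1.1.trans hy.1.le, hy.2.le.trans hb.2.1.2⟩
  have hsep := Configuration.separated_of_not_meets (C := D.toConfiguration) ha.2.1.1 hb.2.1.2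
    ⟨le_rfl, hab.le⟩ ha fun k hki hkj y hy => by
      rcases hy.1.eq_or_lt with h | h
      · subst h
        exact ⟨fun hm => hkj (hm.unique ha), fun hm => hki (hm.unique ha.symm)⟩
      rcases hy.2.eq_or_lt with h' | h'
      · subst h'
        exact ⟨fun hm => hkj (hm.unique hb), fun hm => hki (hm.unique hb.symm)⟩
      · exact ⟨hi k y ⟨h, h'⟩, hj k y ⟨h, h'⟩⟩
  obtain ⟨y₀, hy₀⟩ := exists_between hab
  have hne : D.arc i y₀ ≠ D.arc j y₀ := fun h => hi j y₀ hy₀ ⟨ha.1, hsub hy₀, h⟩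
  rcases hne.lt_or_gt with h | h
  · refine ⟨i, j, ha.2.1.1, hab, hb.2.1.2, ha.2.2, hb.2.2, fun y hy => ?_, ?_⟩
    · exact Configuration.arc_lt_of_not_meets isPreconnected_Ioo hsub ha.1 (hi j) hy₀ hy h
    · intro k hki hkj y hy hk
      rcases hsep k hki hkj with h | h
      · exact absurd hk.1 (not_le.2 (h y hy).1)
      · exact absurd hk.2 (not_le.2 (h y hy).2)
  · refine ⟨j, i, ha.2.1.1, hab, hb.2.1.2, ha.2.2.symm, hb.2.2.symm, fun y hy => ?_, ?_⟩
    · exact Configuration.arc_lt_of_not_meets isPreconnected_Ioo hsub ha.1.symm (hj i) hy₀ hy h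
    · intro k hkj hki y hy hk
      rcases hsep k hki hkj with h | h
      · exact absurd hk.1 (not_le.2 (h y hy).2)
      · exact absurd hk.2 (not_le.2 (h y hy).1)

/-- Replacing the arcs `i` and `j` between the heights `c` and `d`. -/
theorem exists_replace {i j : Fin n} (hij : i ≠ j) {c d : ℝ} (hc : 0 ≤ c) (hd : d ≤ 1) {gi gj : ℝ → ℝ}
    (hgi : ∃ g : ℝ → ℝ, ContDiff ℝ ∞ g ∧ EqOn gi g (Icc 0 1))
    (hgj : ∃ g : ℝ → ℝ, ContDiff ℝ ∞ g ∧ EqOn gj g (Icc 0 1))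
    (hi : ∀ y ∈ Icc (0 : ℝ) 1, y ∉ Ioo c d → gi y = D.arc i y)
    (hj : ∀ y ∈ Icc (0 : ℝ) 1, y ∉ Ioo c d → gj y = D.arc j y)
    (hki : ∀ k, k ≠ i → k ≠ j → ∀ y ∈ Icc c d, gi y ≠ D.arc k y)
    (hkj : ∀ k, k ≠ i → k ≠ j → ∀ y ∈ Icc c d, gj y ≠ D.arc k y)
    (ht : ∀ y ∈ Icc c d, gi y = gj y → deriv gi y ≠ deriv gj y) :
    ∃ D' : Diagram n, D'.arc i = gi ∧ D'.arc j = gj ∧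
      ∀ k, k ≠ i → k ≠ j → D'.arc k = D.arc k := by
  classical
  let g : Fin n → ℝ → ℝ := fun k => if k = i then gi else if k = j then gj else D.arc k
  have g1 : g i = gi := by simp [g]
  have g2 : g j = gj := by simp [g, hij.symm]
  have g3 : ∀ k, k ≠ i → k ≠ j → g k = D.arc k := fun k h1 h2 => by simp [g, h1, h2]
  have gcase : ∀ k, k = i ∨ k = j ∨ (k ≠ i ∧ k ≠ j) := fun k => by tauto
  have goff : ∀ k, ∀ y ∈ Icc (0 : ℝ) 1, y ∉ Ioo c d → g k y = D.arc k y := by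
    intro k y hy hy'
    rcases gcase k with rfl | rfl | ⟨h1, h2⟩
    · rw [g1, hi y hy hy']
    · rw [g2, hj y hy hy']
    · rw [g3 k h1 h2]
  have gsm : ∀ k, ∃ h : ℝ → ℝ, ContDiff ℝ ∞ h ∧ EqOn (g k) h (Icc 0 1) := by
    intro k
    rcases gcase k with rfl | rfl | ⟨h1, h2⟩
    · rwa [g1]
    · rwa [g2]
    · rw [g3 k h1 h2]; exact D.smooth k
  have g0 : ∀ k, g k 0 = D.arc k 0 := fun k => goff k 0 (by simp) fun h => not_lt.2 hc h.1
  have g01 : ∀ k, g k 1 = D.arc k 1 := fun k => goff k 1 (by simp) fun h => not_lt.2 hd h.2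
  refine ⟨⟨⟨g, fun k => ?_, fun k => ?_, ?_, ?_⟩, gsm, ?_⟩, g1, g2, g3⟩
  · obtain ⟨h, hh, he⟩ := gsm k
    exact hh.continuous.continuousOn.congr he
  · rw [g0, D.bottom]
  · obtain ⟨π, hπ⟩ := D.top
    exact ⟨π, fun k => by rw [g01, hπ]⟩
  · intro p q r hpq hqr hpr y hy
    by_cases hycd : y ∈ Ioo c d
    · have hy' : y ∈ Icc c d := Ioo_subset_Icc_self hycd
      refine Configuration.no_triple_of_separated (i := i) (j := j) (x := fun k => g k y)
        (x₀ := fun k => D.arc k y)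
        (fun p q r h1 h2 h3 => D.no_triple p q r h1 h2 h3 y hy) (fun q h1 h2 => ?_)
        (fun q h1 h2 => ?_) (fun q h1 h2 => ?_) p q r hpq hqr hpr
      · simp only [g3 q h1 h2]
      · simp only [g3 q h1 h2, g1]; exact hki q h1 h2 y hy'
      · simp only [g3 q h1 h2, g2]; exact hkj q h1 h2 y hy'
    · rw [goff p y hy hycd, goff q y hy hycd, goff r y hy hycd]
      exact D.no_triple p q r hpq hqr hpr y hy
  · intro p q hpq y hy he
    simp only at he ⊢
    -- The heights `c` and `d` belong to the first case: the arcs have their old values there, but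
    -- not in a neighbourhood, so their derivatives are not simply inherited.
    by_cases hycd : y ∈ Icc c d
    · rcases gcase p with rfl | rfl | ⟨h1, h2⟩ <;> rcases gcase q with rfl | rfl | ⟨h3, h4⟩
      · exact absurd rfl hpq
      · rw [g1, g2] at *; exact ht y hycd he
      · rw [g1, g3 q h3 h4] at he; exact absurd he (hki q h3 h4 y hycd)
      · rw [g1, g2] at *; exact (ht y hycd he.symm).symm
      · exact absurd rfl hpq
      · rw [g2, g3 q h3 h4] at he; exact absurd he (hkj q h3 h4 y hycd)
      · rw [g1, g3 p h1 h2] at he; exact absurd he.symm (hki p h1 h2 y hycd)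
      · rw [g2, g3 p h1 h2] at he; exact absurd he.symm (hkj p h1 h2 y hycd)
      · rw [g3 p h1 h2, g3 q h3 h4] at *; exact D.transverse p q hpq y hy he
    · have hycd' : y ∉ Ioo c d := fun h => hycd (Ioo_subset_Icc_self h)
      rw [goff p y hy hycd', goff q y hy hycd'] at he
      have hy1 := D.mem_Ioo_of_arc_eq hpq hy he
      have hev : ∀ k, g k =ᶠ[𝓝 y] D.arc k := fun k => by
        filter_upwards [isClosed_Icc.isOpen_compl.mem_nhds hycd, Icc_mem_nhds hy1.1 hy1.2]
          with z hz hz'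
        exact goff k z hz' fun h => hz (Ioo_subset_Icc_self h)
      rw [(hev p).deriv_eq, (hev q).deriv_eq]
      exact D.transverse p q hpq y hy he

end Diagram

/-! ### Removal of bigons and termination. -/

namespace Diagram

variable {n : ℕ}

/-- Inside the slab every other arc lies on one side of the old and the new positions of `i` and
`j`, hence of all their convex combinations, and the straight-line homotopy has no triple points. -/
theorem MinusTwo.equivalent {D D' : Diagram n} (h : D.MinusTwo D') :
    D.toConfiguration.Equivalent D'.toConfiguration := by
  obtain ⟨i, j, a, b, c, d, -, hc, hca, hbd, hd, hk, hoff, -, -, hsep⟩ := h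
  refine Configuration.Equivalent.of_linear
    (fun k => hoff k 0 (by simp) fun h => not_lt.2 hc h.1)
    (fun k => hoff k 1 (by simp) fun h => not_lt.2 hd h.2) fun t ht y hy => ?_
  have h1t : 0 ≤ 1 - t := sub_nonneg.2 ht.2
  have hlt : ∀ {u v u' v' : ℝ}, u < v → u' < v' → (1 - t) * u + t * u' < (1 - t) * v + t * v' := by
    intro u v u' v' h h'
    rcases ht.1.eq_or_lt with h0 | h0
    · rw [← h0]; simpa using h
    · nlinarith [mul_lt_mul_of_pos_left h' h0, mul_le_mul_of_nonneg_left h.le h1t]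
  have hconst : ∀ u : ℝ, (1 - t) * u + t * u = u := fun u => by ring
  by_cases hycd : y ∈ Ioo c d
  · refine Configuration.no_triple_of_separated (i := i) (j := j)
      (x := fun k => (1 - t) * D.arc k y + t * D'.arc k y) (x₀ := fun k => D.arc k y)
      (fun p q r h1 h2 h3 => D.no_triple p q r h1 h2 h3 y hy) (fun q h1 h2 => ?_)
      (fun q h1 h2 => ?_) (fun q h1 h2 => ?_)
    · rw [hk q h1 h2 y hy, hconst]
    · rw [hk q h1 h2 y hy]
      rcases hsep q h1 h2 y (Ioo_subset_Icc_self hycd) with ⟨h3, -, h5, -⟩ | ⟨h3, -, h5, -⟩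
      · exact (hlt h3 h5).ne'
      · exact (hlt h3 h5).ne
    · rw [hk q h1 h2 y hy]
      rcases hsep q h1 h2 y (Ioo_subset_Icc_self hycd) with ⟨-, h3, -, h5⟩ | ⟨-, h3, -, h5⟩
      · exact (hlt h3 h5).ne'
      · exact (hlt h3 h5).ne
  · intro p q r h1 h2 h3
    rw [hoff p y hy hycd, hoff q y hy hycd, hoff r y hy hycd, hconst, hconst, hconst]
    exact D.no_triple p q r h1 h2 h3 y hy

/-- The set of double points, as a set of ordered pairs of arcs with a height. -/
def doublePoints (D : Diagram n) : Set (Fin n × Fin n × ℝ) := {z | D.Meets z.1 z.2.2 z.2.1}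

theorem finite_doublePoints (D : Diagram n) : D.doublePoints.Finite := by
  refine ((finite_univ (α := Fin n)).prod ((finite_univ (α := Fin n)).prod
    D.finite_heights)).subset ?_
  rintro ⟨i, j, y⟩ h
  exact ⟨trivial, trivial, i, j, h⟩

/-- In the slab the arcs `i` and `j` meet no arc after the move, so no double point is created; the
corner at height `a` disappears. -/
theorem MinusTwo.ncard_doublePoints_lt {D D' : Diagram n} (h : D.MinusTwo D') :
    D'.doublePoints.ncard < D.doublePoints.ncard := by
  obtain ⟨i, j, a, b, c, d, hbig, hc, hca, hbd, hd, hk, hoff, -, hne, hsep⟩ := h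
  obtain ⟨h0a, hab, hb1, hma, -, hlt, -⟩ := hbig
  have hij : i ≠ j := by
    rintro rfl
    obtain ⟨y, hy⟩ := exists_between hab
    exact lt_irrefl _ (hlt y hy)
  refine ncard_lt_ncard ⟨?_, fun hsub => ?_⟩ D.finite_doublePoints
  · rintro ⟨p, q, y⟩ ⟨hpq, hy, he⟩
    refine ⟨hpq, hy, ?_⟩
    simp only at *
    by_cases hycd : y ∈ Ioo c d
    · have hy' := Ioo_subset_Icc_self hycd
      have hs := fun k h1 h2 => hsep k h1 h2 y hy'
      have hn := hne y hy'
      have hkk := fun k h1 h2 => hk k h1 h2 y hy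
      have := hs p; have := hs q; have := hkk p; have := hkk q
      grind
    · rwa [hoff p y hy hycd, hoff q y hy hycd] at he
  · have : (i, j, a) ∈ D'.doublePoints := hsub ⟨hij, ⟨h0a, hab.le.trans hb1⟩, hma⟩
    exact hne a ⟨hca.le, hab.le.trans hbd.le⟩ this.2.2

/-- A bigon can be removed by a `(-2)` move. -/
theorem IsBigon.exists_minusTwo {D : Diagram n} {i j : Fin n} {a b : ℝ} (h : D.IsBigon i j a b) :
    ∃ D', D.MinusTwo D' := by
  have hbig := h
  obtain ⟨h0a, hab, hb1, hma, hmb, hlt, hk⟩ := h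
  have hij : i ≠ j := by
    rintro rfl
    obtain ⟨y, hy⟩ := exists_between hab
    exact lt_irrefl _ (hlt y hy)
  have hma : D.Meets i a j := ⟨hij, ⟨h0a, hab.le.trans hb1⟩, hma⟩
  have hmb : D.Meets i b j := ⟨hij, ⟨h0a.trans hab.le, hb1⟩, hmb⟩
  obtain ⟨c, h0c, hca, hcE⟩ := D.finite_heights.exists_lt_left hma.mem_Ioo.1
  obtain ⟨d, hd1, hbd, hdE⟩ := D.finite_heights.exists_gt_right hmb.mem_Ioo.2
  have hE : ∀ y ∈ Icc c d, ∀ p q, D.Meets p y q → y ∈ Icc a b := fun y hy p q hm =>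
    ⟨hcE y ⟨p, q, hm⟩ hy.1, hdE y ⟨p, q, hm⟩ hy.2⟩
  have hcd01 : Icc c d ⊆ Icc 0 1 := Icc_subset_Icc h0c.le hd1.le
  have hle : ∀ y ∈ Icc a b, D.arc i y ≤ D.arc j y := fun y hy => by
    rcases hy.1.eq_or_lt with h | h
    · rw [← h]; exact hma.2.2.le
    rcases hy.2.eq_or_lt with h' | h'
    · rw [h']; exact hmb.2.2.le
    exact (hlt y ⟨h, h'⟩).le
  have hmij : ∀ y ∈ Icc c d, D.Meets i y j → y = a ∨ y = b := fun y hy hm => by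
    have hy' := hE y hy i j hm
    by_contra hne
    push Not at hne
    exact (hlt y ⟨lt_of_le_of_ne hy'.1 hne.1.symm, lt_of_le_of_ne hy'.2 hne.2⟩).ne hm.2.2
  have hoth : ∀ k, k ≠ i → k ≠ j → ∀ y ∈ Icc c d, ¬ D.Meets i y k ∧ ¬ D.Meets j y k := by
    intro k hki hkj y hy
    refine ⟨fun hm => ?_, fun hm => ?_⟩
    · have hy' := hE y hy _ _ hm
      exact hk k hki hkj y hy' (by rw [← hm.2.2]; exact ⟨le_rfl, hle y hy'⟩)
    · have hy' := hE y hy _ _ hm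
      exact hk k hki hkj y hy' (by rw [← hm.2.2]; exact ⟨hle y hy', le_rfl⟩)
  have haI : a ∈ Icc c d := ⟨hca.le, hab.le.trans hbd.le⟩
  obtain ⟨ε, hε, hgap⟩ := Configuration.exists_gap h0c.le hd1.le haI hma hoth
  obtain ⟨y₀, hy₀⟩ := exists_between hab
  -- Beyond either corner the arcs have changed sides, so there `i` is already to the right of `j`.
  have hleft : ∀ y ∈ Ico c a, D.arc j y < D.arc i y := by
    intro y hy
    have hycd : y ∈ Icc c d := ⟨hy.1, hy.2.le.trans haI.2⟩
    by_contra hge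
    have hne : D.arc i y ≠ D.arc j y := fun he =>
      not_le.2 hy.2 (hE y hycd i j ⟨hij, hcd01 hycd, he⟩).1
    have := arc_lt_flip hma (hcd01 hycd).1 hy.2 hy₀.1 (hy₀.2.le.trans hb1) (fun z hz hm => ?_)
      (lt_of_le_of_ne (not_lt.1 hge) hne)
    · exact lt_asymm this (hlt y₀ hy₀)
    · rcases hmij z ⟨hy.1.trans hz.1, hz.2.trans (hy₀.2.le.trans hbd.le)⟩ hm with h | h
      · exact h
      · exact absurd hz.2 (not_le.2 (h ▸ hy₀.2))
  have hright : ∀ y ∈ Ioc b d, D.arc j y < D.arc i y := by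
    intro y hy
    have hycd : y ∈ Icc c d := ⟨haI.1.trans (hab.le.trans hy.1.le), hy.2⟩
    refine arc_lt_flip hmb (h0a.trans hy₀.1.le) hy₀.2 hy.1 (hcd01 hycd).2 (fun z hz hm => ?_)
      (hlt y₀ hy₀)
    rcases hmij z ⟨hca.le.trans (hy₀.1.le.trans hz.1), hz.2.trans hy.2⟩ hm with h | h
    · exact absurd hz.1 (not_le.2 (h ▸ hy₀.1))
    · exact h
  let ψ : ℝ → ℝ := fun y => Real.smoothTransition ((y - c) / (a - c)) *
    Real.smoothTransition ((d - y) / (d - b))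
  have hψ : ContDiff ℝ ∞ ψ := (Real.smoothTransition.contDiff.comp (by fun_prop)).mul
    (Real.smoothTransition.contDiff.comp (by fun_prop))
  have hψ0 : ∀ y, y ∉ Ioo c d → ψ y = 0 := by
    intro y hy
    rcases le_or_gt y c with h | h
    · have : Real.smoothTransition ((y - c) / (a - c)) = 0 :=
        Real.smoothTransition.zero_of_nonpos
          (div_nonpos_of_nonpos_of_nonneg (by linarith) (by linarith))
      simp [ψ, this]
    · have h' : d ≤ y := not_lt.1 fun h' => hy ⟨h, h'⟩
      have : Real.smoothTransition ((d - y) / (d - b)) = 0 :=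
        Real.smoothTransition.zero_of_nonpos
          (div_nonpos_of_nonpos_of_nonneg (by linarith) (by linarith))
      simp [ψ, this]
  have hψ1 : ∀ y ∈ Icc a b, ψ y = 1 := by
    intro y hy
    have h1 : Real.smoothTransition ((y - c) / (a - c)) = 1 :=
      Real.smoothTransition.one_of_one_le ((one_le_div (by linarith)).2 (by linarith [hy.1]))
    have h2 : Real.smoothTransition ((d - y) / (d - b)) = 1 :=
      Real.smoothTransition.one_of_one_le ((one_le_div (by linarith)).2 (by linarith [hy.2]))
    simp [ψ, h1, h2]
  have hψnn : ∀ y, 0 ≤ ψ y := fun y =>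
    mul_nonneg (Real.smoothTransition.nonneg _) (Real.smoothTransition.nonneg _)
  have hψle : ∀ y, ψ y ≤ 1 := fun y =>
    mul_le_one₀ (Real.smoothTransition.le_one _) (Real.smoothTransition.nonneg _)
      (Real.smoothTransition.le_one _)
  -- Only `i` moves. Along the bigon it becomes `j` shifted to the right by `ε`; beyond the corners
  -- this is blended with the old arc `i`, itself to the right of `j`. The new arcs are disjoint in
  -- the slab, so transversality there is vacuous.
  let gi : ℝ → ℝ := fun y => (1 - ψ y) * D.arc i y + ψ y * (D.arc j y + ε)
  have hgij : ∀ y ∈ Icc c d, D.arc j y < gi y := by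
    intro y hy
    have e : gi y - D.arc j y = (1 - ψ y) * (D.arc i y - D.arc j y) + ψ y * ε := by
      simp only [gi]; ring
    rw [← sub_pos, e]
    by_cases hyab : y ∈ Icc a b
    · rw [hψ1 y hyab]; simpa using hε
    · have hpos : 0 < D.arc i y - D.arc j y := by
        rw [sub_pos]
        rcases lt_or_ge y a with h | h
        · exact hleft y ⟨hy.1, h⟩
        · exact hright y ⟨lt_of_not_ge fun h' => hyab ⟨h, h'⟩, hy.2⟩
      rcases (hψnn y).eq_or_lt with h | h
      · rw [← h]; simpa using hpos
      · have := mul_pos h hε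
        have := mul_nonneg (sub_nonneg.2 (hψle y)) hpos.le
        linarith
  have hconv : ∀ y, ∀ u, D.arc i y < u → D.arc j y + ε < u → gi y < u := by
    intro y u h1 h2
    have h3 := hψnn y
    have h4 := sub_nonneg.2 (hψle y)
    simp only [gi]
    rcases h3.eq_or_lt with h | h
    · rw [← h]; simpa using h1
    · nlinarith [mul_lt_mul_of_pos_left h2 h, mul_le_mul_of_nonneg_left h1.le h4]
  have hgisep : ∀ k, k ≠ i → k ≠ j → ∀ y ∈ Icc c d,
      (D.arc k y < D.arc i y ∧ D.arc k y < D.arc j y ∧ D.arc k y < gi y) ∨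
      (D.arc i y < D.arc k y ∧ D.arc j y < D.arc k y ∧ gi y < D.arc k y) := by
    intro k hki hkj y hy
    rcases hgap k hki hkj with h | h
    · have := h y hy
      exact Or.inl ⟨by linarith [this.1], by linarith [this.2], by linarith [this.2, hgij y hy]⟩
    · have := h y hy
      exact Or.inr ⟨by linarith [this.1], by linarith [this.2],
        hconv y _ (by linarith [this.1]) this.2⟩
  obtain ⟨fi, hfi, hfie⟩ := D.smooth i
  obtain ⟨fj, hfj, hfje⟩ := D.smooth j
  obtain ⟨D', h1, h2, h3⟩ := D.exists_replace hij h0c.le hd1.le (gi := gi) (gj := D.arc j)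
    ⟨fun y => (1 - ψ y) * fi y + ψ y * (fj y + ε),
      ((contDiff_const.sub hψ).mul hfi).add (hψ.mul (hfj.add contDiff_const)),
      fun y hy => by simp only [gi]; rw [hfie hy, hfje hy]⟩ (D.smooth j)
    (fun y _ hy => by simp [gi, hψ0 y hy]) (fun _ _ _ => rfl)
    (fun k hki hkj y hy => by
      rcases hgisep k hki hkj y hy with h | h
      · exact h.2.2.ne'
      · exact h.2.2.ne)
    (fun k hki hkj y hy => by
      rcases hgisep k hki hkj y hy with h | h
      · exact h.2.1.ne'
      · exact h.2.1.ne)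
    (fun y hy he => absurd he (hgij y hy).ne')
  refine ⟨D', i, j, a, b, c, d, hbig, h0c.le, hca, hbd, hd1.le, fun k hki hkj y _ => by
    rw [h3 k hki hkj], fun k y _ hy => ?_, fun y hy he => hmij y hy ⟨hij, hcd01 hy, he⟩,
    fun y hy => by rw [h1, h2]; exact (hgij y hy).ne', fun k hki hkj y hy => ?_⟩
  · by_cases hki : k = i
    · subst hki; rw [h1]; simp [gi, hψ0 y hy]
    by_cases hkj : k = j
    · subst hkj; rw [h2]
    rw [h3 k hki hkj]
  · rw [h1, h2]
    rcases hgisep k hki hkj y hy with h | h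
    · exact Or.inl ⟨h.1, h.2.1, h.2.2, h.2.1⟩
    · exact Or.inr ⟨h.1, h.2.1, h.2.2, h.2.1⟩

theorem exists_isReduction (D : Diagram n) : ∃ R, D.IsReduction R := by
  induction hm : D.doublePoints.ncard using Nat.strong_induction_on generalizing D with
  | _ m ih =>
    by_cases hD : D.BigonFree
    · exact ⟨D, Relation.ReflTransGen.refl, hD⟩
    · simp only [BigonFree, not_forall, not_not] at hD
      obtain ⟨i, j, a, b, h⟩ := hD
      obtain ⟨D', hD'⟩ := h.exists_minusTwo
      obtain ⟨R, hR, hR'⟩ := ih _ (hm ▸ hD'.ncard_doublePoints_lt) D' rfl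
      exact ⟨R, Relation.ReflTransGen.head hD' hR, hR'⟩

theorem Represents.of_reflTransGen {D R : Diagram n} {p : Configuration n} (h : D.Represents p)
    (hR : Relation.ReflTransGen MinusTwo D R) : R.Represents p := by
  induction hR with
  | refl => exact h
  | tail _ hs ih => exact Configuration.Equivalent.trans ih hs.equivalent

end Diagram

/-! ### Existence of representatives by polynomial approximation. -/

namespace Configuration

variable {n : ℕ}

open Polynomial in
-- A Weierstrass approximation is corrected by the linear interpolation of its errors at the two
-- ends, which is no larger than those errors.
theorem exists_polynomial_near_fixing_ends {f : ℝ → ℝ} (hf : ContinuousOn f (Icc 0 1)) {ε : ℝ}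
    (hε : 0 < ε) : ∃ q : ℝ[X], q.eval 0 = f 0 ∧ q.eval 1 = f 1 ∧
      ∀ y ∈ Icc (0 : ℝ) 1, |q.eval y - f y| < ε := by
  obtain ⟨P, hP⟩ := exists_polynomial_near_of_continuousOn 0 1 f hf (ε / 2) (half_pos hε)
  refine ⟨P + C (f 0 - P.eval 0) * (1 - X) + C (f 1 - P.eval 1) * X, by simp, by simp,
    fun y hy => ?_⟩
  simp only [eval_add, eval_mul, eval_C, eval_sub, eval_one, eval_X]
  have h0 := abs_lt.1 (hP 0 (by simp))
  have h1 := abs_lt.1 (hP 1 (by simp))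
  have hy' := abs_lt.1 (hP y hy)
  have e1 : 0 ≤ 1 - y := by linarith [hy.2]
  have e2 : 0 ≤ y := hy.1
  rw [abs_lt]
  constructor
  · nlinarith [mul_nonneg e1 (by linarith : 0 ≤ f 0 - P.eval 0 + ε / 2),
      mul_nonneg e2 (by linarith : 0 ≤ f 1 - P.eval 1 + ε / 2)]
  · nlinarith [mul_nonneg e1 (by linarith : 0 ≤ ε / 2 - (f 0 - P.eval 0)),
      mul_nonneg e2 (by linarith : 0 ≤ ε / 2 - (f 1 - P.eval 1))]

open Polynomial in
/-- The parameters `s` for which `P + s m X (1 - X)` has a multiple zero in `(0, 1)`. -/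
theorem finite_setOf_multiple_zero {P : ℝ[X]} (hP : P.eval 0 ≠ 0) {m : ℝ} (hm : m ≠ 0) :
    {s : ℝ | ∃ y ∈ Ioo (0 : ℝ) 1, (P + C (s * m) * (X * (1 - X))).eval y = 0 ∧
      (derivative (P + C (s * m) * (X * (1 - X)))).eval y = 0}.Finite := by
  -- Eliminating `s` from the two equations shows that a multiple zero is a root of this Wronskian,
  -- which does not vanish at `0`. The zero `y` in turn determines `s`.
  set W : ℝ[X] := derivative P * (X * (1 - X)) - P * derivative (X * (1 - X)) with hW
  have hW0 : W ≠ 0 := by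
    intro h
    have : W.eval 0 = 0 := by rw [h]; simp
    simp [hW] at this
    exact hP this
  refine (W.roots.toFinset.finite_toSet.image fun y => -P.eval y / (m * (y * (1 - y)))).subset ?_
  rintro s ⟨y, hy, h1, h2⟩
  have hy1 : 0 < 1 - y := sub_pos.2 hy.2
  have hy0 : 0 < y := hy.1
  simp only [derivative_add, derivative_mul, derivative_C, zero_mul, zero_add, derivative_X,
    one_mul, derivative_sub, derivative_one, zero_sub, eval_add, eval_mul, eval_C, eval_X, eval_sub,
    eval_one, eval_neg, mul_neg, mul_one] at h1 h2
  refine ⟨y, ?_, ?_⟩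
  · simp only [Multiset.mem_toFinset, Finset.mem_coe, mem_roots hW0, IsRoot.def]
    simp only [hW, derivative_mul, derivative_X,
      one_mul, derivative_sub, derivative_one, zero_sub, eval_add, eval_mul, eval_X, eval_sub,
      eval_one, eval_neg, mul_neg, mul_one]
    have e1 : P.eval y = -(s * m * (y * (1 - y))) := by linarith
    have e2 : P.derivative.eval y = -(s * m * (1 - y + -y)) := by linarith
    rw [e1, e2]
    ring
  · simp only
    rw [div_eq_iff (by positivity)]
    linarith

open Polynomial in
-- Adding `s i X (1 - X)` to the arc `i` keeps the ends and changes every difference of two arcs by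
-- a nonzero multiple of `s X (1 - X)`. Only finitely many `s` give some pair a multiple zero.
theorem exists_transverse_polynomials (p : Configuration n) {ε : ℝ} (hε : 0 < ε) :
    ∃ r : Fin n → ℝ[X], (∀ i, (r i).eval 0 = p.arc i 0) ∧ (∀ i, (r i).eval 1 = p.arc i 1) ∧
      (∀ i, ∀ y ∈ Icc (0 : ℝ) 1, |(r i).eval y - p.arc i y| < ε) ∧
      ∀ i j, i ≠ j → ∀ y ∈ Ioo (0 : ℝ) 1, (r i).eval y = (r j).eval y →
        (derivative (r i)).eval y ≠ (derivative (r j)).eval y := by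
  choose q hq0 hq1 hq using fun i =>
    exists_polynomial_near_fixing_ends (p.continuousOn i) (half_pos hε)
  have hfin : (⋃ i : Fin n, ⋃ j : Fin n, ⋃ _ : i ≠ j, {s : ℝ | ∃ y ∈ Ioo (0 : ℝ) 1,
      ((q i - q j) + C (s * ((i : ℝ) - j)) * (X * (1 - X))).eval y = 0 ∧
      (derivative ((q i - q j) + C (s * ((i : ℝ) - j)) * (X * (1 - X)))).eval y = 0}).Finite := by
    refine finite_iUnion fun i => finite_iUnion fun j => finite_iUnion fun hij => ?_
    have h1 : (i : ℝ) - j ≠ 0 := by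
      rw [sub_ne_zero]
      exact fun h => hij (Fin.ext (by exact_mod_cast h))
    refine finite_setOf_multiple_zero ?_ h1
    rw [eval_sub, hq0, hq0]
    exact sub_ne_zero.2 (p.arc_zero_ne hij)
  obtain ⟨s, hs, hsn⟩ := (Ioo_infinite (show (0 : ℝ) < ε / (2 * (n + 1)) by
    positivity)).exists_notMem_finite hfin
  refine ⟨fun i => q i + C (s * i) * (X * (1 - X)), fun i => by simp [hq0], fun i => by simp [hq1],
    fun i y hy => ?_, fun i j hij y hy he hd => hsn ?_⟩
  · have h1 := abs_lt.1 (hq i y hy)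
    simp only [eval_add, eval_mul, eval_C, eval_X, eval_sub, eval_one]
    have hy1 : 0 ≤ 1 - y := sub_nonneg.2 hy.2
    have hin : (i : ℝ) ≤ n + 1 := by
      have := i.2
      have : ((i : ℕ) : ℝ) < n := by exact_mod_cast this
      linarith
    have h2 : 0 ≤ s * i * (y * (1 - y)) :=
      mul_nonneg (mul_nonneg hs.1.le (by positivity)) (mul_nonneg hy.1 hy1)
    have h3 : s * i * (y * (1 - y)) ≤ ε / 2 := by
      have e1 : s * i ≤ ε / 2 := by
        calc s * i ≤ ε / (2 * (n + 1)) * (n + 1) := by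
              gcongr
              exact hs.2.le
          _ = ε / 2 := by field_simp
      have e2 : y * (1 - y) ≤ 1 := by nlinarith [hy.1, hy.2]
      have e3 : 0 ≤ y * (1 - y) := mul_nonneg hy.1 hy1
      nlinarith
    rw [abs_lt]
    constructor <;> linarith
  · simp only [mem_iUnion]
    refine ⟨i, j, hij, y, hy, ?_, ?_⟩
    · simp only [eval_add, eval_mul, eval_C, eval_X, eval_sub, eval_one] at he ⊢
      linarith
    · simp only [derivative_add, derivative_mul, derivative_C, zero_mul, zero_add, derivative_X,
        one_mul, derivative_sub, derivative_one, zero_sub, eval_add, eval_mul, eval_C, eval_X,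
        eval_sub, eval_one, eval_neg, mul_neg, mul_one] at hd ⊢
      linarith

end Configuration

open Configuration in
-- Let `ε` be smaller than the sum of the two successive distances among any three arcs at any
-- height. With approximation error below `ε / 4`, arcs that coincide during the straight-line
-- homotopy were less than `ε / 2` apart, so three can never coincide.
theorem Diagram.exists_represents {n : ℕ} (p : Configuration n) :
    ∃ D : Diagram n, D.Represents p := by
  have hev : ∀ᶠ ε in 𝓝[>] (0 : ℝ), ∀ i j k, i ≠ j → j ≠ k → i ≠ k → ∀ y ∈ Icc (0 : ℝ) 1,
      0 + ε < |p.arc i y - p.arc j y| + |p.arc j y - p.arc k y| := by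
    refine eventually_all.2 fun i => eventually_all.2 fun j => eventually_all.2 fun k => ?_
    by_cases h : i ≠ j ∧ j ≠ k ∧ i ≠ k
    · have hc := p.continuousOn
      have hpos : ∀ y ∈ Icc (0 : ℝ) 1,
          0 < |p.arc i y - p.arc j y| + |p.arc j y - p.arc k y| := fun y hy => by
        have := p.no_triple i j k h.1 h.2.1 h.2.2 y hy
        by_contra hle
        have h1 := abs_nonneg (p.arc i y - p.arc j y)
        have h2 := abs_nonneg (p.arc j y - p.arc k y)
        simp only [not_lt] at hle
        have h3 : |p.arc i y - p.arc j y| = 0 := by linarith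
        have h4 : |p.arc j y - p.arc k y| = 0 := by linarith
        exact this ⟨sub_eq_zero.1 (abs_eq_zero.1 h3), sub_eq_zero.1 (abs_eq_zero.1 h4)⟩
      filter_upwards [eventually_forall_add_lt (g := fun _ => 0) continuousOn_const
        (((hc i).sub (hc j)).abs.add ((hc j).sub (hc k)).abs) hpos] with ε hε _ _ _
      exact hε
    · exact Eventually.of_forall fun ε h1 h2 h3 => absurd ⟨h1, h2, h3⟩ h
  obtain ⟨ε, hε, hε0⟩ := (hev.and self_mem_nhdsWithin).exists
  replace hε0 : 0 < ε := hε0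
  obtain ⟨r, hr0, hr1, hrε, hrt⟩ := p.exists_transverse_polynomials (show 0 < ε / 4 by positivity)
  have hno : ∀ t ∈ Icc (0 : ℝ) 1, ∀ y ∈ Icc (0 : ℝ) 1, ∀ i j k, i ≠ j → j ≠ k → i ≠ k →
      ¬ ((1 - t) * p.arc i y + t * (r i).eval y = (1 - t) * p.arc j y + t * (r j).eval y ∧
        (1 - t) * p.arc j y + t * (r j).eval y = (1 - t) * p.arc k y + t * (r k).eval y) := by
    rintro t ht y hy i j k hij hjk hik ⟨h1, h2⟩
    have key : ∀ i j, (1 - t) * p.arc i y + t * (r i).eval y =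
        (1 - t) * p.arc j y + t * (r j).eval y → |p.arc i y - p.arc j y| < ε / 2 := by
      intro i j h
      have e : p.arc i y - p.arc j y =
          t * (((r j).eval y - p.arc j y) - ((r i).eval y - p.arc i y)) := by linarith
      have e1 : |((r j).eval y - p.arc j y) - ((r i).eval y - p.arc i y)| < ε / 2 := by
        refine (abs_sub _ _).trans_lt ?_
        linarith [hrε i y hy, hrε j y hy]
      rw [e, abs_mul, abs_of_nonneg ht.1]
      have := abs_nonneg (((r j).eval y - p.arc j y) - ((r i).eval y - p.arc i y))
      nlinarith [ht.2]
    linarith [hε i j k hij hjk hik y hy, key i j h1, key j k h2]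
  have hC : ∀ i, ContDiff ℝ ∞ fun y => (r i).eval y := fun i => by
    simpa using Polynomial.contDiff_aeval (𝕜 := ℝ) (r i) ∞
  have htop : ∃ π : Equiv.Perm (Fin n), ∀ i, (r i).eval 1 = (π i : ℝ) + 1 := by
    obtain ⟨π, hπ⟩ := p.top
    exact ⟨π, fun i => by rw [hr1, hπ]⟩
  let R : Configuration n := ⟨fun i y => (r i).eval y, fun i => (hC i).continuous.continuousOn,
    fun i => by rw [hr0, p.bottom], htop,
    fun i j k hij hjk hik y hy => by
      have := hno 1 (by simp) y hy i j k hij hjk hik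
      simpa using this⟩
  refine ⟨⟨R, fun i => ⟨_, hC i, fun y _ => rfl⟩, fun i j hij y hy he => ?_⟩,
    Equivalent.of_linear hr0 hr1 hno⟩
  have hy1 := R.mem_Ioo_of_arc_eq hij hy he
  change deriv (fun y => (r i).eval y) y ≠ deriv (fun y => (r j).eval y) y
  rw [Polynomial.deriv, Polynomial.deriv]
  exact hrt i j hij y hy1 he

/-! ### Sliding a double point along its arcs. -/

/-- A diffeomorphism of the line supported in `(c, d)` that carries `a` to `a'`. -/
theorem exists_line_diffeo {a a' c d : ℝ} (ha : a ∈ Ioo c d) (ha' : a' ∈ Ioo c d) :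
    ∃ η κ : ℝ → ℝ, ContDiff ℝ ∞ η ∧ ContDiff ℝ ∞ κ ∧ (∀ x, κ (η x) = x) ∧ (∀ x, η (κ x) = x) ∧
      (∀ x, ∃ e, 0 < e ∧ HasDerivAt η e x) ∧ η a = a' ∧
      (∀ x ∉ Ioo c d, η x = x) ∧ (∀ x ∉ Ioo c d, κ x = x) ∧ (∀ x ∈ Ioo c d, η x ∈ Ioo c d) ∧
      ∀ x ∈ Ioo c d, κ x ∈ Ioo c d := by
  have hid : ∀ U : Set ℝ, IsOpen U → IncreasingFamily U (fun z => 0 + 1 * z.1) := fun U hU =>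
    IncreasingFamily.affine (α := fun _ => 0) (β := fun _ => 1)
      hU contDiffOn_const contDiffOn_const fun _ _ => one_pos
  have htr : IncreasingFamily univ (fun z => (a' - a) + 1 * z.1) :=
    IncreasingFamily.affine (α := fun _ => a' - a) (β := fun _ => 1)
      isOpen_univ contDiffOn_const contDiffOn_const fun _ _ => one_pos
  -- The map is glued from the identity up to `c`, the translation by `a' - a` near `a`, and the
  -- identity from `d` on. The parameter of the families is a dummy, frozen at `0`.
  obtain ⟨V, φ, τ, hτ, -, h0V, hφ, hV⟩ := (hid univ isOpen_univ).glue htr (y₀ := 0) trivial ha.1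
    (by simpa using ha'.1)
  have hφa : φ (a, 0) = a' := by rw [(hV 0 h0V).2 a (by linarith)]; ring
  obtain ⟨W, ψ, σ, hσ, -, h0W, hψ, hW⟩ := hφ.glue (hid V hφ.isOpen) h0V ha.2
    (by rw [hφa]; simpa using ha'.2)
  let η : ℝ → ℝ := fun x => ψ (x, 0)
  have hηa : η a = a' := by simp only [η]; rw [(hW 0 h0W).1 a (by linarith), hφa]
  have hηc : ∀ x ≤ c, η x = x := fun x hx => by
    simp only [η]
    rw [(hW 0 h0W).1 x (by linarith [ha.1]), (hV 0 h0V).1 x (by linarith)]; ring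
  have hηd : ∀ x, d ≤ x → η x = x := fun x hx => by
    simp only [η]
    rw [(hW 0 h0W).2 x (by linarith)]; ring
  have hmono : StrictMono η := hψ.strictMono h0W
  have hηsm : ContDiff ℝ ∞ η := by
    rw [← contDiffOn_univ]
    exact hψ.contDiffOn.comp (contDiff_id.prodMk contDiff_const).contDiffOn
      fun x _ => ⟨trivial, h0W⟩
  obtain ⟨Φ, -, hΦ', hΦη⟩ := exists_fiber_diffeo (fun z => η z.1) (hηsm.comp contDiff_fst)
    (fun _ x => hψ.deriv_pos 0 h0W x) (fun _ => hψ.atTop 0 h0W) (fun _ => hψ.atBot 0 h0W)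
  let κ : ℝ → ℝ := fun x => (Φ.symm (x, 0)).1
  have hκη : ∀ x, κ (η x) = x := fun x => by
    have : Φ.symm (η x, 0) = (x, 0) := by rw [Equiv.symm_apply_eq, hΦη]
    simp only [κ, this]
  have hηκ : ∀ x, η (κ x) = x := fun x => by
    have h1 := Φ.apply_symm_apply (x, 0)
    rw [hΦη] at h1
    exact congrArg Prod.fst h1
  have hηoff : ∀ x ∉ Ioo c d, η x = x := fun x hx => by
    rcases le_or_gt x c with h | h
    · exact hηc x h
    · exact hηd x (not_lt.1 fun h' => hx ⟨h, h'⟩)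
  refine ⟨η, κ, hηsm, contDiff_fst.comp (hΦ'.comp (contDiff_id.prodMk contDiff_const)), hκη, hηκ,
    fun x => hψ.deriv_pos 0 h0W x, hηa, hηoff, fun x hx => ?_, fun x hx => ⟨?_, ?_⟩,
    fun x hx => ⟨?_, ?_⟩⟩
  · have := hκη x
    rwa [hηoff x hx] at this
  · rw [← hηc c le_rfl]; exact hmono hx.1
  · rw [← hηd d le_rfl]; exact hmono hx.2
  · rw [← hmono.lt_iff_lt, hηκ, hηc c le_rfl]; exact hx.1
  · rw [← hmono.lt_iff_lt, hηκ, hηd d le_rfl]; exact hx.2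

namespace Diagram

variable {n : ℕ}

/-- A double point can be slid along its two arcs as long as it does not run into another one. -/
theorem exists_slide {D : Diagram n} {i j : Fin n} {a a' c d : ℝ} (hc : 0 ≤ c) (hd : d ≤ 1)
    (ha : a ∈ Ioo c d) (ha' : a' ∈ Ioo c d) (hm : D.Meets i a j)
    (hij : ∀ y ∈ Icc c d, D.Meets i y j → y = a)
    (hoth : ∀ k, k ≠ i → k ≠ j → ∀ y ∈ Icc c d, ¬ D.Meets i y k ∧ ¬ D.Meets j y k) :
    ∃ D' : Diagram n, D.PlaneDiffeomorphic D' ∧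
      (∀ k, ∀ y ∈ Icc (0 : ℝ) 1, y ∉ Ioo c d → D'.arc k y = D.arc k y) ∧
      (∀ k, k ≠ i → k ≠ j → D'.arc k = D.arc k) ∧
      (∀ y ∈ Icc c d, D'.Meets i y j ↔ y = a') ∧
      ∀ k, k ≠ i → k ≠ j → ∀ y ∈ Icc c d, ¬ D'.Meets i y k ∧ ¬ D'.Meets j y k := by
  obtain ⟨η, κ, hη, hκ, hκη, hηκ, hηpos, hηa, hηoff, hκoff, hηin, hκin⟩ :=
    exists_line_diffeo ha ha'
  have hcd01 : Icc c d ⊆ Icc 0 1 := Icc_subset_Icc hc hd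
  obtain ⟨G, hG, hgap⟩ := Configuration.exists_gap hc hd (Ioo_subset_Icc_self ha) hm hoth
  obtain ⟨f, hf, hfe⟩ := D.smooth i
  obtain ⟨g, hg, hge⟩ := D.smooth j
  let m : ℝ → ℝ := fun y => (f y + g y) / 2
  let u : ℝ → ℝ := fun y => (f y - g y) / 2
  -- A smooth positive scale with `|u| < s ≤ |u| + G`. In the coordinate `(x - m) / s` the arcs `i`
  -- and `j` become `U` and `-U` with `|U| < 1`, while over `[c, d]` all other arcs stay at absolute
  -- value at least `1`.
  let s : ℝ → ℝ := fun y => Real.sqrt (u y ^ 2 + G ^ 2)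
  let U : ℝ → ℝ := fun y => u y / s y
  have hmsm : ContDiff ℝ ∞ m := (hf.add hg).div_const 2
  have husm : ContDiff ℝ ∞ u := (hf.sub hg).div_const 2
  have hspos0 : ∀ y, 0 < u y ^ 2 + G ^ 2 := fun y => by positivity
  have hs : ∀ y, 0 < s y := fun y => Real.sqrt_pos.2 (hspos0 y)
  have hssm : ContDiff ℝ ∞ s := ((husm.pow 2).add contDiff_const).sqrt fun y => (hspos0 y).ne'
  have hUsm : ContDiff ℝ ∞ U := husm.div hssm fun y => (hs y).ne'
  have husU : ∀ y, s y * U y = u y := fun y => by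
    have := (hs y).ne'
    simp only [U]; field_simp
  have hU1 : ∀ y, |U y| < 1 := fun y => by
    simp only [U]
    rw [abs_div, abs_of_pos (hs y), div_lt_one (hs y)]
    exact Real.lt_sqrt_of_sq_lt (by rw [sq_abs]; nlinarith)
  have hsle : ∀ y, s y ≤ |u y| + G := fun y => by
    refine Real.sqrt_le_iff.2 ⟨by positivity, ?_⟩
    have := sq_abs (u y)
    have := abs_nonneg (u y)
    nlinarith
  have hmi : ∀ y ∈ Icc (0 : ℝ) 1, D.arc i y = m y + u y := fun y hy => by
    rw [hfe hy]; simp only [m, u]; ring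
  have hmj : ∀ y ∈ Icc (0 : ℝ) 1, D.arc j y = m y - u y := fun y hy => by
    rw [hge hy]; simp only [m, u]; ring
  have hfar : ∀ k, k ≠ i → k ≠ j → ∀ y ∈ Icc c d, s y ≤ |D.arc k y - m y| := by
    intro k hki hkj y hy
    refine (hsle y).trans ?_
    have e1 := hmi y (hcd01 hy)
    have e2 := hmj y (hcd01 hy)
    rcases hgap k hki hkj with h | h
    · have h1 := h y hy
      rw [abs_sub_comm]
      refine le_trans ?_ (le_abs_self _)
      rcases abs_cases (u y) with h2 | h2 <;> linarith [h1.1, h1.2]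
    · have h1 := h y hy
      refine le_trans ?_ (le_abs_self _)
      rcases abs_cases (u y) with h2 | h2 <;> linarith [h1.1, h1.2]
  have hev := eventually_forall_add_lt (c := c) (d := d) (g := fun y => |U y|) (h := fun _ => 1)
    hUsm.continuous.abs.continuousOn continuousOn_const fun y _ => hU1 y
  obtain ⟨q', hq', hq'0⟩ := (hev.and self_mem_nhdsWithin).exists
  replace hq'0 : 0 < q' := hq'0
  have hq0 : 0 < 1 - q' := by
    have := hq' a (Ioo_subset_Icc_self ha)
    have := abs_nonneg (U a)
    linarith
  -- The cutoff is `1` on the values of `U` and `-U` over `[c, d]`, by the uniform margin `q'`, and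
  -- `0` on the other arcs.
  let χ : ContDiffBump (0 : ℝ) := ⟨1 - q', 1, hq0, by linarith⟩
  have hχ1 : ∀ y ∈ Icc c d, χ (U y) = 1 := fun y hy => χ.one_of_mem_closedBall (by
    rw [mem_closedBall_zero_iff, Real.norm_eq_abs]
    change |U y| ≤ 1 - q'
    linarith [hq' y hy])
  have hχ0 : ∀ x, 1 ≤ |x| → χ x = 0 := fun x hx => χ.zero_of_le_dist (by
    rw [dist_zero_right, Real.norm_eq_abs]; exact hx)
  have hχsm : ContDiff ℝ ∞ χ := χ.contDiff
  -- With the coordinates swapped, this moves the height `y` by a convex combination of `η` and the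
  -- identity, which is again increasing.
  obtain ⟨Ψ, hΨ, hΨ', hΨe⟩ := exists_fiber_diffeo (fun z => z.1 + (η z.1 - z.1) * χ z.2)
    (contDiff_fst.add (((hη.comp contDiff_fst).sub contDiff_fst).mul (hχsm.comp contDiff_snd)))
    (fun x y => by
      obtain ⟨e, he, hde⟩ := hηpos y
      refine ⟨1 + (e - 1) * χ x, ?_, ?_⟩
      · have h1 := χ.nonneg (x := x)
        have h2 := χ.le_one (x := x)
        rcases h1.eq_or_lt with h | h
        · rw [← h]; norm_num
        · nlinarith [mul_pos h he]
      · exact HasDerivAt.add (hasDerivAt_id y) ((hde.sub (hasDerivAt_id y)).mul_const (χ x)))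
    (fun x => tendsto_id.congr' (by
      filter_upwards [eventually_ge_atTop d] with y hy
      simp [hηoff y fun h => not_lt.2 hy h.2]))
    (fun x => tendsto_id.congr' (by
      filter_upwards [eventually_le_atBot c] with y hy
      simp [hηoff y fun h => not_lt.2 hy h.1]))
  let Θ : ℝ × ℝ ≃ ℝ × ℝ :=
    { toFun := fun z => ((z.1 - m z.2) / s z.2, z.2)
      invFun := fun z => (m z.2 + s z.2 * z.1, z.2)
      left_inv := fun z => by
        have := (hs z.2).ne'
        ext
        · simp only; field_simp; ring
        · rfl
      right_inv := fun z => by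
        have := (hs z.2).ne'
        ext
        · simp only; field_simp; ring
        · rfl }
  have hΘ : ContDiff ℝ ∞ Θ := ((contDiff_fst.sub (hmsm.comp contDiff_snd)).div
    (hssm.comp contDiff_snd) fun z => (hs z.2).ne').prodMk contDiff_snd
  have hΘ' : ContDiff ℝ ∞ Θ.symm := ((hmsm.comp contDiff_snd).add
    ((hssm.comp contDiff_snd).mul contDiff_fst)).prodMk contDiff_snd
  let sw : ℝ × ℝ ≃ ℝ × ℝ := Equiv.prodComm ℝ ℝ
  have hsw : ContDiff ℝ ∞ sw := contDiff_snd.prodMk contDiff_fst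
  have hsw' : ContDiff ℝ ∞ sw.symm := contDiff_snd.prodMk contDiff_fst
  let Φ : ℝ × ℝ ≃ ℝ × ℝ := Θ.trans (sw.trans (Ψ.trans (sw.symm.trans Θ.symm)))
  have hΦsm : ContDiff ℝ ∞ Φ := hΘ'.comp (hsw'.comp (hΨ.comp (hsw.comp hΘ)))
  have hΦsm' : ContDiff ℝ ∞ Φ.symm := hΘ'.comp (hsw'.comp (hΨ'.comp (hsw.comp hΘ)))
  have hΦe : ∀ x y y', y + (η y - y) * χ ((x - m y) / s y) = y' →
      Φ (x, y) = (m y' + s y' * ((x - m y) / s y), y') := by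
    rintro x y y' rfl
    change Θ.symm (sw.symm (Ψ (sw (Θ (x, y))))) = _
    have : sw (Θ (x, y)) = (y, (x - m y) / s y) := rfl
    rw [this, hΨe]
    rfl
  have hΦid : ∀ x y, (η y - y) * χ ((x - m y) / s y) = 0 → Φ (x, y) = (x, y) := fun x y h => by
    rw [hΦe x y y (by rw [h, add_zero])]
    have := (hs y).ne'
    ext
    · simp only; field_simp; ring
    · rfl
  -- The heights are reparametrized in the normalized coordinates only: `m` and `s` are taken at the
  -- new height, so the new arcs stay within distance `s y` of `m y`, away from all others.
  let gi : ℝ → ℝ := fun y => m y + s y * U (κ y)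
  let gj : ℝ → ℝ := fun y => m y - s y * U (κ y)
  have hsUsm : ContDiff ℝ ∞ (fun y => s y * U (κ y)) := hssm.mul (hUsm.comp hκ)
  have hgism : ContDiff ℝ ∞ gi := hmsm.add hsUsm
  have hgjsm : ContDiff ℝ ∞ gj := hmsm.sub hsUsm
  have hclose : ∀ y, |s y * U (κ y)| < s y := fun y => by
    rw [abs_mul, abs_of_pos (hs y)]
    have := hU1 (κ y)
    have := hs y
    nlinarith
  have hκI : ∀ y ∈ Icc c d, κ y ∈ Icc c d := fun y hy => by
    by_cases h : y ∈ Ioo c d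
    · exact Ioo_subset_Icc_self (hκin y h)
    · rwa [hκoff y h]
  have hgieq : ∀ y ∈ Icc c d, gi y = gj y ↔ y = a' := fun y hy => by
    have h1 : gi y = gj y ↔ U (κ y) = 0 := by
      have := (hs y).ne'
      simp only [gi, gj]
      constructor
      · intro h
        have : s y * U (κ y) = 0 := by linarith
        exact (mul_eq_zero.1 this).resolve_left (hs y).ne'
      · intro h; rw [h]; ring
    have h2 : U (κ y) = 0 ↔ u (κ y) = 0 := by
      rw [← husU]
      simp [(hs (κ y)).ne']
    have h3 := hmi _ (hcd01 (hκI y hy))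
    have h4 := hmj _ (hcd01 (hκI y hy))
    rw [h1, h2]
    constructor
    · intro h
      have : κ y = a := hij _ (hκI y hy) ⟨hm.1, hcd01 (hκI y hy), by rw [h3, h4, h]; ring⟩
      rw [← hηκ y, this, hηa]
    · rintro rfl
      rw [← hηa, hκη]
      rw [← hηa, hκη, hm.2.2] at h3
      rw [← hηa, hκη] at h4
      linarith
  have hη01 : ∀ y ∈ Icc (0 : ℝ) 1, η y ∈ Icc (0 : ℝ) 1 := fun y hy => by
    by_cases h : y ∈ Ioo c d
    · exact hcd01 (Ioo_subset_Icc_self (hηin y h))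
    · rwa [hηoff y h]
  have hκ01 : ∀ y ∈ Icc (0 : ℝ) 1, κ y ∈ Icc (0 : ℝ) 1 := fun y hy => by
    by_cases h : y ∈ Ioo c d
    · exact hcd01 (Ioo_subset_Icc_self (hκin y h))
    · rwa [hκoff y h]
  have hkne : ∀ k, k ≠ i → k ≠ j → ∀ y ∈ Icc c d, ∀ t, |t| < s y → m y + t ≠ D.arc k y := by
    intro k hki hkj y hy t ht he
    have := hfar k hki hkj y hy
    rw [← he, add_sub_cancel_left] at this
    linarith
  have hgik : ∀ k, k ≠ i → k ≠ j → ∀ y ∈ Icc c d, gi y ≠ D.arc k y := fun k hki hkj y hy =>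
    hkne k hki hkj y hy _ (hclose y)
  have hgjk : ∀ k, k ≠ i → k ≠ j → ∀ y ∈ Icc c d, gj y ≠ D.arc k y := fun k hki hkj y hy => by
    have := hkne k hki hkj y hy (-(s y * U (κ y))) (by rw [abs_neg]; exact hclose y)
    rwa [← sub_eq_add_neg] at this
  -- At the new double point `U (κ y) = U a = 0`, so the slopes differ by `2 s U'(a) κ'`. Here `κ'`
  -- is nonzero because `κ` has a smooth inverse, and `U'(a) = 0` would give `u'(a) = 0`, against
  -- transversality.
  have htr : ∀ y ∈ Icc c d, gi y = gj y → deriv gi y ≠ deriv gj y := by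
    intro y hy he hder
    have hya := (hgieq y hy).1 he
    have hκa : κ y = a := by rw [hya, ← hηa, hκη]
    have hua : u a = 0 := by
      have h1 := hmi a hm.2.1
      have h2 := hmj a hm.2.1
      rw [hm.2.2] at h1
      linarith
    have hUa : U a = 0 := by simp only [U]; rw [hua, zero_div]
    have dd : ∀ {h : ℝ → ℝ}, ContDiff ℝ ∞ h → ∀ y, HasDerivAt h (deriv h y) y := fun hh y =>
      (hh.differentiable (by simp) y).hasDerivAt
    have hsU := (dd hssm y).mul (((hκa ▸ dd hUsm a : HasDerivAt U (deriv U a) (κ y))).comp y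
      (dd hκ y))
    have hsU' : HasDerivAt (fun y => s y * U (κ y)) (s y * (deriv U a * deriv κ y)) y := by
      have e : deriv s y * (U ∘ κ) y + s y * (deriv U a * deriv κ y) =
          s y * (deriv U a * deriv κ y) := by
        rw [Function.comp_apply, hκa, hUa]; ring
      rw [← e]
      exact hsU
    have e1 : deriv gi y = deriv m y + s y * (deriv U a * deriv κ y) :=
      ((dd hmsm y).add hsU').deriv
    have e2 : deriv gj y = deriv m y - s y * (deriv U a * deriv κ y) :=
      ((dd hmsm y).sub hsU').deriv
    have e3 : s y * (deriv U a * deriv κ y) = 0 := by linarith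
    have e4 : deriv κ y ≠ 0 := by
      intro h0
      have h1 : HasDerivAt (η ∘ κ) (deriv η (κ y) * deriv κ y) y := (dd hη _).comp y (dd hκ y)
      have h2 : η ∘ κ = id := funext hηκ
      rw [h2] at h1
      have := h1.unique (hasDerivAt_id y)
      rw [h0, mul_zero] at this
      exact zero_ne_one this
    have e5 : deriv U a = 0 := by
      rcases mul_eq_zero.1 e3 with h | h
      · exact absurd h (hs y).ne'
      · exact (mul_eq_zero.1 h).resolve_right e4
    have e6 : deriv u a = 0 := by
      have h1 := (dd hssm a).mul (dd hUsm a)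
      have h2 : s * U = u := funext husU
      rw [h2] at h1
      rw [h1.deriv, hUa, e5]; ring
    have e7 : deriv u a = (deriv f a - deriv g a) / 2 :=
      (((dd hf a).sub (dd hg a)).div_const 2).deriv
    have h3 := D.transverse i j hm.1 a hm.2.1 hm.2.2
    rw [deriv_eq_of_eqOn hfe hm.mem_Ioo, deriv_eq_of_eqOn hge hm.mem_Ioo] at h3
    exact h3 (by linarith)
  have hgioff : ∀ y ∈ Icc (0 : ℝ) 1, y ∉ Ioo c d → gi y = D.arc i y := fun y hy hy' => by
    simp only [gi]; rw [hκoff y hy', husU, hmi y hy]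
  have hgjoff : ∀ y ∈ Icc (0 : ℝ) 1, y ∉ Ioo c d → gj y = D.arc j y := fun y hy hy' => by
    simp only [gj]; rw [hκoff y hy', husU, hmj y hy]
  obtain ⟨D', h1, h2, h3⟩ := D.exists_replace hm.1 hc hd ⟨gi, hgism, fun _ _ => rfl⟩
    ⟨gj, hgjsm, fun _ _ => rfl⟩ hgioff hgjoff hgik hgjk htr
  have hΦi : ∀ y ∈ Icc (0 : ℝ) 1, Φ (D.arc i y, y) = (gi (η y), η y) := fun y hy => by
    have e : (D.arc i y - m y) / s y = U y := by rw [hmi y hy]; simp [U]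
    rw [hΦe _ y (η y), e]
    · simp only [gi, hκη]
    · rw [e]
      by_cases h : y ∈ Ioo c d
      · rw [hχ1 y (Ioo_subset_Icc_self h)]; ring
      · rw [hηoff y h]; ring
  have hΦj : ∀ y ∈ Icc (0 : ℝ) 1, Φ (D.arc j y, y) = (gj (η y), η y) := fun y hy => by
    have e : (D.arc j y - m y) / s y = -U y := by rw [hmj y hy]; simp [U, neg_div]
    rw [hΦe _ y (η y), e]
    · simp only [gj, hκη]; ext <;> ring
    · rw [e, χ.neg]
      by_cases h : y ∈ Ioo c d
      · rw [hχ1 y (Ioo_subset_Icc_self h)]; ring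
      · rw [hηoff y h]; ring
  have hΦk : ∀ k, k ≠ i → k ≠ j → ∀ y ∈ Icc (0 : ℝ) 1, Φ (D.arc k y, y) = (D.arc k y, y) :=
    fun k hki hkj y hy => hΦid _ _ (by
      by_cases h : y ∈ Ioo c d
      · rw [hχ0, mul_zero]
        rw [abs_div, abs_of_pos (hs y), one_le_div (hs y)]
        exact hfar k hki hkj y (Ioo_subset_Icc_self h)
      · rw [hηoff y h]; ring)
  have himg : ∀ k (h h' : ℝ → ℝ), (∀ y ∈ Icc (0 : ℝ) 1, h y ∈ Icc (0 : ℝ) 1) →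
      (∀ y ∈ Icc (0 : ℝ) 1, h' y ∈ Icc (0 : ℝ) 1) → (∀ y, h (h' y) = y) →
      (∀ y ∈ Icc (0 : ℝ) 1, Φ (D.arc k y, y) = (D'.arc k (h y), h y)) →
      Φ '' D.arcSet k = D'.arcSet k := by
    intro k h h' hh hh' hi he
    ext ⟨x, y⟩
    simp only [Configuration.arcSet, mem_image, mem_ofPred_eq, Prod.exists]
    constructor
    · rintro ⟨x', y', ⟨hy', rfl⟩, h⟩
      rw [he y' hy'] at h
      cases h
      exact ⟨hh y' hy', rfl⟩
    · rintro ⟨hy, rfl⟩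
      refine ⟨_, h' y, ⟨hh' y hy, rfl⟩, ?_⟩
      rw [he _ (hh' y hy), hi]
  refine ⟨D', ⟨Φ, hΦsm, hΦsm', fun p => ⟨?_, ?_⟩, fun k => ?_⟩, fun k y hy hy' => ?_, h3,
    fun y hy => ?_, fun k hki hkj y hy => ⟨fun h => ?_, fun h => ?_⟩⟩
  · exact hΦid _ _ (by rw [hηoff 0 fun h => not_lt.2 hc h.1]; ring)
  · exact hΦid _ _ (by rw [hηoff 1 fun h => not_lt.2 hd h.2]; ring)
  · by_cases hki : k = i
    · subst hki
      exact himg k η κ hη01 hκ01 hηκ (by rw [h1]; exact hΦi)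
    by_cases hkj : k = j
    · subst hkj
      exact himg k η κ hη01 hκ01 hηκ (by rw [h2]; exact hΦj)
    exact himg k id id (fun y hy => hy) (fun y hy => hy) (fun _ => rfl)
      (by rw [h3 k hki hkj]; exact hΦk k hki hkj)
  · by_cases hki : k = i
    · subst hki; rw [h1]; exact hgioff y hy hy'
    by_cases hkj : k = j
    · subst hkj; rw [h2]; exact hgjoff y hy hy'
    rw [h3 k hki hkj]
  · rw [← hgieq y hy, ← h1, ← h2]
    exact ⟨fun h => h.2.2, fun h => ⟨hm.1, hcd01 hy, h⟩⟩
  · have := h.2.2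
    rw [h1, h3 k hki hkj] at this
    exact hgik k hki hkj y hy this
  · have := h.2.2
    rw [h2, h3 k hki hkj] at this
    exact hgjk k hki hkj y hy this

end Diagram

/-! ### Lists of partners determine a diagram. -/

/-- `Reads E c L`: the events of `E` before the time `c` are, latest first, those of the list. -/
inductive Reads {α : Type*} (E : ℝ → α → Prop) : ℝ → List α → Prop
  | nil {c : ℝ} (h : ∀ y < c, ∀ k, ¬ E y k) : Reads E c []
  | cons {a c : ℝ} {j : α} {L : List α} (hac : a < c) (ha : E a j)
      (h : ∀ y, a < y → y < c → ∀ k, ¬ E y k) (hL : Reads E a L) : Reads E c (j :: L)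

theorem Reads.congr {α : Type*} {E E' : ℝ → α → Prop} {c c' : ℝ} {L : List α} (h : Reads E c L)
    (hE : ∀ y k, (y < c ∧ E y k) ↔ (y < c' ∧ E' y k)) : Reads E' c' L := by
  induction h generalizing c' with
  | nil h => exact Reads.nil fun y hy k hk => h y ((hE y k).2 ⟨hy, hk⟩).1 k ((hE y k).2 ⟨hy, hk⟩).2
  | @cons a c j L hac ha h hL ih =>
    obtain ⟨h1, h2⟩ := (hE a j).1 ⟨hac, ha⟩
    refine Reads.cons h1 h2 (fun y hay hyc k hk => ?_) (ih fun y k => ?_)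
    · have := (hE y k).2 ⟨hyc, hk⟩
      exact h y hay this.1 k this.2
    · constructor
      · rintro ⟨h3, h4⟩
        exact ⟨h3, ((hE y k).1 ⟨h3.trans hac, h4⟩).2⟩
      · rintro ⟨h3, h4⟩
        exact ⟨h3, ((hE y k).2 ⟨h3.trans h1, h4⟩).2⟩

/-- If `i` and `j` are each other's latest partners, then at the same double point. -/
theorem Configuration.exists_common_latest {n : ℕ} {C : Configuration n} {i j : Fin n} {c : ℝ}
    {Li Lj : List (Fin n)} (hi : Reads (C.Meets i) c (j :: Li)) (hj : Reads (C.Meets j) c (i :: Lj)) :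
    ∃ a < c, C.Meets i a j ∧ (∀ y, a < y → y < c → ∀ k, ¬ C.Meets i y k ∧ ¬ C.Meets j y k) ∧
      Reads (C.Meets i) a Li ∧ Reads (C.Meets j) a Lj := by
  obtain _ | ⟨hac, ha, h, hL⟩ := hi
  obtain _ | ⟨hac', ha', h', hL'⟩ := hj
  rename_i a a'
  have : a = a' := by
    rcases lt_trichotomy a a' with hlt | heq | hlt
    · exact absurd ha'.symm (h _ hlt hac' _)
    · exact heq
    · exact absurd ha.symm (h' _ hlt hac _)
  subst this
  exact ⟨a, hac, ha, fun y h1 h2 k => ⟨h y h1 h2 k, h' y h1 h2 k⟩, hL, hL'⟩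

namespace Diagram

variable {n : ℕ}

theorem lt_iff_of_not_meets {D : Diagram n} {i j : Fin n} {c d : ℝ} (hc : 0 ≤ c) (hd : d ≤ 1)
    (h : ∀ y ∈ Icc c d, ¬ D.Meets i y j) {y : ℝ} (hy : y ∈ Icc c d) :
    D.arc i y < D.arc j y ↔ D.arc i d < D.arc j d := by
  by_cases hij : i = j
  · simp [hij]
  have hs : Icc c d ⊆ Icc 0 1 := Icc_subset_Icc hc hd
  have hdI : d ∈ Icc c d := ⟨hy.1.trans hy.2, le_rfl⟩
  exact ⟨Configuration.arc_lt_of_not_meets isPreconnected_Icc hs hij h hy hdI,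
    Configuration.arc_lt_of_not_meets isPreconnected_Icc hs hij h hdI hy⟩

/-- Because the single crossing is transverse, the order at the top of the slab and the height of
the crossing determine the order throughout; this is how the orders in two diagrams are compared. -/
theorem lt_iff_of_single_meets {D : Diagram n} {i j : Fin n} {a c d : ℝ} (hij : i ≠ j) (hc : 0 ≤ c)
    (hd : d ≤ 1) (ha : a ∈ Ioo c d) (h : ∀ y ∈ Icc c d, D.Meets i y j ↔ y = a) {y : ℝ}
    (hy : y ∈ Icc c d) : D.arc i y < D.arc j y ↔
      (y < a ∧ D.arc j d < D.arc i d) ∨ (a < y ∧ D.arc i d < D.arc j d) := by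
  have hs : Icc c d ⊆ Icc 0 1 := Icc_subset_Icc hc hd
  have ham := (h a (Ioo_subset_Icc_self ha)).2 rfl
  rcases lt_trichotomy y a with hya | rfl | hya
  · have hsub : ∀ z ∈ Icc y d, z ∈ Icc c d := fun z hz => ⟨hy.1.trans hz.1, hz.2⟩
    have e1 := arc_lt_flip ham (hs hy).1 hya ha.2 hd fun z hz hm => (h z (hsub z hz)).1 hm
    have e2 := arc_lt_flip ham.symm (hs hy).1 hya ha.2 hd
      fun z hz hm => (h z (hsub z hz)).1 hm.symm
    have hne : D.arc i y ≠ D.arc j y := fun he => hya.ne ((h y hy).1 ⟨hij, hs hy, he⟩)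
    constructor
    · exact fun hlt => Or.inl ⟨hya, e1 hlt⟩
    · rintro (⟨-, hlt⟩ | ⟨hlt, -⟩)
      · rcases hne.lt_or_gt with h' | h'
        · exact h'
        · exact absurd hlt (lt_asymm (e2 h'))
      · exact absurd hlt (lt_asymm hya)
  · simp [ham.2.2]
  · rw [lt_iff_of_not_meets (c := y) (d := d) (hs hy).1 hd (fun z hz hm => ?_) ⟨le_rfl, hy.2⟩]
    · simp [hya, hya.not_gt]
    · exact (hya.trans_le hz.1).ne' ((h z ⟨hy.1.trans hz.1, hz.2⟩).1 hm)

/-- The latest double point of `i` and `j` before `c` can be pulled up to a height `c₁` close to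
`c`. -/
theorem exists_pull {D : Diagram n} {i j : Fin n} {a c c₁ : ℝ} (hc : c ≤ 1) (hm : D.Meets i a j)
    (hac : a < c₁) (hcc : c₁ < c)
    (h : ∀ y, a < y → y ≤ c → ∀ k, ¬ D.Meets i y k ∧ ¬ D.Meets j y k) :
    ∃ D' : Diagram n, D.PlaneDiffeomorphic D' ∧
      (∀ k, ∀ y ∈ Icc c 1, D'.arc k y = D.arc k y) ∧
      (∀ k, k ≠ i → k ≠ j → ∀ y l, D'.Meets k y l ↔ D.Meets k y l) ∧
      (∀ y ≤ c, ∀ l, D'.Meets i y l ↔ (y < a ∧ D.Meets i y l) ∨ (y = c₁ ∧ l = j)) ∧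
      (∀ y ≤ c, ∀ l, D'.Meets j y l ↔ (y < a ∧ D.Meets j y l) ∨ (y = c₁ ∧ l = i)) := by
  -- No double point lies at a height in `[b, a)`, so between `b` and `c` the only event on `i` or
  -- `j` is the one to be moved.
  obtain ⟨b, h0b, hba, hb⟩ := D.finite_heights.exists_lt_left hm.mem_Ioo.1
  have hnone : ∀ y ∈ Icc b c, y ≠ a → ∀ k, ¬ D.Meets i y k ∧ ¬ D.Meets j y k := by
    intro y hy hya k
    rcases lt_or_gt_of_ne hya with hlt | hlt
    · exact ⟨fun hm => not_le.2 hlt (hb y ⟨i, k, hm⟩ hy.1),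
        fun hm => not_le.2 hlt (hb y ⟨j, k, hm⟩ hy.1)⟩
    · exact h y hlt hy.2 k
  have hoth : ∀ k, k ≠ i → k ≠ j → ∀ y ∈ Icc b c, ¬ D.Meets i y k ∧ ¬ D.Meets j y k := by
    intro k hki hkj y hy
    by_cases hya : y = a
    · subst hya
      exact ⟨fun h => hkj (h.unique hm), fun h => hki (h.unique hm.symm)⟩
    · exact hnone y hy hya k
  obtain ⟨D', hD', hoff, hk, hij, hoth'⟩ := exists_slide (a' := c₁) h0b.le hc
    ⟨hba, hac.trans hcc⟩ ⟨hba.trans hac, hcc⟩ hm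
    (fun y hy hm => by by_contra hya; exact (hnone y hy hya j).1 hm) hoth
  have hM : ∀ k l y, y ∉ Ioo b c → (D'.Meets k y l ↔ D.Meets k y l) := by
    intro k l y hy
    simp only [Configuration.Meets]
    constructor
    · rintro ⟨h1, h2, h3⟩
      exact ⟨h1, h2, by rwa [hoff k y h2 hy, hoff l y h2 hy] at h3⟩
    · rintro ⟨h1, h2, h3⟩
      exact ⟨h1, h2, by rwa [hoff k y h2 hy, hoff l y h2 hy]⟩
  refine ⟨D', hD', fun k y hy => hoff k y ⟨h0b.le.trans ((hba.trans (hac.trans hcc)).le.trans hy.1),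
    hy.2⟩ fun h => not_lt.2 hy.1 h.2, fun k hki hkj y l => ?_, fun y hy l => ?_, fun y hy l => ?_⟩
  · by_cases hy : y ∈ Ioo b c
    · have hy' := Ioo_subset_Icc_self hy
      by_cases hli : l = i
      · subst hli
        exact ⟨fun h => absurd h.symm (hoth' k hki hkj y hy').1,
          fun h => absurd h.symm (hoth k hki hkj y hy').1⟩
      by_cases hlj : l = j
      · subst hlj
        exact ⟨fun h => absurd h.symm (hoth' k hki hkj y hy').2,
          fun h => absurd h.symm (hoth k hki hkj y hy').2⟩
      simp only [Configuration.Meets, hk k hki hkj, hk l hli hlj]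
    · exact hM k l y hy
  · by_cases hyI : y ∈ Ioo b c
    · have hy' := Ioo_subset_Icc_self hyI
      have hno : ¬ (y < a ∧ D.Meets i y l) := fun h => (hnone y hy' h.1.ne l).1 h.2
      by_cases hlj : l = j
      · subst hlj; rw [hij y hy']; simp [hno]
      · refine ⟨fun hm' => ?_, fun h => ?_⟩
        · by_cases hli : l = i
          · exact absurd hli.symm hm'.1
          · exact absurd hm' (hoth' l hli hlj y hy').1
        · simp [hno, hlj] at h
    · rw [hM i l y hyI]
      constructor
      · intro h1
        refine Or.inl ⟨?_, h1⟩
        by_contra hya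
        rcases (not_lt.1 hya).eq_or_lt with rfl | h2
        · exact hyI ⟨hba, hac.trans hcc⟩
        · exact (h y h2 hy l).1 h1
      · rintro (h1 | ⟨rfl, -⟩)
        · exact h1.2
        · exact absurd ⟨hba.trans hac, hcc⟩ hyI
  · by_cases hyI : y ∈ Ioo b c
    · have hy' := Ioo_subset_Icc_self hyI
      have hno : ¬ (y < a ∧ D.Meets j y l) := fun h => (hnone y hy' h.1.ne l).2 h.2
      by_cases hli : l = i
      · subst hli
        rw [show D'.Meets j y l ↔ D'.Meets l y j from ⟨fun h => h.symm, fun h => h.symm⟩, hij y hy']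
        simp [hno]
      · refine ⟨fun hm' => ?_, fun h => ?_⟩
        · by_cases hlj : l = j
          · exact absurd hlj.symm hm'.1
          · exact absurd hm' (hoth' l hli hlj y hy').2
        · simp [hno, hli] at h
    · rw [hM j l y hyI]
      constructor
      · intro h1
        refine Or.inl ⟨?_, h1⟩
        by_contra hya
        rcases (not_lt.1 hya).eq_or_lt with rfl | h2
        · exact hyI ⟨hba, hac.trans hcc⟩
        · exact (h y h2 hy l).2 h1
      · rintro (h1 | ⟨rfl, -⟩)
        · exact h1.2
        · exact absurd ⟨hba.trans hac, hcc⟩ hyI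

/-- Induction on the number of list entries. A topmost double point below `c` joins two arcs that
head each other's lists; pulled up close to `c` in both diagrams, it drops off the lists, and `c` is
lowered past it. With empty lists nothing crosses below `c`, and the arcs have the same order at
every height. -/
theorem planeDiffeomorphic_of_reads_below {D D' : Diagram n} {c : ℝ} (hc0 : 0 < c) (hc1 : c ≤ 1)
    {L : Fin n → List (Fin n)}
    (htop : ∀ i, D.arc i 1 = D'.arc i 1)
    (hlt : ∀ i j, ∀ y ∈ Icc c 1, D.arc i y < D.arc j y ↔ D'.arc i y < D'.arc j y)
    (hc : ∀ i j, ¬ D.Meets i c j) (hc' : ∀ i j, ¬ D'.Meets i c j)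
    (hL : ∀ i, Reads (D.Meets i) c (L i)) (hL' : ∀ i, Reads (D'.Meets i) c (L i)) :
    D.PlaneDiffeomorphic D' := by
  induction hN : ∑ i, (L i).length using Nat.strong_induction_on generalizing D D' c L with
  | _ N ih =>
    by_cases hnil : ∀ i, L i = []
    · have key : ∀ {D : Diagram n}, (∀ i j, ¬ D.Meets i c j) → (∀ i, Reads (D.Meets i) c (L i)) →
          ∀ i j, ∀ y ∈ Icc 0 c, ¬ D.Meets i y j := by
        intro D hc hL i j y hy hm
        rcases hy.2.eq_or_lt with h | h
        · exact hc i j (h ▸ hm)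
        · have h1 := hL i
          rw [hnil i] at h1
          obtain ⟨h2⟩ | _ := h1
          exact h2 y h j hm
      refine planeDiffeomorphic_of_same_order D D' (fun i j y hy => ?_) htop
      rcases le_or_gt c y with h | h
      · exact hlt i j y ⟨h, hy.2⟩
      · have hy' : y ∈ Icc 0 c := ⟨hy.1, h.le⟩
        rw [lt_iff_of_not_meets le_rfl hc1 (key hc hL i j) hy',
          lt_iff_of_not_meets le_rfl hc1 (key hc' hL' i j) hy']
        exact hlt i j c ⟨le_rfl, hc1⟩
    push Not at hnil
    obtain ⟨i₀, hi₀⟩ := hnil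
    have hne : (D.heights ∩ Iio c).Nonempty := by
      have h1 := hL i₀
      obtain ⟨j, l, hjl⟩ := List.exists_cons_of_ne_nil hi₀
      rw [hjl] at h1
      obtain _ | ⟨h2, h3, -, -⟩ := h1
      exact ⟨_, ⟨i₀, j, h3⟩, h2⟩
    obtain ⟨a, ⟨⟨i, j, hm⟩, hac⟩, hmax⟩ := exists_max_image (D.heights ∩ Iio c) id
      (D.finite_heights.subset inter_subset_left) hne
    replace hac : a < c := hac
    have hhead : ∀ {i j : Fin n}, D.Meets i a j → ∃ l, L i = j :: l := by
      intro i j hm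
      have h1 := hL i
      generalize L i = M at h1
      obtain ⟨h2⟩ | ⟨h2, h3, h4, -⟩ := h1
      · exact absurd hm (h2 a hac j)
      · rename_i b k l
        have : a = b := by
          refine le_antisymm (not_lt.1 fun hba => h4 a hba hac j hm) ?_
          exact hmax b ⟨⟨_, _, h3⟩, h2⟩
        subst this
        exact ⟨l, by rw [h3.unique hm]⟩
    obtain ⟨Li, hLi⟩ := hhead hm
    obtain ⟨Lj, hLj⟩ := hhead hm.symm
    have hij : i ≠ j := hm.1
    -- Neither diagram has a double point at a height in `[e, c)`. The heights `e < c₂ < c₁ < c`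
    -- leave room to put the pulled crossing at `c₁` and the new boundary at `c₂`.
    obtain ⟨e, h0e, hec, he⟩ :=
      (D.finite_heights.union D'.finite_heights).exists_lt_left hc0
    obtain ⟨c₂, hec₂, hc₂⟩ := exists_between hec
    obtain ⟨c₁, hc₂₁, hc₁⟩ := exists_between hc₂
    have hlow : ∀ {y}, y ∈ D.heights ∪ D'.heights → y < c → y < e := fun hy hyc =>
      lt_of_not_ge fun h => not_le.2 hyc (he _ hy h)
    have h0c₂ : 0 ≤ c₂ := (h0e.trans hec₂).le
    -- Only the mutual heads of the lists are used here, not maximality of the double point: in the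
    -- second diagram the crossing of `i` and `j` need not be topmost, yet both arcs are free above
    -- it.
    have step : ∀ {D : Diagram n}, (∀ i j, ¬ D.Meets i c j) → (∀ i, Reads (D.Meets i) c (L i)) →
        (∀ {y}, y ∈ D.heights → y < c → y < e) →
        ∃ D₁ : Diagram n, D.PlaneDiffeomorphic D₁ ∧
          (∀ k, ∀ y ∈ Icc c 1, D₁.arc k y = D.arc k y) ∧
          (∀ k l, ¬ D₁.Meets k c₂ l) ∧
          (∀ k, Reads (D₁.Meets k) c₂ (if k = i then Li else if k = j then Lj else L k)) ∧
          (∀ y ∈ Icc c₂ c, D₁.Meets i y j ↔ y = c₁) ∧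
          (∀ p q, ¬ (p = i ∧ q = j) → ¬ (p = j ∧ q = i) → ∀ y ∈ Icc c₂ c, ¬ D₁.Meets p y q) := by
      intro D hc hL hlow
      have h1 := hL i
      have h2 := hL j
      rw [hLi] at h1
      rw [hLj] at h2
      obtain ⟨a, hac, hm, hlast, hRi, hRj⟩ := Configuration.exists_common_latest h1 h2
      have hae : a < e := hlow ⟨i, j, hm⟩ hac
      obtain ⟨D₁, hD₁, htop₁, hk₁, hi₁, hj₁⟩ := exists_pull (c₁ := c₁) hc1 hm
        ((hae.trans hec₂).trans hc₂₁) hc₁ (fun y hy hyc k => by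
          rcases hyc.eq_or_lt with rfl | hyc
          · exact ⟨hc i k, hc j k⟩
          · exact hlast y hy hyc k)
      have hoth : ∀ p q, ¬ (p = i ∧ q = j) → ¬ (p = j ∧ q = i) → ∀ y ∈ Icc c₂ c,
          ¬ D₁.Meets p y q := by
        intro p q h1 h2 y hy hmy
        by_cases hpi : p = i
        · subst hpi
          rcases (hi₁ y hy.2 q).1 hmy with h | h
          · linarith [h.1, hy.1]
          · exact h1 ⟨rfl, h.2⟩
        by_cases hpj : p = j
        · subst hpj
          rcases (hj₁ y hy.2 q).1 hmy with h | h
          · linarith [h.1, hy.1]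
          · exact h2 ⟨rfl, h.2⟩
        · have := (hk₁ p hpi hpj y q).1 hmy
          rcases hy.2.eq_or_lt with rfl | hyc
          · exact hc p q this
          · linarith [hlow ⟨p, q, this⟩ hyc, hy.1]
      have hij₁ : ∀ y ∈ Icc c₂ c, D₁.Meets i y j ↔ y = c₁ := by
        intro y hy
        rw [hi₁ y hy.2]
        constructor
        · rintro (h | h)
          · linarith [h.1, hy.1]
          · exact h.1
        · exact fun h => Or.inr ⟨h, rfl⟩
      refine ⟨D₁, hD₁, htop₁, fun k l h => ?_, fun k => ?_, hij₁, hoth⟩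
      · by_cases h1 : k = i ∧ l = j
        · rw [h1.1, h1.2] at h
          exact hc₂₁.ne ((hij₁ c₂ ⟨le_rfl, hc₂.le⟩).1 h)
        by_cases h2 : k = j ∧ l = i
        · rw [h2.1, h2.2] at h
          exact hc₂₁.ne ((hij₁ c₂ ⟨le_rfl, hc₂.le⟩).1 h.symm)
        exact hoth k l h1 h2 c₂ ⟨le_rfl, hc₂.le⟩ h
      · by_cases hki : k = i
        · subst hki
          rw [if_pos rfl]
          refine hRi.congr fun y l => ⟨fun h => ⟨by linarith [h.1], ?_⟩, fun h => ?_⟩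
          · exact (hi₁ y (by linarith [h.1]) l).2 (Or.inl h)
          · rcases (hi₁ y (by linarith [h.1]) l).1 h.2 with h' | h'
            · exact h'
            · linarith [h'.1, h.1]
        by_cases hkj : k = j
        · subst hkj
          rw [if_neg hki, if_pos rfl]
          refine hRj.congr fun y l => ⟨fun h => ⟨by linarith [h.1], ?_⟩, fun h => ?_⟩
          · exact (hj₁ y (by linarith [h.1]) l).2 (Or.inl h)
          · rcases (hj₁ y (by linarith [h.1]) l).1 h.2 with h' | h'
            · exact h'
            · linarith [h'.1, h.1]
        rw [if_neg hki, if_neg hkj]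
        refine (hL k).congr fun y l => ?_
        rw [hk₁ k hki hkj]
        exact ⟨fun h => ⟨by linarith [hlow ⟨k, l, h.2⟩ h.1], h.2⟩, fun h => ⟨by linarith [h.1], h.2⟩⟩
    obtain ⟨D₁, hD₁, ht₁, hc₁', hR₁, hij₁, hoth₁⟩ := step hc hL fun hy => hlow (Or.inl hy)
    obtain ⟨D₂, hD₂, ht₂, hc₂', hR₂, hij₂, hoth₂⟩ := step hc' hL' fun hy => hlow (Or.inr hy)
    have hcI : c ∈ Icc c 1 := ⟨le_rfl, hc1⟩
    have h1I : (1 : ℝ) ∈ Icc c 1 := ⟨hc1, le_rfl⟩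
    refine hD₁.trans (PlaneDiffeomorphic.trans ?_ hD₂.symm)
    refine ih _ ?_ (h0e.trans hec₂) (hc₂.le.trans hc1)
      (fun k => by rw [ht₁ k 1 h1I, ht₂ k 1 h1I, htop])
      (fun p q y hy => ?_) hc₁' hc₂' hR₁ hR₂ rfl
    · rw [← hN]
      refine Finset.sum_lt_sum (fun k _ => ?_) ⟨i, Finset.mem_univ _, ?_⟩
      · by_cases hki : k = i
        · subst hki; simp [hLi]
        by_cases hkj : k = j
        · subst hkj; simp [hLj, hki]
        simp [hki, hkj]
      · simp [hLi]
    · rcases le_or_gt c y with h | h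
      · rw [ht₁ p y ⟨h, hy.2⟩, ht₁ q y ⟨h, hy.2⟩, ht₂ p y ⟨h, hy.2⟩, ht₂ q y ⟨h, hy.2⟩]
        exact hlt p q y ⟨h, hy.2⟩
      have hyI : y ∈ Icc c₂ c := ⟨hy.1, h.le⟩
      have hc₁I : c₁ ∈ Ioo c₂ c := ⟨hc₂₁, hc₁⟩
      have hcc : ∀ p q, D₁.arc p c < D₁.arc q c ↔ D₂.arc p c < D₂.arc q c := fun p q => by
        rw [ht₁ p c hcI, ht₁ q c hcI, ht₂ p c hcI, ht₂ q c hcI]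
        exact hlt p q c hcI
      by_cases h1 : p = i ∧ q = j
      · rw [h1.1, h1.2, lt_iff_of_single_meets hij h0c₂ hc1 hc₁I hij₁ hyI,
          lt_iff_of_single_meets hij h0c₂ hc1 hc₁I hij₂ hyI, hcc, hcc]
      by_cases h2 : p = j ∧ q = i
      · have hs : ∀ {D : Diagram n} y, D.Meets j y i ↔ D.Meets i y j :=
          fun y => ⟨fun h => h.symm, fun h => h.symm⟩
        rw [h2.1, h2.2,
          lt_iff_of_single_meets hij.symm h0c₂ hc1 hc₁I (fun y hy => (hs y).trans (hij₁ y hy)) hyI,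
          lt_iff_of_single_meets hij.symm h0c₂ hc1 hc₁I (fun y hy => (hs y).trans (hij₂ y hy)) hyI,
          hcc, hcc]
      rw [lt_iff_of_not_meets h0c₂ hc1 (hoth₁ p q h1 h2) hyI,
        lt_iff_of_not_meets h0c₂ hc1 (hoth₂ p q h1 h2) hyI, hcc]

/-- Diagrams in which every arc meets the same arcs in the same sequence are diffeomorphic. -/
theorem planeDiffeomorphic_of_reads {D D' : Diagram n} {L : Fin n → List (Fin n)}
    (htop : ∀ i, D.arc i 1 = D'.arc i 1) (hL : ∀ i, Reads (D.Meets i) 1 (L i))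
    (hL' : ∀ i, Reads (D'.Meets i) 1 (L i)) : D.PlaneDiffeomorphic D' := by
  refine planeDiffeomorphic_of_reads_below one_pos le_rfl htop (fun i j y hy => ?_)
    (fun i j h => h.mem_Ioo.2.ne rfl) (fun i j h => h.mem_Ioo.2.ne rfl) hL hL'
  have : y = 1 := le_antisymm hy.2 hy.1
  rw [this, htop, htop]

end Diagram

/-! ### Reduced states of sequences of crossings. -/

section CrossingStates

variable {n : ℕ}

/-- Let each `i` with `μ i ≠ i` cross its partner `μ i`.  The state lists for each `i` the partners
of its crossings, latest first; two successive crossings of the same pair cancel. -/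
def crossPairs (μ : Fin n → Fin n) (L : Fin n → List (Fin n)) : Fin n → List (Fin n) := fun i =>
  if μ i = i then L i
  else if (L i).head? = some (μ i) ∧ (L (μ i)).head? = some i then (L i).tail
  else μ i :: L i

/-- States of reduced sequences of crossings. -/
structure IsReducedState (L : Fin n → List (Fin n)) : Prop where
  count_eq : ∀ i j, i ≠ j → (L i).count j = (L j).count i
  -- The counts number the crossings of the pair, earliest first. Equal counts would mean that the
  -- same two crossings are adjacent on both arcs, so this forbids exactly the uncancelled
  -- repetitions.
  no_repeat : ∀ i j, i ≠ j → ∀ l l', (j :: j :: l) <:+ L i → (i :: i :: l') <:+ L j →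
    l.count j ≠ l'.count i

theorem isReducedState_nil : IsReducedState (fun _ : Fin n => ([] : List (Fin n))) :=
  ⟨by simp, by simp⟩

theorem IsReducedState.crossPairs {μ : Fin n → Fin n} (hμ : ∀ i, μ (μ i) = i)
    {L : Fin n → List (Fin n)} (hL : IsReducedState L) : IsReducedState (crossPairs μ L) := by
  have hcount : ∀ i j, j ≠ μ i → (_root_.crossPairs μ L i).count j = (L i).count j := by
    intro i j hj
    simp only [_root_.crossPairs]
    split_ifs with h1 h2
    · rfl
    · obtain ⟨h2, -⟩ := h2
      rcases hLi : L i with _ | ⟨a, l⟩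
      · rfl
      · rw [hLi] at h2
        simp only [List.head?_cons, Option.some.injEq] at h2
        rw [List.tail_cons, List.count_cons_of_ne (by rw [h2]; exact hj.symm)]
    · rw [List.count_cons_of_ne hj.symm]
  have hsuf : ∀ i j, j ≠ μ i → ∀ l, (j :: l) <:+ _root_.crossPairs μ L i → (j :: l) <:+ L i := by
    intro i j hj l hl
    simp only [_root_.crossPairs] at hl
    split_ifs at hl with h1 h2
    · exact hl
    · exact hl.trans (List.tail_suffix _)
    · rcases List.suffix_cons_iff.1 hl with h | h
      · exact absurd (List.cons.inj h).1 hj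
      · exact h
  have hpop : ∀ i, μ i ≠ i → (L i).head? = some (μ i) → (L (μ i)).head? = some i →
      _root_.crossPairs μ L i = (L i).tail := fun i h1 h2 h3 => by
    simp only [_root_.crossPairs]; rw [if_neg h1, if_pos ⟨h2, h3⟩]
  have hpush : ∀ i, μ i ≠ i → ¬ ((L i).head? = some (μ i) ∧ (L (μ i)).head? = some i) →
      _root_.crossPairs μ L i = μ i :: L i := fun i h1 h2 => by
    simp only [_root_.crossPairs]; rw [if_neg h1, if_neg h2]
  refine ⟨fun i j hij => ?_, fun i j hij l l' hl hl' => ?_⟩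
  · by_cases hj : j = μ i
    · subst hj
      have hi := hμ i
      by_cases hp : (L i).head? = some (μ i) ∧ (L (μ i)).head? = some i
      · rw [hpop i hij.symm hp.1 hp.2, hpop (μ i) (by rw [hi]; exact hij) (by rw [hi]; exact hp.2)
          (by rw [hi]; exact hp.1)]
        have hc := hL.count_eq i (μ i) hij
        obtain ⟨l, hl⟩ := List.head?_eq_some_iff.1 hp.1
        obtain ⟨l', hl'⟩ := List.head?_eq_some_iff.1 hp.2
        rw [hl, hl'] at hc ⊢
        simpa using hc
      · rw [hpush i hij.symm hp, hpush (μ i) (by rw [hi]; exact hij)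
          (by rw [hi]; exact fun h => hp h.symm), hi]
        simpa using hL.count_eq i (μ i) hij
    · have hi : i ≠ μ j := fun h => hj (by rw [h, hμ])
      rw [hcount i j hj, hcount j i hi]
      exact hL.count_eq i j hij
  · by_cases hj : j = μ i
    · subst hj
      have hi := hμ i
      by_cases hp : (L i).head? = some (μ i) ∧ (L (μ i)).head? = some i
      · rw [hpop i hij.symm hp.1 hp.2] at hl
        rw [hpop (μ i) (by rw [hi]; exact hij) (by rw [hi]; exact hp.2)
          (by rw [hi]; exact hp.1)] at hl'
        exact hL.no_repeat i (μ i) hij l l' (hl.trans (List.tail_suffix _))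
          (hl'.trans (List.tail_suffix _))
      · rw [hpush i hij.symm hp] at hl
        rw [hpush (μ i) (by rw [hi]; exact hij) (by rw [hi]; exact fun h => hp h.symm), hi] at hl'
        have hc := hL.count_eq i (μ i) hij
        -- If the new crossing takes part in the repetition on both arcs, the heads matched and it
        -- would have been cancelled. If it does so on one arc only, the counts differ.
        rcases List.suffix_cons_iff.1 hl with h | h <;> rcases List.suffix_cons_iff.1 hl' with h' | h'
        · refine absurd ⟨?_, ?_⟩ hp
          · rw [← (List.cons.inj h).2]; rfl
          · rw [← (List.cons.inj h').2]; rfl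
        · have h1 := h'.sublist.count_le i
          rw [← (List.cons.inj h).2] at hc
          simp only [List.count_cons_self] at h1 hc
          omega
        · have h1 := h.sublist.count_le (μ i)
          rw [← (List.cons.inj h').2] at hc
          simp only [List.count_cons_self] at h1 hc
          omega
        · exact hL.no_repeat i (μ i) hij l l' h h'
    · have hi : i ≠ μ j := fun h => hj (by rw [h, hμ])
      exact hL.no_repeat i j hij l l' (hsuf i j hj _ hl) (hsuf j i hi _ hl')

open Classical in
/-- The part of the matching `μ` on the pairs satisfying `T`. -/
noncomputable def restrictPairs (μ : Fin n → Fin n) (T : Fin n → Prop) : Fin n → Fin n :=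
  fun i => if T i then μ i else i

theorem restrictPairs_involutive {μ : Fin n → Fin n} (hμ : ∀ i, μ (μ i) = i) {T : Fin n → Prop}
    (hT : ∀ i, T (μ i) ↔ T i) (i : Fin n) : restrictPairs μ T (restrictPairs μ T i) = i := by
  by_cases h : T i
  · simp [restrictPairs, h, hT, hμ]
  · simp [restrictPairs, h]

/-- Crossing a pair twice restores the state. A push is undone by a pop; after a pop the heads
cannot match again, since the state was reduced, so the second crossing pushes the removed entries
back. -/
theorem crossPairs_crossPairs {μ : Fin n → Fin n} (hμ : ∀ i, μ (μ i) = i)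
    {T T' T'' : Fin n → Prop} (hT : ∀ i, T (μ i) ↔ T i)
    (hT'' : ∀ i, T'' i ↔ ¬ (T i ↔ T' i)) {L : Fin n → List (Fin n)} (hL : IsReducedState L) :
    crossPairs (restrictPairs μ T') (crossPairs (restrictPairs μ T) L) =
      crossPairs (restrictPairs μ T'') L := by
  funext i
  by_cases hi : μ i = i
  · simp [crossPairs, restrictPairs, hi]
  by_cases h : T i <;> by_cases h' : T' i
  · by_cases hp : (L i).head? = some (μ i) ∧ (L (μ i)).head? = some i
    · obtain ⟨l, hl⟩ := List.head?_eq_some_iff.1 hp.1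
      obtain ⟨l', hl'⟩ := List.head?_eq_some_iff.1 hp.2
      have hno : ¬ (l.head? = some (μ i) ∧ l'.head? = some i) := by
        rintro ⟨h1, h2⟩
        obtain ⟨m, rfl⟩ := List.head?_eq_some_iff.1 h1
        obtain ⟨m', rfl⟩ := List.head?_eq_some_iff.1 h2
        have hc := hL.count_eq i (μ i) (Ne.symm hi)
        refine hL.no_repeat i (μ i) (Ne.symm hi) m m' (by rw [hl]) (by rw [hl']) ?_
        rw [hl, hl'] at hc
        simpa using hc
      simp [crossPairs, restrictPairs, h, h', hT, hT'', hμ, hi, Ne.symm hi, hl, hl', hno]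
    · have hp' : ¬ ((L (μ i)).head? = some i ∧ (L i).head? = some (μ i)) := fun h => hp h.symm
      simp [crossPairs, restrictPairs, h, h', hT, hT'', hμ, hi, Ne.symm hi, hp, hp']
  · simp [crossPairs, restrictPairs, h, h', hT'', hi]
  · simp [crossPairs, restrictPairs, h, h', hT, hT'', hi]
  · simp [crossPairs, restrictPairs, h, h', hT'']

/-- The points `i` and `j` are in the order of their indices. -/
def InOrder (x : Fin n → ℝ) (i j : Fin n) : Prop := x (min i j) < x (max i j)

theorem inOrder_comm (x : Fin n → ℝ) (i j : Fin n) : InOrder x i j ↔ InOrder x j i := by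
  rw [InOrder, InOrder, min_comm, max_comm]

open Classical in
/-- The partner with which `i` has to cross between `x` and `x'`. -/
noncomputable def crossingPartner (x x' : Fin n → ℝ) (i : Fin n) : Fin n :=
  if h : ∃ j, ¬ (InOrder x i j ↔ InOrder x' i j) then h.choose else i

/-- In the set `S`, only the pairs of the matching `μ` may cross. -/
structure IsMatched (μ : Fin n → Fin n) (S : Set (Fin n → ℝ)) : Prop where
  involutive : ∀ i, μ (μ i) = i
  ne : ∀ x ∈ S, ∀ i j, i ≠ j → j ≠ μ i → x i ≠ x j
  inOrder : ∀ x ∈ S, ∀ x' ∈ S, ∀ i j, j ≠ μ i → (InOrder x i j ↔ InOrder x' i j)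

/-- Within `S` only `μ i` can change its order with `i`, so the choice in `crossingPartner` is
forced. -/
theorem IsMatched.crossingPartner_eq {μ : Fin n → Fin n} {S : Set (Fin n → ℝ)}
    (h : IsMatched μ S) {x x' : Fin n → ℝ} (hx : x ∈ S) (hx' : x' ∈ S) :
    crossingPartner x x' =
      restrictPairs μ fun i => ¬ (InOrder x i (μ i) ↔ InOrder x' i (μ i)) := by
  funext i
  simp only [crossingPartner, restrictPairs]
  by_cases hex : ∃ j, ¬ (InOrder x i j ↔ InOrder x' i j)
  · have h1 : hex.choose = μ i := by
      by_contra hne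
      exact hex.choose_spec (h.inOrder x hx x' hx' i _ hne)
    have h2 := hex.choose_spec
    rw [dif_pos hex, h1, if_pos (by rwa [h1] at h2)]
  · rw [dif_neg hex, if_neg fun hn => hex ⟨_, hn⟩]

theorem IsMatched.pair_symm {μ : Fin n → Fin n} {S : Set (Fin n → ℝ)} (h : IsMatched μ S)
    (x x' : Fin n → ℝ) (i : Fin n) :
    (¬ (InOrder x (μ i) (μ (μ i)) ↔ InOrder x' (μ i) (μ (μ i)))) ↔
      ¬ (InOrder x i (μ i) ↔ InOrder x' i (μ i)) := by
  rw [h.involutive, inOrder_comm x, inOrder_comm x']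

/-- The sets of swapped pairs compose by symmetric difference, so transport within `S` does not
depend on the path. The points may have coincidences: `InOrder` counts a tie as not in order,
consistently for both members of the pair. -/
theorem IsMatched.crossPairs_comp {μ : Fin n → Fin n} {S : Set (Fin n → ℝ)} (h : IsMatched μ S)
    {x y z : Fin n → ℝ} (hx : x ∈ S) (hy : y ∈ S) (hz : z ∈ S) {L : Fin n → List (Fin n)}
    (hL : IsReducedState L) :
    crossPairs (crossingPartner y z) (crossPairs (crossingPartner x y) L) =
      crossPairs (crossingPartner x z) L := by
  rw [h.crossingPartner_eq hx hy, h.crossingPartner_eq hy hz, h.crossingPartner_eq hx hz]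
  exact crossPairs_crossPairs h.involutive (h.pair_symm x y) (fun i => by tauto) hL

theorem IsMatched.isReducedState {μ : Fin n → Fin n} {S : Set (Fin n → ℝ)} (h : IsMatched μ S)
    {x y : Fin n → ℝ} (hx : x ∈ S) (hy : y ∈ S) {L : Fin n → List (Fin n)}
    (hL : IsReducedState L) : IsReducedState (crossPairs (crossingPartner x y) L) := by
  rw [h.crossingPartner_eq hx hy]
  exact hL.crossPairs (restrictPairs_involutive h.involutive (h.pair_symm x y))

theorem crossPairs_crossingPartner_self (x : Fin n → ℝ) (L : Fin n → List (Fin n)) :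
    crossPairs (crossingPartner x x) L = L := by
  funext i
  simp [crossPairs, crossingPartner]

/-- The state reached along a sequence of points. -/
noncomputable def stateAlong (x : ℕ → Fin n → ℝ) : ℕ → Fin n → List (Fin n)
  | 0 => fun _ => []
  | k + 1 => crossPairs (crossingPartner (x k) (x (k + 1))) (stateAlong x k)

/-- The sequences are two sides of a ladder. By path independence in each square, the state along
`x'` is the state along `x` carried across the rung, and the first and last rungs are trivial. -/
theorem stateAlong_eq_of_squares {x x' : ℕ → Fin n → ℝ} (h0 : x 0 = x' 0)
    (h : ∀ k, ∃ μ S, IsMatched μ S ∧ x k ∈ S ∧ x (k + 1) ∈ S ∧ x' k ∈ S ∧ x' (k + 1) ∈ S) {N : ℕ}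
    (hN : x N = x' N) : stateAlong x N = stateAlong x' N := by
  have hred : ∀ k, IsReducedState (stateAlong x k) := by
    intro k
    induction k with
    | zero => exact isReducedState_nil
    | succ k ih =>
      obtain ⟨μ, S, hS, h1, h2, -, -⟩ := h k
      exact hS.isReducedState h1 h2 ih
  have key : ∀ k, stateAlong x' k = crossPairs (crossingPartner (x k) (x' k)) (stateAlong x k) := by
    intro k
    induction k with
    | zero => rw [h0, crossPairs_crossingPartner_self]; rfl
    | succ k ih =>
      obtain ⟨μ, S, hS, h1, h2, h3, h4⟩ := h k
      simp only [stateAlong]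
      rw [ih, hS.crossPairs_comp h1 h3 h4 (hred k), hS.crossPairs_comp h1 h2 h4 (hred k)]
  rw [key N, hN, crossPairs_crossingPartner_self]

/-- Near a point without triple coincidences only the coincident pairs may cross. -/
theorem exists_isMatched_nhds {x₀ : Fin n → ℝ}
    (h₀ : ∀ p q r, p ≠ q → q ≠ r → p ≠ r → ¬ (x₀ p = x₀ q ∧ x₀ q = x₀ r)) :
    ∃ μ S, IsMatched μ S ∧ IsOpen S ∧ x₀ ∈ S := by
  classical
  -- The partner is the other point at the same position, unique as there are no triples. Strict
  -- inequalities at `x₀` persist nearby and define the neighbourhood `S`.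
  let μ : Fin n → Fin n := fun i => if h : ∃ j, j ≠ i ∧ x₀ i = x₀ j then h.choose else i
  have hμ1 : ∀ i j, i ≠ j → x₀ i = x₀ j → μ i = j := by
    intro i j hij he
    have hex : ∃ j, j ≠ i ∧ x₀ i = x₀ j := ⟨j, hij.symm, he⟩
    have h1 : μ i = hex.choose := dif_pos hex
    have h2 := hex.choose_spec
    rw [← h1] at h2
    by_contra hne
    exact h₀ (μ i) i j h2.1 hij hne ⟨h2.2.symm, he⟩
  have hμ2 : ∀ i, μ i ≠ i → x₀ i = x₀ (μ i) := by
    intro i hi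
    by_cases hex : ∃ j, j ≠ i ∧ x₀ i = x₀ j
    · have h1 : μ i = hex.choose := dif_pos hex
      rw [h1]; exact hex.choose_spec.2
    · exact absurd (dif_neg hex) hi
  let S : Set (Fin n → ℝ) := {x | ∀ i j, x₀ i < x₀ j → x i < x j}
  have hlt : ∀ x ∈ S, ∀ i j, i ≠ j → j ≠ μ i → x i ≠ x j ∧ (x i < x j ↔ x₀ i < x₀ j) := by
    intro x hx i j hij hj
    have hne : x₀ i ≠ x₀ j := fun he => hj (hμ1 i j hij he).symm
    rcases hne.lt_or_gt with h | h
    · exact ⟨(hx i j h).ne, by simp [h, hx i j h]⟩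
    · exact ⟨(hx j i h).ne', by simp [h.not_gt, (hx j i h).not_gt]⟩
  have hinv : ∀ i, μ (μ i) = i := by
    intro i
    by_cases hi : μ i = i
    · rw [hi, hi]
    · exact hμ1 _ _ hi (hμ2 i hi).symm
  have hord : ∀ x ∈ S, ∀ i j, j ≠ μ i → (InOrder x i j ↔ InOrder x₀ i j) := by
    intro x hx i j hj
    by_cases hij : i = j
    · simp [InOrder, hij]
    · have hi : i ≠ μ j := fun h => hj (by rw [h, hinv])
      rcases le_total i j with h | h
      · simp only [InOrder, min_eq_left h, max_eq_right h]
        exact (hlt x hx i j hij hj).2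
      · simp only [InOrder, min_eq_right h, max_eq_left h]
        exact (hlt x hx j i (Ne.symm hij) hi).2
  refine ⟨μ, S, ⟨hinv, fun x hx i j hij hj => (hlt x hx i j hij hj).1,
    fun x hx x' hx' i j hj => (hord x hx i j hj).trans (hord x' hx' i j hj).symm⟩, ?_,
    fun i j h => h⟩
  have : S = ⋂ i, ⋂ j, ⋂ _ : x₀ i < x₀ j, {x | x i < x j} := by
    ext x; simp [S]
  rw [this]
  refine isOpen_iInter_of_finite fun i => isOpen_iInter_of_finite fun j =>
    isOpen_iInter_of_finite fun _ => ?_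
  exact isOpen_lt (continuous_apply i) (continuous_apply j)

/-- A Lebesgue number of the cover by the matched neighbourhoods. -/
theorem exists_forall_ball_isMatched {α : Type*} [PseudoMetricSpace α] [CompactSpace α]
    {h : α → Fin n → ℝ} (hh : Continuous h)
    (h₀ : ∀ z, ∀ p q r, p ≠ q → q ≠ r → p ≠ r → ¬ (h z p = h z q ∧ h z q = h z r)) :
    ∃ δ > 0, ∀ z, ∃ μ S, IsMatched μ S ∧ ∀ w ∈ Metric.ball z δ, h w ∈ S := by
  choose μ S hS hSo hxS using fun z => exists_isMatched_nhds (h₀ z)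
  obtain ⟨δ, hδ, hball⟩ := lebesgue_number_lemma_of_metric (isCompact_univ (X := α))
    (c := fun z => h ⁻¹' S z) (fun z => (hSo z).preimage hh)
    (fun z _ => mem_iUnion.2 ⟨z, hxS z⟩)
  refine ⟨δ, hδ, fun z => ?_⟩
  obtain ⟨z', hz'⟩ := hball z trivial
  exact ⟨μ z', S z', hS z', fun w hw => hz' hw⟩

end CrossingStates

/-! ### Homotopy invariance of the state. -/

namespace Configuration

variable {n : ℕ}

theorem exists_mesh_isMatched (C : Configuration n) : ∃ δ > 0, ∀ y ∈ Icc (0 : ℝ) 1,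
    ∃ μ S, IsMatched μ S ∧ ∀ z ∈ Icc (0 : ℝ) 1, |z - y| < δ → (fun i => C.arc i z) ∈ S := by
  obtain ⟨δ, hδ, h⟩ := exists_forall_ball_isMatched
    (h := fun (y : Icc (0 : ℝ) 1) i => C.arc i y)
    (continuous_pi fun i => (C.continuousOn i).comp_continuous continuous_subtype_val
      fun y => y.2) fun y p q r h1 h2 h3 => C.no_triple p q r h1 h2 h3 y y.2
  refine ⟨δ, hδ, fun y hy => ?_⟩
  obtain ⟨μ, S, hS, hb⟩ := h ⟨y, hy⟩
  exact ⟨μ, S, hS, fun z hz hd => hb ⟨z, hz⟩ hd⟩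

/-- The parameter interval is cut into steps shorter than a Lebesgue number for the whole square.
Each cell then lies in one matched set, and successive rows have equal final states because the ends
of the arcs are fixed. -/
theorem Equivalent.exists_mesh {C C' : Configuration n} (h : C.Equivalent C') :
    ∃ δ > 0, ∀ y : ℕ → ℝ, (∀ k, y k ∈ Icc (0 : ℝ) 1) → y 0 = 0 → (∀ k, |y (k + 1) - y k| < δ) →
      ∀ N, y N = 1 → stateAlong (fun k i => C.arc i (y k)) N =
        stateAlong (fun k i => C'.arc i (y k)) N := by
  obtain ⟨H, hc, h0, h1, he⟩ := h
  obtain ⟨δ, hδ, hball⟩ := exists_forall_ball_isMatched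
    (h := fun (z : Icc (0 : ℝ) 1 × Icc (0 : ℝ) 1) i => (H z.1).arc i z.2)
    (continuous_pi fun i => (hc i).comp_continuous
      (f := fun z : Icc (0 : ℝ) 1 × Icc (0 : ℝ) 1 => ((z.1 : ℝ), (z.2 : ℝ))) (by fun_prop)
      fun z => ⟨z.1.2, z.2.2⟩)
    fun z p q r h1 h2 h3 => (H z.1).no_triple p q r h1 h2 h3 z.2 z.2.2
  refine ⟨δ, hδ, fun y hy hy0 hyδ N hN => ?_⟩
  obtain ⟨M, hM⟩ := exists_nat_gt (1 / δ)
  have hM0 : (0 : ℝ) < M := (by positivity : 0 < 1 / δ).trans hM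
  have ht : ∀ a : ℕ, a ≤ M → (a : ℝ) / M ∈ Icc (0 : ℝ) 1 := fun a ha =>
    ⟨by positivity, (div_le_one hM0).2 (by exact_mod_cast ha)⟩
  have key : ∀ a : ℕ, a ≤ M → stateAlong (fun k i => (H 0).arc i (y k)) N =
      stateAlong (fun k i => (H ((a : ℝ) / M)).arc i (y k)) N := by
    intro a
    induction a with
    | zero => intro _; simp
    | succ a ih =>
      intro ha
      have ha' : a ≤ M := (Nat.le_succ a).trans ha
      rw [ih ha']
      have e1 := he _ (ht a ha')
      have e2 := he _ (ht (a + 1) ha)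
      refine stateAlong_eq_of_squares ?_ (fun k => ?_) ?_
      · funext i
        simp only [hy0]
        rw [(e1 i).1, (e2 i).1]
      · obtain ⟨μ, S, hS, hb⟩ := hball (⟨_, ht a ha'⟩, ⟨y k, hy k⟩)
        have hd1 : |((a + 1 : ℕ) : ℝ) / M - (a : ℝ) / M| < δ := by
          have : ((a + 1 : ℕ) : ℝ) / M - (a : ℝ) / M = 1 / M := by push_cast; ring
          rw [this, abs_of_pos (by positivity), div_lt_comm₀ hM0 hδ]
          exact hM
        have hmem : ∀ t (ht' : t ∈ Icc (0 : ℝ) 1) z (hz : z ∈ Icc (0 : ℝ) 1),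
            |t - (a : ℝ) / M| < δ → |z - y k| < δ → (fun i => (H t).arc i z) ∈ S := by
          intro t ht' z hz h1 h2
          refine hb (⟨t, ht'⟩, ⟨z, hz⟩) ?_
          rw [Metric.mem_ball, Prod.dist_eq]
          exact max_lt h1 h2
        refine ⟨μ, S, hS, hmem _ (ht a ha') _ (hy k) (by simpa) (by simpa),
          hmem _ (ht a ha') _ (hy (k + 1)) (by simpa) (hyδ k),
          hmem _ (ht (a + 1) ha) _ (hy k) hd1 (by simpa),
          hmem _ (ht (a + 1) ha) _ (hy (k + 1)) hd1 (hyδ k)⟩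
      · funext i
        simp only [hN]
        rw [(e1 i).2, (e2 i).2]
  have hfin := key M le_rfl
  rw [div_self hM0.ne'] at hfin
  have g0 : (fun k i => (H 0).arc i (y k)) = fun k i => C.arc i (y k) := by
    funext k i; exact h0 i (y k) (hy k)
  have g1 : (fun k i => (H 1).arc i (y k)) = fun k i => C'.arc i (y k) := by
    funext k i; exact h1 i (y k) (hy k)
  rw [← g0, ← g1]
  exact hfin

end Configuration

/-! ### Bigon-free diagrams are reduced. -/

namespace Diagram

variable {n : ℕ}

/-- Between two consecutive crossings of `i` and `j` neither arc would meet anything, and they would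
bound a bigon. -/
theorem BigonFree.eq_of_meets {D : Diagram n} (hD : D.BigonFree) {i j : Fin n} {c d : ℝ}
    (hi : ∀ y ∈ Icc c d, ∀ k, D.Meets i y k → k = j) (hj : ∀ y ∈ Icc c d, ∀ k, D.Meets j y k → k = i)
    {a b : ℝ} (ha : a ∈ Icc c d) (hb : b ∈ Icc c d) (hma : D.Meets i a j) (hmb : D.Meets i b j) :
    a = b := by
  wlog hab : a < b generalizing a b
  · rcases (not_lt.1 hab).eq_or_lt with h | h
    · exact h.symm
    · exact (this hb ha hmb hma h).symm
  exfalso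
  obtain ⟨e, ⟨hme, hae⟩, hmin⟩ := exists_min_image ({y | D.Meets i y j} ∩ Ioi a) id
    ((D.finite_meets i j).subset inter_subset_left) ⟨b, hmb, hab⟩
  have heb : e ≤ b := hmin b ⟨hmb, hab⟩
  have hno : ∀ y ∈ Ioo a e, ¬ D.Meets i y j := fun y hy hm => not_le.2 hy.2 (hmin y ⟨hm, hy.1⟩)
  have hsub : ∀ y ∈ Ioo a e, y ∈ Icc c d := fun y hy =>
    ⟨ha.1.trans hy.1.le, hy.2.le.trans (heb.trans hb.2)⟩
  obtain ⟨i', j', hbig⟩ := exists_isBigon hae hma hme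
    (fun k y hy hm => hno y hy (hi y (hsub y hy) k hm ▸ hm))
    (fun k y hy hm => hno y hy (hj y (hsub y hy) k hm ▸ hm).symm)
  exact hD _ _ _ _ hbig

/-- For a bigon-free diagram, the state along a fine subdivision consists of the lists of partners
of the arcs. -/
theorem BigonFree.reads_stateAlong {D : Diagram n} (hD : D.BigonFree) {y : ℕ → ℝ}
    (hy01 : ∀ k, y k ∈ Icc (0 : ℝ) 1) (hy0 : y 0 = 0) (hym : Monotone y)
    (hyE : ∀ k, y k ∉ D.heights)
    (hS : ∀ k, ∃ μ S, IsMatched μ S ∧ ∀ z ∈ Icc (y k) (y (k + 1)), (fun i => D.arc i z) ∈ S)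
    (k : ℕ) (i : Fin n) :
    Reads (D.Meets i) (y k) (stateAlong (fun k i => D.arc i (y k)) k i) := by
  induction k generalizing i with
  | zero =>
    refine Reads.nil fun z hz j hm => ?_
    rw [hy0] at hz
    exact not_lt.2 hm.2.1.1 hz
  | succ k ih =>
    obtain ⟨μ, S, hμ, hS⟩ := hS k
    have hle : y k ≤ y (k + 1) := hym k.le_succ
    have hsub : Icc (y k) (y (k + 1)) ⊆ Icc 0 1 := Icc_subset_Icc (hy01 k).1 (hy01 (k + 1)).2
    have hpart : ∀ i, ∀ z ∈ Icc (y k) (y (k + 1)), ∀ j, D.Meets i z j → j = μ i := by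
      intro i z hz j hm
      by_contra hne
      exact hμ.ne _ (hS z hz) i j hm.1 hne hm.2.2
    have hend : ∀ z ∈ Icc (y k) (y (k + 1)), ∀ i j, D.Meets i z j → z ∈ Ioo (y k) (y (k + 1)) := by
      intro z hz i j hm
      refine ⟨hz.1.lt_of_ne ?_, hz.2.lt_of_ne ?_⟩
      · rintro rfl; exact hyE k ⟨i, j, hm⟩
      · rintro rfl; exact hyE (k + 1) ⟨i, j, hm⟩
    simp only [stateAlong]
    set L := stateAlong (fun k i => D.arc i (y k)) k with hLdef
    rw [hμ.crossingPartner_eq (hS _ ⟨le_rfl, hle⟩) (hS _ ⟨hle, le_rfl⟩)]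
    set x := fun i => D.arc i (y k) with hx
    set x' := fun i => D.arc i (y (k + 1)) with hx'
    by_cases hex : ∃ z ∈ Icc (y k) (y (k + 1)), D.Meets i z (μ i)
    · obtain ⟨w, hw, hmw⟩ := hex
      have hw' := hend w hw _ _ hmw
      have hne : i ≠ μ i := hmw.1
      have hsingle : ∀ z ∈ Icc (y k) (y (k + 1)), D.Meets i z (μ i) ↔ z = w := fun z hz => by
        refine ⟨fun hm => ?_, fun h => h ▸ hmw⟩
        exact hD.eq_of_meets (hpart i) (fun z hz l hm => by
          rw [hpart (μ i) z hz l hm, hμ.involutive]) hz hw hm hmw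
      have hsingle' : ∀ z ∈ Icc (y k) (y (k + 1)), D.Meets (μ i) z i ↔ z = w := fun z hz => by
        rw [← hsingle z hz]; exact ⟨fun h => h.symm, fun h => h.symm⟩
      have hflip : ∀ p q, p ≠ q → (∀ z ∈ Icc (y k) (y (k + 1)), D.Meets p z q ↔ z = w) →
          ¬ (x p < x q ↔ x' p < x' q) := by
        intro p q hpq hs
        have h1 := lt_iff_of_single_meets hpq (hy01 k).1 (hy01 (k + 1)).2 hw' hs ⟨le_rfl, hle⟩
        have h2 : x' p ≠ x' q := fun h => hyE (k + 1) ⟨p, q, hpq, hy01 _, h⟩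
        simp only [hw'.1, hw'.1.not_gt, true_and, false_and, or_false] at h1
        change x p < x q ↔ x' q < x' p at h1
        rw [h1]
        rcases h2.lt_or_gt with h | h
        · simp [h, h.not_gt]
        · simp [h, h.not_gt]
      have hT : ¬ (InOrder x i (μ i) ↔ InOrder x' i (μ i)) := by
        rcases le_total i (μ i) with h | h
        · simp only [InOrder, min_eq_left h, max_eq_right h]
          exact hflip i (μ i) hne hsingle
        · simp only [InOrder, min_eq_right h, max_eq_left h]
          exact hflip (μ i) i hne.symm hsingle'
      have hr : restrictPairs μ (fun i => ¬ (InOrder x i (μ i) ↔ InOrder x' i (μ i))) i = μ i :=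
        if_pos hT
      -- A cancellation would mean that the previous crossing of both arcs is the one with each
      -- other; together with the crossing at `w` it bounds a bigon.
      have hhead : ¬ ((L i).head? = some (μ i) ∧ (L (μ i)).head? = some i) := by
        rintro ⟨h1, h2⟩
        obtain ⟨l, hl⟩ := List.head?_eq_some_iff.1 h1
        obtain ⟨l', hl'⟩ := List.head?_eq_some_iff.1 h2
        have r1 := ih i
        have r2 := ih (μ i)
        rw [hl] at r1
        rw [hl'] at r2
        obtain ⟨a, hay, hma, hlast, -, -⟩ := Configuration.exists_common_latest r1 r2
        have hcase : ∀ z ∈ Ioo a w, ∀ l, ¬ D.Meets i z l ∧ ¬ D.Meets (μ i) z l := by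
          intro z hz l
          rcases lt_or_ge z (y k) with h | h
          · exact hlast z hz.1 h l
          · have hzI : z ∈ Icc (y k) (y (k + 1)) := ⟨h, hz.2.le.trans hw.2⟩
            refine ⟨fun hm => ?_, fun hm => ?_⟩
            · have := hpart i z hzI l hm
              subst this
              exact hz.2.ne ((hsingle z hzI).1 hm)
            · have := hpart (μ i) z hzI l hm
              rw [hμ.involutive] at this
              subst this
              exact hz.2.ne ((hsingle' z hzI).1 hm)
        obtain ⟨p, q, hbig⟩ := exists_isBigon (hay.trans hw'.1) hma hmw
          (fun l z hz => (hcase z hz l).1) (fun l z hz => (hcase z hz l).2)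
        exact hD _ _ _ _ hbig
      simp only [crossPairs]
      rw [hr, if_neg hne.symm, if_neg hhead]
      refine Reads.cons hw'.2 hmw (fun z hwz hzy l hm => ?_) ((ih i).congr fun z l => ?_)
      · have hzI : z ∈ Icc (y k) (y (k + 1)) := ⟨hw.1.trans hwz.le, hzy.le⟩
        have := hpart i z hzI l hm
        subst this
        exact hwz.ne' ((hsingle z hzI).1 hm)
      · refine ⟨fun h => ⟨h.1.trans hw'.1, h.2⟩, fun h => ⟨?_, h.2⟩⟩
        by_contra hge
        have hzI : z ∈ Icc (y k) (y (k + 1)) := ⟨not_lt.1 hge, h.1.le.trans hw.2⟩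
        have := hpart i z hzI l h.2
        subst this
        exact h.1.ne ((hsingle z hzI).1 h.2)
    · push Not at hex
      have hnone : ∀ z ∈ Icc (y k) (y (k + 1)), ∀ j, ¬ D.Meets i z j := fun z hz j hm =>
        hex z hz (hpart i z hz j hm ▸ hm)
      have hT : InOrder x i (μ i) ↔ InOrder x' i (μ i) := by
        rcases le_total i (μ i) with h | h
        · simp only [InOrder, min_eq_left h, max_eq_right h]
          exact lt_iff_of_not_meets (hy01 k).1 (hy01 (k + 1)).2 hex ⟨le_rfl, hle⟩
        · simp only [InOrder, min_eq_right h, max_eq_left h]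
          exact lt_iff_of_not_meets (hy01 k).1 (hy01 (k + 1)).2 (fun z hz hm => hex z hz hm.symm)
            ⟨le_rfl, hle⟩
      have hr : restrictPairs μ (fun i => ¬ (InOrder x i (μ i) ↔ InOrder x' i (μ i))) i = i :=
        if_neg (not_not.2 hT)
      simp only [crossPairs]
      rw [hr, if_pos rfl]
      refine (ih i).congr fun z l => ⟨fun h => ⟨h.1.trans_le hle, h.2⟩, fun h => ⟨?_, h.2⟩⟩
      by_contra hge
      exact hnone z ⟨not_lt.1 hge, h.1.le⟩ l h.2

end Diagram

/-! ### A common subdivision and the uniqueness of reductions. -/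

/-- Fine subdivisions of `[0, 1]` that avoid a finite subset of `(0, 1)`. -/
theorem exists_subdivision_avoiding {E : Set ℝ} (hE : E.Finite) (hE1 : E ⊆ Ioo 0 1) {δ : ℝ}
    (hδ : 0 < δ) : ∃ y : ℕ → ℝ, (∀ k, y k ∈ Icc (0 : ℝ) 1) ∧ y 0 = 0 ∧ Monotone y ∧
      (∀ k, |y (k + 1) - y k| < δ) ∧ (∀ k, y k ∉ E) ∧ ∃ N, y N = 1 := by
  obtain ⟨M, hM⟩ := exists_nat_gt (1 / δ)
  have hM0 : (0 : ℝ) < M := (by positivity : 0 < 1 / δ).trans hM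
  have hcount : (⋃ k : ℕ, (fun e : ℝ => (k : ℝ) - M * e) '' E).Countable :=
    countable_iUnion fun k => (hE.image _).countable
  -- A shift outside a countable set keeps all points `(k - s) / M` off `E`.
  obtain ⟨s, hs, hs1⟩ := (hcount.dense_compl ℝ).exists_mem_open (isOpen_Ioo (a := (0 : ℝ)) (b := 1))
    ⟨1 / 2, by norm_num, by norm_num⟩
  have hkey : ∀ k : ℕ, ((k : ℝ) - s) / M ∉ E := by
    intro k hk
    refine hs (mem_iUnion.2 ⟨k, _, hk, ?_⟩)
    simp only
    field_simp
    ring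
  -- Clamping to `[0, 1]` only adds the values `0` and `1`, which are not in `E`. Since the shift
  -- lies in `(0, 1)`, the subdivision starts at `0` but is sure to reach `1` only at index `M + 1`.
  refine ⟨fun k => max 0 (min 1 (((k : ℝ) - s) / M)), fun k => ⟨le_max_left _ _,
    max_le zero_le_one (min_le_left _ _)⟩, ?_, ?_, fun k => ?_, fun k hk => ?_, M + 1, ?_⟩
  · have : ((0 : ℕ) - s) / M ≤ 0 :=
      div_nonpos_of_nonpos_of_nonneg (by push_cast; linarith [hs1.1]) hM0.le
    exact max_eq_left ((min_le_right _ _).trans this)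
  · intro k l hkl
    have : (k : ℝ) ≤ l := by exact_mod_cast hkl
    simp only
    gcongr
  · have h1 : (((k + 1 : ℕ) : ℝ) - s) / M = ((k : ℝ) - s) / M + 1 / M := by push_cast; ring
    have h2 : 1 / (M : ℝ) < δ := by rwa [div_lt_comm₀ hM0 hδ]
    have h3 : 0 < 1 / (M : ℝ) := by positivity
    simp only [h1]
    refine lt_of_le_of_lt ?_ h2
    rw [abs_le]
    constructor <;>
    rcases max_cases (0 : ℝ) (min 1 (((k : ℝ) - s) / M + 1 / M)) with h | h <;>
    rcases max_cases (0 : ℝ) (min 1 (((k : ℝ) - s) / M)) with h' | h' <;>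
    rcases min_cases (1 : ℝ) (((k : ℝ) - s) / M + 1 / M) with g | g <;>
    rcases min_cases (1 : ℝ) (((k : ℝ) - s) / M) with g' | g' <;>
    linarith [h.1, h.2, h'.1, h'.2, g.1, g.2, g'.1, g'.2]
  · have hIoo := hE1 hk
    have h1 : min 1 (((k : ℝ) - s) / M) = ((k : ℝ) - s) / M := by
      rcases min_cases (1 : ℝ) (((k : ℝ) - s) / M) with g | g
      · simp only [g.1] at hIoo
        have := hIoo.2
        simp at this
      · exact g.1
    simp only [h1] at hk hIoo
    rcases max_cases (0 : ℝ) (((k : ℝ) - s) / M) with g | g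
    · rw [g.1] at hIoo
      exact lt_irrefl _ hIoo.1
    · rw [g.1] at hk
      exact hkey k hk
  · have : 1 ≤ (((M + 1 : ℕ) : ℝ) - s) / M := by
      rw [one_le_div hM0]; push_cast; linarith [hs1.2]
    simp only [min_eq_left this]
    norm_num

/-- Equivalent bigon-free diagrams are diffeomorphic. -/
theorem Diagram.BigonFree.planeDiffeomorphic {n : ℕ} {R R' : Diagram n} (hR : R.BigonFree)
    (hR' : R'.BigonFree) (h : R.toConfiguration.Equivalent R'.toConfiguration) :
    R.PlaneDiffeomorphic R' := by
  obtain ⟨δ, hδ, hst⟩ := h.exists_mesh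
  obtain ⟨δ₁, hδ₁, h₁⟩ := R.exists_mesh_isMatched
  obtain ⟨δ₂, hδ₂, h₂⟩ := R'.exists_mesh_isMatched
  have hsub : ∀ D : Diagram n, D.heights ⊆ Ioo 0 1 := by
    rintro D y ⟨i, j, hm⟩
    exact hm.mem_Ioo
  -- One subdivision serves the homotopy and both diagrams, so the two states being compared are
  -- read at the same heights.
  obtain ⟨y, hy01, hy0, hym, hyδ, hyE, N, hN⟩ := exists_subdivision_avoiding
    (R.finite_heights.union R'.finite_heights) (union_subset (hsub R) (hsub R'))
    (lt_min hδ (lt_min hδ₁ hδ₂))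
  have hstrip : ∀ (C : Configuration n) (ε : ℝ), min δ (min δ₁ δ₂) ≤ ε → (∀ y ∈ Icc (0 : ℝ) 1,
      ∃ μ S, IsMatched μ S ∧ ∀ z ∈ Icc (0 : ℝ) 1, |z - y| < ε → (fun i => C.arc i z) ∈ S) →
      ∀ k, ∃ μ S, IsMatched μ S ∧ ∀ z ∈ Icc (y k) (y (k + 1)), (fun i => C.arc i z) ∈ S := by
    intro C ε hε hC k
    obtain ⟨μ, S, hμ, hS⟩ := hC (y k) (hy01 k)
    refine ⟨μ, S, hμ, fun z hz => hS z ⟨(hy01 k).1.trans hz.1, hz.2.trans (hy01 (k + 1)).2⟩ ?_⟩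
    refine lt_of_le_of_lt ?_ ((hyδ k).trans_le hε)
    rw [abs_of_nonneg (sub_nonneg.2 hz.1), abs_of_nonneg (sub_nonneg.2 (hz.1.trans hz.2))]
    linarith [hz.2]
  have hread := fun i => hR.reads_stateAlong hy01 hy0 hym (fun k hk => hyE k (Or.inl hk))
    (hstrip R.toConfiguration δ₁ ((min_le_right _ _).trans (min_le_left _ _)) h₁) N i
  have hread' := fun i => hR'.reads_stateAlong hy01 hy0 hym (fun k hk => hyE k (Or.inr hk))
    (hstrip R'.toConfiguration δ₂ ((min_le_right _ _).trans (min_le_right _ _)) h₂) N i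
  rw [hN] at hread hread'
  rw [← hst y hy01 hy0 (fun k => (hyδ k).trans_le (min_le_left _ _)) N hN] at hread'
  exact Diagram.planeDiffeomorphic_of_reads h.arc_one hread hread'

theorem theorem5 (n : ℕ) (p : Configuration n) :
    (∃ D : Diagram n, D.Represents p) ∧
    (∀ D : Diagram n, D.Represents p →
      ∃ R : Diagram n, D.IsReduction R ∧ R.Represents p) ∧
    (∀ D D' R R' : Diagram n, D.Represents p → D'.Represents p →
      D.IsReduction R → D'.IsReduction R' → R.PlaneDiffeomorphic R') := by
  refine ⟨Diagram.exists_represents p, fun D hD => ?_, fun D D' R R' hD hD' hR hR' => ?_⟩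
  · obtain ⟨R, hR⟩ := D.exists_isReduction
    exact ⟨R, hR, hD.of_reflTransGen hR.1⟩
  · exact hR.2.planeDiffeomorphic hR'.2
      ((hD.of_reflTransGen hR.1).symm.trans (hD'.of_reflTransGen hR'.1))
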